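/- **Setup.** Let $\Phi$ be an irreducible reduced root system spanning a Euclidean space $E$, with Weyl group $W$, base $\alpha_1,\dots,\alpha_r$, positive and negative roots $\Phi^{\pm}$, coroots $\alpha^\vee=2\alpha/\|\alpha\|^2$, simple reflections $s_i$, root lattice $Q$ and weight lattice $P=\{\lambda\in E:(\lambda,\alpha^\vee)\in\mathbb Z\ \forall\alpha\in\Phi\}$. Put $\Phi(w)=\Phi^+\cap w^{-1}\Phi^-$, $\ell(w)=\#\Phi(w)$, let $w_0$ be the longest element of $W$, and let $P^+\subset P$ be the set of dominant weights. Let $\mathbf Q:P\to\mathbb Q$ be a $W$-invariant quadratic form, integer valued on $Q$, with $\mathbf B(\lambda,\mu)=\mathbf Q(\lambda+\mu)-\mathbf Q(\lambda)-\mathbf Q(\mu)$, and let $n\ge 1$ be an integer. For $\alpha\in\Phi$ put $m(\alpha)=n/\gcd(n,\mathbf Q(\alpha))$ and $\alpha^m=m(\alpha)\alpha$. Let $P^m\subseteq P$ be the weight lattice of the root system $\Phi^m=\{\alpha^m\}_{\alpha\in\Phi}$ and $\rho^m=\frac12\sum_{\alpha\in\Phi^+}\alpha^m\in P^m$. Let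 $\mathrm{size}(\alpha^m)\in\{sh,lg\}$ be the size of $\alpha^m$ in $\Phi^m$ (all roots are long if they have equal length). Let $\mathbf k:\Phi\to\mathbb C^\times$, $\alpha\mapsto\mathbf k_\alpha$, be $W$-invariant, $\mathbf k_i=\mathbf k_{\alpha_i}$, and write $\mathbf k_y$ for the value of $\mathbf k$ at the roots $\alpha$ with $\mathrm{size}(\alpha^m)=y$. Let $g_j(y)\in\mathbb C^\times$ ($j\in\mathbb Z$, $y\in\{sh,lg\}$) depend on $j$ only modulo $n$ and satisfy $g_j(y)=-1$ if $n\mid j$, and $g_j(y)g_{n-j}(y)=\mathbf k_y^{-2}$ if $n\nmid j$ and $y$ is a size occurring in $\Phi^m$. Let $\mathbb C(P)$ and $\mathbb C(P^m)\subseteq\mathbb C(P)$ be the quotient fields of the group algebras $\mathbb C[P]=\bigoplus_{\lambda\in P}\mathbb Cx^\lambda$ and $\mathbb C[P^m]$, with the natural action of $W$ by field automorphisms, $w\,x^\lambda=x^{w\lambda}$. For $i=1,\dots,r$ let $\sigma(s_i)$ be the unique $\mathbb C$-linear operator on $\mathbb C(P)$ with $$\sigma(s_i)(fx^\lambda)=\frac{(1-\mathbf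 k_i^2)\,x^{e_i(\lambda)\alpha_i^m}}{1-\mathbf k_i^2x^{\alpha_i^m}}(s_if)x^\lambda+\mathbf k_i^2\,g_{\mathbf Q(\alpha_i)-\mathbf B(\lambda,\alpha_i)}(\mathrm{size}(\alpha_i^m))\,\frac{1-x^{-\alpha_i^m}}{1-\mathbf k_i^2x^{\alpha_i^m}}(s_if)x^{\alpha_i+s_i\lambda}$$ for all $f\in\mathbb C(P^m)$, $\lambda\in P$, where $e_i(\lambda)=\bigl(-(\lambda,\alpha_i^\vee)-t\bigr)/m(\alpha_i)$ and $t\in\{0,\dots,m(\alpha_i)-1\}$ is the remainder of $-(\lambda,\alpha_i^\vee)$ modulo $m(\alpha_i)$. With $$c_\alpha=\frac{1-\mathbf k_\alpha^2x^{\alpha^m}}{1-x^{\alpha^m}}\quad(\alpha\in\Phi),\qquad c_i=c_{\alpha_i},\qquad \tau(T_i)=\mathbf k_i+\mathbf k_i^{-1}c_i(\sigma(s_i)-1),$$ define the metaplectic Demazure–Lusztig operators $\mathcal T_i=-\mathbf k_i\,x^{\rho^m}\,\tau(T_i)^{-1}\,x^{-\rho^m}$ on $\mathbb C(P)$, elements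 of $\mathbb C(P)$ acting by multiplication. For a reduced expression $w=s_{i_1}\cdots s_{i_l}$ put $\mathcal T_w=\mathcal T_{i_1}\cdots\mathcal T_{i_l}$. **Theorem.** These objects are well defined: the operators $\sigma(s_i)$ extend to a representation $\sigma$ of $W$ on $\mathbb C(P)$, the operators $\tau(T_i)$ are invertible, and $\mathcal T_w$ does not depend on the reduced expression of $w$. As operators on $\mathbb C(P)$, $$\sum_{w\in W}\mathcal T_w=\Bigl(\prod_{\alpha\in\Phi^+}c_\alpha\Bigr)x^{\rho^m}\Bigl(\sum_{w\in W}(-1)^{\ell(w)}\sigma(w)\Bigr)x^{-\rho^m}=\Bigl(\prod_{\alpha\in\Phi^+}c_\alpha\Bigr)\sum_{w\in W}(-1)^{\ell(w)}\Bigl(\prod_{\alpha\in\Phi(w^{-1})}x^{\alpha^m}\Bigr)\sigma(w).$$ Consequently, for $\lambda\in P^+$ the metaplectic Whittaker function $$\widetilde{\mathcal W}_\lambda:=\Bigl(\prod_{\alpha\in\Phi^+}c_\alpha\Bigr)\sum_{w\in W}(-1)^{\ell(w)}\Bigl(\prod_{\alpha\in\Phi(w^{-1})}x^{\alpha^m}\Bigr)\sigma(w)(x^{w_0\lambda})$$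 satisfies $$\widetilde{\mathcal W}_\lambda=\sum_{w\in W}\mathcal T_w(x^{w_0\lambda}).$$ If moreover $\Lambda\subset E$ is a lattice with $Q\subseteq\Lambda\subseteq P$, then $\widetilde{\mathcal W}_\lambda\in\mathbb C[\Lambda]$ for all $\lambda\in\Lambda^+=P^+\cap\Lambda$. -/

import Mathlib

namespace Metaplectic

noncomputable section

/-- An irreducible reduced (crystallographic) root system `Φ` in a Euclidean space `E`, together with
a base. Roots are indexed by `ι` (injectively), the pairing of `E` with itself is the scalar
product, and the coroot of `α` is `2 α / ‖α‖ ^ 2`. -/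
structure BasedRootSystem (ι E : Type*) [Fintype ι] [NormedAddCommGroup E]
    [InnerProductSpace ℝ E] where
  R : RootPairing ι ℝ E E
  pairing_eq : ∀ x y : E, R.toLinearMap x y = inner ℝ x y
  coroot_eq : ∀ i, R.coroot i = (2 / ‖R.root i‖ ^ 2) • R.root i
  isRootSystem : R.IsRootSystem
  isCrystallographic : R.IsCrystallographic
  isReduced : R.IsReduced
  isIrreducible : R.IsIrreducible
  b : R.Base

namespace BasedRootSystem

attribute [instance] isRootSystem isCrystallographic isReduced isIrreducible

variable {ι E : Type*} [Fintype ι] [NormedAddCommGroup E] [InnerProductSpace ℝ E]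
  (S : BasedRootSystem ι E)

/-! ### Weyl group, lengths, reduced expressions -/

/-- The Weyl group. It acts on `E` by isometries and on the index set `ι` of the roots. -/
abbrev W : Type _ := S.R.weylGroup

lemma root_smul (w : S.W) (i : ι) : S.R.root (w • i) = w • S.R.root i :=
  RootPairing.Equiv.root_indexEquiv_eq_smul _ i (w : S.R.Aut)

lemma smul_eq_of_index {w w' : S.W} (h : ∀ i : ι, w • i = w' • i) : w = w' := by
  apply Subtype.ext
  apply RootPairing.Equiv.weightHom_injective S.R
  apply LinearEquiv.toLinearMap_injective
  apply LinearMap.ext_on_range (v := S.R.root) S.isRootSystem.span_root_eq_top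
  intro i
  have h1 := S.root_smul w i
  have h2 := S.root_smul w' i
  rw [h i] at h1
  exact h1.symm.trans h2

instance : Finite S.W :=
  Finite.of_injective (fun (w : S.W) (i : ι) => w • i)
    fun _ _ h => S.smul_eq_of_index fun i => congrFun h i

instance : Fintype S.W := Fintype.ofFinite _

/-- The index set of the simple roots. -/
abbrev I : Type _ := S.b.support

/-- The simple reflection `s_i`. -/
def s (i : S.I) : S.W := RootPairing.weylGroup.ofIdx S.R i

open Classical in
/-- The set of positive roots. -/
def posRoots : Finset ι := Finset.univ.filter fun i => S.b.IsPos i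

open Classical in
/-- `Φ(w) = Φ⁺ ∩ w⁻¹ Φ⁻`. -/
def inversions (w : S.W) : Finset ι := Finset.univ.filter fun i => S.b.IsPos i ∧ ¬ S.b.IsPos (w • i)

/-- The length of `w`. -/
def length (w : S.W) : ℕ := (S.inversions w).card

/-- The product `s_{i_1} ⋯ s_{i_l}` attached to a word in the simple reflections. -/
def wordProd (ω : List S.I) : S.W := (ω.map S.s).prod

/-- `ω` is a reduced expression of `w`. -/
def IsReducedWord (ω : List S.I) (w : S.W) : Prop := S.wordProd ω = w ∧ ω.length = S.length w

lemma exists_longest : ∃ w : S.W, ∀ w', S.length w' ≤ S.length w := Finite.exists_max S.length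

/-- The longest element of the Weyl group. -/
def w₀ : S.W := S.exists_longest.choose

/-! #### Existence of reduced expressions -/

/-- The pairing between `E` and coroots is invariant under the Weyl group. -/
lemma inner_smul_coroot (w : S.W) (x : E) (i : ι) :
    inner ℝ (w • x) (S.R.coroot (w • i)) = inner ℝ x (S.R.coroot i) := by
  obtain ⟨w, hw⟩ := w
  induction hw using RootPairing.weylGroup.induction generalizing x i with
  | mem j =>
    rw [← S.pairing_eq, ← S.pairing_eq]
    change S.R.coroot' (S.R.reflectionPerm j i) (S.R.reflection j x) = _
    rw [RootPairing.coroot'_reflection, RootPairing.reflectionPerm_self]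
    rfl
  | one => rfl
  | mul v w hv hw ihv ihw =>
    have h := ihv ((⟨w, hw⟩ : S.W) • x) ((⟨w, hw⟩ : S.W) • i)
    rw [ihw] at h
    exact h

lemma ofIdx_smul_eq (i : ι) (x : E) :
    (RootPairing.weylGroup.ofIdx S.R i : S.W) • x =
      x - (inner ℝ x (S.R.coroot i) : ℝ) • S.R.root i := by
  rw [← S.pairing_eq]
  exact S.R.reflection_apply i x

lemma mul_ofIdx (w : S.W) (i : ι) :
    w * RootPairing.weylGroup.ofIdx S.R i = RootPairing.weylGroup.ofIdx S.R (w • i) * w := by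
  refine S.smul_eq_of_index fun l => S.R.root.injective ?_
  rw [mul_smul, mul_smul, root_smul, root_smul, root_smul, root_smul, ofIdx_smul_eq,
    ofIdx_smul_eq, inner_smul_coroot, root_smul, smul_sub, smul_comm]

lemma s_smul_index (i : S.I) (j : ι) : S.s i • j = S.R.reflectionPerm i j := rfl

lemma s_mul_s (i : S.I) : S.s i * S.s i = 1 := by
  apply S.smul_eq_of_index
  intro j
  rw [mul_smul, s_smul_index, s_smul_index, RootPairing.reflectionPerm_self, one_smul]

lemma isPos_s_smul {i : S.I} {j : ι} (hj : S.b.IsPos j) (hne : j ≠ i) :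
    S.b.IsPos (S.s i • j) :=
  hj.reflectionPerm i.2 hne

lemma isPos_simple (i : S.I) : S.b.IsPos (i : ι) := RootPairing.Base.isPos_of_mem_support i.2

lemma isPos_smul_s_self (w : S.W) (i : S.I) :
    S.b.IsPos (w • (S.s i • (i : ι))) ↔ ¬ S.b.IsPos (w • (i : ι)) := by
  have h : w • (S.s i • (i : ι)) =
      S.R.reflectionPerm (w • (i : ι)) (w • (i : ι)) := by
    apply S.R.root.injective
    rw [root_smul, root_smul, RootPairing.root_reflectionPerm, RootPairing.reflection_apply_self,
      root_smul]
    have : S.s i • S.R.root i = - S.R.root i := S.R.reflection_apply_self i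
    rw [this, smul_neg]
  rw [h]
  exact RootPairing.Base.IsPos.neg_iff_not S.b (w • (i : ι))

lemma exists_word (w : S.W) : ∃ ω : List S.I, S.wordProd ω = w := by
  have hmul : ∀ w w' : S.W, (∃ ω : List S.I, S.wordProd ω = w) →
      (∃ ω : List S.I, S.wordProd ω = w') → ∃ ω : List S.I, S.wordProd ω = w * w' := by
    rintro _ _ ⟨ω, rfl⟩ ⟨ω', rfl⟩
    exact ⟨ω ++ ω', by simp [wordProd]⟩
  have hrefl : ∀ i : ι, ∃ ω : List S.I, S.wordProd ω = RootPairing.weylGroup.ofIdx S.R i := by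
    intro i
    refine S.b.induction_reflect i (p := fun i => ∃ ω : List S.I,
      S.wordProd ω = RootPairing.weylGroup.ofIdx S.R i) ?_ ?_ ?_
    · rintro i ⟨ω, hω⟩
      refine ⟨ω, hω.trans (S.smul_eq_of_index fun j => ?_)⟩
      apply S.R.root.injective
      rw [root_smul, root_smul]
      change S.R.reflection i _ = S.R.reflection (S.R.reflectionPerm i i) _
      rw [RootPairing.reflection_reflectionPerm]
      simp
    · intro i hi
      exact ⟨[⟨i, hi⟩], by simp [wordProd, s]⟩
    · intro i j hi hj
      have h : RootPairing.weylGroup.ofIdx S.R (S.R.reflectionPerm j i) =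
          S.s ⟨j, hj⟩ * (RootPairing.weylGroup.ofIdx S.R i * S.s ⟨j, hj⟩) := by
        refine S.smul_eq_of_index fun l => ?_
        apply S.R.root.injective
        rw [root_smul, root_smul, mul_smul, mul_smul]
        change S.R.reflection (S.R.reflectionPerm j i) _ = S.R.reflection j (S.R.reflection i
          (S.R.reflection j _))
        rw [RootPairing.reflection_reflectionPerm]
        rfl
      rw [h]
      have hsj : ∃ ω : List S.I, S.wordProd ω = S.s ⟨j, hj⟩ := ⟨[⟨j, hj⟩], by simp [wordProd]⟩
      exact hmul _ _ hsj (hmul _ _ hi hsj)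
  obtain ⟨w, hw⟩ := w
  induction hw using RootPairing.weylGroup.induction with
  | mem i => exact hrefl i
  | one => exact ⟨[], rfl⟩
  | mul x y hx hy ihx ihy => exact hmul ⟨x, hx⟩ ⟨y, hy⟩ ihx ihy

/-- If `w = s_{i_1} ⋯ s_{i_l}` maps the simple root `α_i` to a negative root, then `w s_i` is
obtained by deleting a letter. -/
lemma exists_delete (ω : List S.I) (i : S.I) (h : ¬ S.b.IsPos (S.wordProd ω • (i : ι))) :
    ∃ ω' : List S.I, S.wordProd ω' = S.wordProd ω * S.s i ∧ ω'.length < ω.length := by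
  induction ω with
  | nil => exact absurd (S.isPos_simple i) (by simpa [wordProd] using h)
  | cons j ω ih =>
    have hc : S.wordProd (j :: ω) = S.s j * S.wordProd ω := by simp [wordProd]
    by_cases hp : S.b.IsPos (S.wordProd ω • (i : ι))
    · have heq : S.wordProd ω • (i : ι) = j := by
        by_contra hne
        exact h (by rw [hc, mul_smul]; exact S.isPos_s_smul hp hne)
      refine ⟨ω, ?_, by simp⟩
      have hconj : S.wordProd ω * S.s i = S.s j * S.wordProd ω := by
        have := S.mul_ofIdx (S.wordProd ω) i
        rwa [heq] at this
      rw [hc, mul_assoc, hconj, ← mul_assoc, s_mul_s, one_mul]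
    · obtain ⟨ω', h1, h2⟩ := ih hp
      exact ⟨j :: ω', by rw [hc, mul_assoc, ← h1]; simp [wordProd], by simpa using h2⟩

lemma length_mul_s (w : S.W) (i : S.I) (h : ¬ S.b.IsPos (w • (i : ι))) :
    S.length (w * S.s i) + 1 = S.length w := by
  classical
  have hi : (i : ι) ∈ S.inversions w := by simp [inversions, h, S.isPos_simple i]
  have hss : ∀ j : ι, S.s i • S.s i • j = j := fun j => by rw [← mul_smul, s_mul_s, one_smul]
  have hinv : S.length (w * S.s i) = ((S.inversions w).erase i).card := by
    refine Finset.card_bij (fun j _ => S.s i • j) ?_ ?_ ?_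
    · intro j hj
      simp only [inversions, Finset.mem_filter, Finset.mem_univ, true_and, mul_smul] at hj
      have hne : j ≠ i := by
        rintro rfl
        exact hj.2 ((S.isPos_smul_s_self w i).2 h)
      simp only [inversions, Finset.mem_erase, Finset.mem_filter, Finset.mem_univ, true_and]
      refine ⟨?_, S.isPos_s_smul hj.1 hne, hj.2⟩
      intro he
      have h1 := (S.isPos_smul_s_self 1 i)
      rw [one_smul, one_smul, ← he, hss] at h1
      rw [he] at h1
      exact (h1.1 hj.1) (S.isPos_simple i)
    · intro a _ b _ hab
      simpa [hss] using congrArg (fun l => S.s i • l) hab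
    · intro j hj
      simp only [inversions, Finset.mem_erase, Finset.mem_filter, Finset.mem_univ, true_and] at hj
      refine ⟨S.s i • j, ?_, hss j⟩
      simp only [inversions, Finset.mem_filter, Finset.mem_univ, true_and, mul_smul, hss]
      exact ⟨S.isPos_s_smul hj.2.1 hj.1, hj.2.2⟩
  rw [hinv, Finset.card_erase_of_mem hi, length]
  have := Finset.card_pos.2 ⟨_, hi⟩
  omega

/-- Every element of the Weyl group has a reduced expression. -/
lemma exists_reducedWord (w : S.W) : ∃ ω : List S.I, S.IsReducedWord ω w := by
  classical
  induction hn : S.length w using Nat.strong_induction_on generalizing w with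
  | _ n ih =>
    by_cases h : ∃ i : S.I, ¬ S.b.IsPos (w • (i : ι))
    · obtain ⟨i, hi⟩ := h
      have hl := S.length_mul_s w i hi
      obtain ⟨ω, h1, h2⟩ := ih (S.length (w * S.s i)) (by omega) (w * S.s i) rfl
      refine ⟨ω ++ [i], ?_, ?_⟩
      · have : S.wordProd (ω ++ [i]) = S.wordProd ω * S.s i := by simp [wordProd]
        rw [this, h1, mul_assoc, s_mul_s, mul_one]
      · rw [List.length_append, h2, ← hl]
        rfl
    · push Not at h
      have hex : ∃ k, ∃ ω : List S.I, S.wordProd ω = w ∧ ω.length = k := by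
        obtain ⟨ω, hω⟩ := S.exists_word w
        exact ⟨_, ω, hω, rfl⟩
      obtain ⟨ω, hω, hk⟩ := Nat.find_spec hex
      rcases List.eq_nil_or_concat ω with rfl | ⟨ω', i, rfl⟩
      · subst hω
        exact ⟨[], rfl, by simp [wordProd, length, inversions]⟩
      · exfalso
        rw [List.concat_eq_append] at hω hk
        have hc : S.wordProd (ω' ++ [i]) = S.wordProd ω' * S.s i := by simp [wordProd]
        have hneg : ¬ S.b.IsPos (S.wordProd ω' • (i : ι)) := by
          have := h i
          rw [← hω, hc, mul_smul, S.isPos_smul_s_self] at this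
          exact this
        obtain ⟨ω'', h1, h2⟩ := S.exists_delete ω' i hneg
        have := Nat.find_min' hex ⟨ω'', by rw [h1, ← hc, hω], rfl⟩
        rw [← hk, List.length_append] at this
        omega

/-- A chosen reduced expression of `w`. -/
def redWord (w : S.W) : List S.I := (S.exists_reducedWord w).choose

/-! ### Weight lattice and root lattice -/

/-- The weight lattice `P = {λ ∈ E | (λ, α^∨) ∈ ℤ for all α ∈ Φ}`. -/
def weightLattice : AddSubgroup E where
  carrier := {x | ∀ i, ∃ z : ℤ, inner ℝ x (S.R.coroot i) = (z : ℝ)}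
  zero_mem' i := ⟨0, by simp⟩
  add_mem' {x y} hx hy i := by
    obtain ⟨a, ha⟩ := hx i
    obtain ⟨c, hc⟩ := hy i
    exact ⟨a + c, by rw [inner_add_left, ha, hc]; push_cast; rfl⟩
  neg_mem' {x} hx i := by
    obtain ⟨a, ha⟩ := hx i
    exact ⟨-a, by rw [inner_neg_left, ha]; push_cast; rfl⟩

/-- The weight lattice as a type. -/
abbrev P : Type _ := S.weightLattice

/-- The root lattice `Q = ℤ Φ`. -/
def rootLattice : AddSubgroup E := AddSubgroup.closure (Set.range S.R.root)

variable {S} in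
/-- The integer `(λ, α^∨)`. -/
def pair (lam : S.P) (i : ι) : ℤ := (lam.2 i).choose

variable {S} in
lemma pair_spec (lam : S.P) (i : ι) :
    inner ℝ (lam : E) (S.R.coroot i) = ((pair lam i : ℤ) : ℝ) := (lam.2 i).choose_spec

lemma root_mem_weightLattice (i : ι) : S.R.root i ∈ S.weightLattice := by
  intro j
  refine ⟨S.R.pairingIn ℤ i j, ?_⟩
  rw [← S.pairing_eq, RootPairing.root_coroot_eq_pairing]
  exact (S.R.algebraMap_pairingIn ℤ i j).symm

/-- The root `α` as an element of the weight lattice. -/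
def rootP (i : ι) : S.P := ⟨S.R.root i, S.root_mem_weightLattice i⟩

lemma smul_mem_weightLattice (w : S.W) {x : E} (hx : x ∈ S.weightLattice) :
    w • x ∈ S.weightLattice := by
  intro i
  obtain ⟨z, hz⟩ := hx (w⁻¹ • i)
  refine ⟨z, ?_⟩
  rw [← hz, ← S.inner_smul_coroot w x, smul_inv_smul]

/-- The Weyl group acts on the weight lattice. -/
instance : DistribMulAction S.W S.P where
  smul w lam := ⟨w • (lam : E), S.smul_mem_weightLattice w lam.2⟩
  one_smul lam := Subtype.ext (one_smul S.W (lam : E))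
  mul_smul w w' lam := Subtype.ext (mul_smul w w' (lam : E))
  smul_zero w := Subtype.ext (smul_zero (A := E) w)
  smul_add w lam mu := Subtype.ext (smul_add w (lam : E) (mu : E))

@[simp] lemma coe_smul (w : S.W) (lam : S.P) : ((w • lam : S.P) : E) = w • (lam : E) := rfl

lemma ofIdx_smul_P (i : ι) (lam : S.P) :
    (RootPairing.weylGroup.ofIdx S.R i : S.W) • lam = lam - pair lam i • S.rootP i := by
  apply Subtype.ext
  rw [coe_smul, ofIdx_smul_eq, pair_spec, Int.cast_smul_eq_zsmul]
  simp [rootP]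

lemma pair_add (lam mu : S.P) (i : ι) : pair (lam + mu) i = pair lam i + pair mu i := by
  have h : ((pair (lam + mu) i : ℤ) : ℝ) = ((pair lam i + pair mu i : ℤ) : ℝ) := by
    push_cast
    rw [← pair_spec, ← pair_spec, ← pair_spec, ← inner_add_left]
    rfl
  exact_mod_cast h

/-- `(·, α^∨)` as an additive map. -/
def pairHom (i : ι) : S.P →+ ℤ := AddMonoidHom.mk' (fun lam => pair lam i)
  fun lam mu => S.pair_add lam mu i

/-- Dominant weights. -/
def IsDominant (lam : S.P) : Prop := ∀ i : S.I, 0 ≤ pair lam i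

/-! ### The group algebra `ℂ[P]` and its quotient field `ℂ(P)` -/

instance : TwoUniqueSums S.P := by
  let _ : Module ℚ E := Module.compHom E (algebraMap ℚ ℝ)
  exact TwoUniqueSums.of_injective_addHom (S.weightLattice.subtype : S.P →ₙ+ E)
    Subtype.val_injective inferInstance

/-- The group algebra `ℂ[P]`. -/
abbrev A : Type _ := AddMonoidAlgebra ℂ S.P

instance : IsDomain S.A := NoZeroDivisors.to_isDomain _

/-- The field `ℂ(P)`, the quotient field of `ℂ[P]`. -/
abbrev K : Type _ := FractionRing S.A

/-- The monomial `x^λ`. -/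
def X (lam : S.P) : S.K := algebraMap S.A S.K (AddMonoidAlgebra.single lam 1)

lemma X_add (lam mu : S.P) : S.X (lam + mu) = S.X lam * S.X mu := by
  rw [X, X, X, ← map_mul, AddMonoidAlgebra.single_mul_single, one_mul]

lemma X_zero : S.X 0 = 1 := by
  rw [X, ← AddMonoidAlgebra.one_def, map_one]

lemma X_ne_zero (lam : S.P) : S.X lam ≠ 0 := by
  intro h
  have := S.X_add lam (-lam)
  rw [h, zero_mul, add_neg_cancel, X_zero] at this
  exact one_ne_zero this

lemma X_nsmul (k : ℕ) (lam : S.P) : S.X (k • lam) = S.X lam ^ k := by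
  induction k with
  | zero => simp [X_zero]
  | succ k ih => rw [succ_nsmul, X_add, ih, pow_succ]

/-- The Weyl group acts on `ℂ(P)` by field automorphisms, `w x^λ = x^{wλ}`. -/
def weylK (w : S.W) : S.K ≃ₐ[ℂ] S.K :=
  IsFractionRing.fieldEquivOfAlgEquiv ℂ S.K S.K
    (AddMonoidAlgebra.domCongr ℂ ℂ (DistribMulAction.toAddEquiv S.P w))

@[simp] lemma weylK_X (w : S.W) (lam : S.P) : S.weylK w (S.X lam) = S.X (w • lam) := by
  rw [weylK, X, IsFractionRing.fieldEquivOfAlgEquiv_algebraMap, AddMonoidAlgebra.domCongr_single]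
  rfl

/-- `ℂ[Λ] ⊆ ℂ(P)`, the span of the `x^λ` with `λ ∈ Λ`. -/
def groupAlg (Lam : AddSubgroup E) : Submodule ℂ S.K :=
  Submodule.span ℂ {f | ∃ lam : S.P, (lam : E) ∈ Lam ∧ f = S.X lam}

/-- Multiplication by `f` as a linear operator on `ℂ(P)`. -/
def mulOp (f : S.K) : Module.End ℂ S.K := LinearMap.mulLeft ℂ f

end BasedRootSystem

open BasedRootSystem

/-! ### The metaplectic structure -/

/-- The two root sizes. -/
inductive RootSize
  | sh
  | lg

/-- A `W`-invariant quadratic form `Q : P → ℚ`, integral on the root lattice, and `n ≥ 1`. -/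
structure MetaplecticStructure {ι E : Type*} [Fintype ι] [NormedAddCommGroup E]
    [InnerProductSpace ℝ E] (S : BasedRootSystem ι E) where
  Q : QuadraticMap ℤ S.P ℚ
  Q_smul : ∀ (w : S.W) (lam : S.P), Q (w • lam) = Q lam
  Q_integral : ∀ lam : S.P, (lam : E) ∈ S.rootLattice → ∃ z : ℤ, Q lam = z
  n : ℕ
  n_pos : 0 < n

namespace MetaplecticStructure

variable {ι E : Type*} [Fintype ι] [NormedAddCommGroup E] [InnerProductSpace ℝ E]
  {S : BasedRootSystem ι E} (D : MetaplecticStructure S)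

/-- The bilinear form `B(λ, μ) = Q(λ + μ) - Q(λ) - Q(μ)`. -/
def B (lam mu : S.P) : ℚ := D.Q (lam + mu) - D.Q lam - D.Q mu

/-- The integer `Q(α)`, `α` a root. -/
def Qroot (i : ι) : ℤ := (D.Q (S.rootP i)).num

/-- The integer `B(λ, α)`, `α` a root. -/
def Broot (lam : S.P) (i : ι) : ℤ := (D.B lam (S.rootP i)).num

lemma Qroot_cast (i : ι) : ((D.Qroot i : ℤ) : ℚ) = D.Q (S.rootP i) := by
  obtain ⟨z, hz⟩ := D.Q_integral (S.rootP i) (AddSubgroup.subset_closure ⟨i, rfl⟩)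
  rw [Qroot, hz, Rat.num_intCast]

lemma B_eq (lam : S.P) (i : ι) : D.B lam (S.rootP i) = D.Qroot i * pair lam i := by
  rw [Qroot_cast]
  have h1 := D.Q_smul (RootPairing.weylGroup.ofIdx S.R i) lam
  have h2 := D.Q_smul (RootPairing.weylGroup.ofIdx S.R i) (lam + S.rootP i)
  have hp : pair (S.rootP i) i = 2 := by
    have : ((pair (S.rootP i) i : ℤ) : ℝ) = 2 := by
      rw [← pair_spec, ← S.pairing_eq]
      exact S.R.root_coroot_two i
    exact_mod_cast this
  rw [ofIdx_smul_P] at h1 h2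
  rw [pair_add, hp] at h2
  have e2 : lam + S.rootP i - (pair lam i + 2) • S.rootP i
      = lam + (-(pair lam i + 1)) • S.rootP i := by module
  have e1 : lam - pair lam i • S.rootP i = lam + (-pair lam i) • S.rootP i := by module
  have key : ∀ c : ℤ, D.Q (lam + c • S.rootP i) =
      D.Q lam + c * c * D.Q (S.rootP i) + c * D.B lam (S.rootP i) := by
    intro c
    rw [QuadraticMap.map_add D.Q, QuadraticMap.map_smul, QuadraticMap.polar_smul_right]
    simp [B, QuadraticMap.polar]
  have k0 := key 1
  rw [e1, key] at h1
  rw [e2, key] at h2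
  rw [one_smul] at k0
  rw [k0] at h2
  push_cast at h1 h2
  linarith

lemma Broot_eq (lam : S.P) (i : ι) : D.Broot lam i = D.Qroot i * pair lam i := by
  rw [Broot, B_eq, ← Int.cast_mul, Rat.num_intCast]

lemma Broot_cast (lam : S.P) (i : ι) : ((D.Broot lam i : ℤ) : ℚ) = D.B lam (S.rootP i) := by
  rw [Broot_eq, B_eq]
  push_cast
  rfl

/-- `m(α) = n / gcd(n, Q(α))`. -/
def m (i : ι) : ℕ := D.n / Int.gcd D.n (D.Qroot i)

lemma m_pos (i : ι) : 0 < D.m i := by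
  have h : Int.gcd D.n (D.Qroot i) ∣ D.n := by
    exact_mod_cast Int.gcd_dvd_left (D.n : ℤ) (D.Qroot i)
  exact Nat.div_pos (Nat.le_of_dvd D.n_pos h) (Nat.pos_of_dvd_of_pos h D.n_pos)

lemma n_dvd (i : ι) : (D.n : ℤ) ∣ D.m i * D.Qroot i := by
  have h : Int.gcd D.n (D.Qroot i) ∣ D.n := by
    exact_mod_cast Int.gcd_dvd_left (D.n : ℤ) (D.Qroot i)
  obtain ⟨q, hq⟩ := Int.gcd_dvd_right (D.n : ℤ) (D.Qroot i)
  have h2 : (D.n : ℤ) = D.m i * (Int.gcd D.n (D.Qroot i) : ℤ) := by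
    exact_mod_cast (Nat.div_mul_cancel h).symm
  exact ⟨q, by rw [hq, ← mul_assoc, ← h2]⟩

/-- The root `α^m = m(α) α` of `Φ^m`, as an element of `E`. -/
def mrootE (i : ι) : E := (D.m i : ℝ) • S.R.root i

/-- The root `α^m = m(α) α` of `Φ^m`, as an element of `P`. -/
def mroot (i : ι) : S.P := D.m i • S.rootP i

lemma coe_mroot (i : ι) : (D.mroot i : E) = D.mrootE i := by
  simp [mroot, mrootE, rootP, Nat.cast_smul_eq_nsmul]

/-- The weight lattice `P^m` of `Φ^m`, as a subgroup of `P`: those `λ` with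
`(λ, 2 α^m / ‖α^m‖ ^ 2) ∈ ℤ` for all `α ∈ Φ`. -/
def Pm : AddSubgroup S.P where
  carrier := {lam | ∀ i, ∃ z : ℤ,
    inner ℝ (lam : E) ((2 / ‖D.mrootE i‖ ^ 2) • D.mrootE i) = (z : ℝ)}
  zero_mem' i := ⟨0, by simp⟩
  add_mem' {x y} hx hy i := by
    obtain ⟨a, ha⟩ := hx i
    obtain ⟨c, hc⟩ := hy i
    exact ⟨a + c, by rw [AddSubgroup.coe_add, inner_add_left, ha, hc]; push_cast; rfl⟩
  neg_mem' {x} hx i := by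
    obtain ⟨a, ha⟩ := hx i
    exact ⟨-a, by rw [AddSubgroup.coe_neg, inner_neg_left, ha]; push_cast; rfl⟩

lemma mem_Pm_iff (lam : S.P) : lam ∈ D.Pm ↔ ∀ i, (D.m i : ℤ) ∣ pair lam i := by
  refine forall_congr' fun i => ?_
  have hm : (D.m i : ℝ) ≠ 0 := by exact_mod_cast (D.m_pos i).ne'
  have h : inner ℝ (lam : E) ((2 / ‖D.mrootE i‖ ^ 2) • D.mrootE i) =
      (D.m i : ℝ)⁻¹ * (pair lam i : ℤ) := by
    rw [← pair_spec, S.coroot_eq, mrootE, norm_smul, inner_smul_right, inner_smul_right,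
      inner_smul_right, mul_pow, Real.norm_natCast]
    field_simp
  rw [h]
  constructor
  · rintro ⟨z, hz⟩
    refine ⟨z, ?_⟩
    rw [inv_mul_eq_iff_eq_mul₀ hm] at hz
    exact_mod_cast hz
  · rintro ⟨z, hz⟩
    refine ⟨z, ?_⟩
    rw [hz]
    push_cast
    rw [inv_mul_cancel_left₀ hm]

/-- The subfield `ℂ(P^m)` of `ℂ(P)`. -/
def Km : IntermediateField ℂ S.K := IntermediateField.adjoin ℂ (S.X '' (D.Pm : Set S.P))

open Classical in
/-- The size of the root `α^m` in `Φ^m`; all roots are long if they have the same length. -/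
def size (i : ι) : RootSize :=
  if ∃ j, ‖D.mrootE i‖ < ‖D.mrootE j‖ then RootSize.sh else RootSize.lg

/-- `(q(μ), α^{m∨}) = ((μ, α^∨) - r_{m(α)}((μ, α^∨))) / m(α)`, where `r_s(t) = t % s` is the
remainder of `t` modulo `s`. -/
def qPair (mu : S.P) (i : ι) : ℤ :=
  (pair mu i - pair mu i % D.m i) / D.m i

/-! #### The half sum of the positive roots of `Φ^m` -/

lemma Qroot_smul (w : S.W) (i : ι) : D.Qroot (w • i) = D.Qroot i := by
  have : S.rootP (w • i) = w • S.rootP i := Subtype.ext (S.root_smul w i)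
  rw [Qroot, Qroot, this, D.Q_smul]

lemma m_smul (w : S.W) (i : ι) : D.m (w • i) = D.m i := by rw [m, m, D.Qroot_smul]

/-- `ρ^m`, half the sum of the positive roots of `Φ^m`, as an element of `E`. -/
def rhoE : E := (2⁻¹ : ℝ) • ∑ i ∈ S.posRoots, D.mrootE i

lemma inner_rhoE (j : S.I) : inner ℝ D.rhoE (S.R.coroot j) = (D.m j : ℝ) := by
  classical
  have hj : (j : ι) ∈ S.posRoots := by simp [posRoots, S.isPos_simple j]
  have hss : ∀ l : ι, S.s j • S.s j • l = l := fun l => by rw [← mul_smul, s_mul_s, one_smul]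
  set T : E := ∑ i ∈ S.posRoots.erase j, D.mrootE i with hT
  have hmem : ∀ l ∈ S.posRoots.erase (j : ι), S.s j • l ∈ S.posRoots.erase (j : ι) := by
    intro l hl
    simp only [posRoots, Finset.mem_erase, Finset.mem_filter, Finset.mem_univ, true_and] at hl ⊢
    refine ⟨fun he => ?_, S.isPos_s_smul hl.2 hl.1⟩
    have h1 := (S.isPos_smul_s_self 1 j)
    rw [one_smul, one_smul, ← he, hss] at h1
    rw [he] at h1
    exact (h1.1 hl.2) (S.isPos_simple j)
  have hfix : S.s j • T = T := by
    rw [hT, Finset.smul_sum]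
    refine Finset.sum_nbij' (fun l => S.s j • l) (fun l => S.s j • l) hmem hmem
      (fun l _ => hss l) (fun l _ => hss l) ?_
    intro l _
    rw [mrootE, mrootE, m_smul, root_smul, smul_comm]
  have h0 : inner ℝ T (S.R.coroot j) = (0 : ℝ) := by
    have h := S.ofIdx_smul_eq j T
    have h' : S.s j • T = T - (inner ℝ T (S.R.coroot j) : ℝ) • S.R.root j := h
    rw [hfix] at h'
    have h2 : (inner ℝ T (S.R.coroot j) : ℝ) • S.R.root j = 0 := by
      rw [eq_comm, sub_eq_self] at h'
      exact h'
    exact (smul_eq_zero.1 h2).resolve_right (S.R.ne_zero j)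
  have h2 : inner ℝ (S.R.root j) (S.R.coroot j) = (2 : ℝ) := by
    rw [← S.pairing_eq]
    exact S.R.root_coroot_two j
  rw [rhoE, ← Finset.add_sum_erase _ _ hj, inner_smul_left, inner_add_left, ← hT, h0, mrootE,
    inner_smul_left, h2]
  simp
  ring

lemma rhoE_mem : D.rhoE ∈ S.weightLattice := by
  intro i
  have h := S.b.coroot_mem_span_int i
  generalize S.R.coroot i = y at h
  induction h using Submodule.span_induction with
  | mem x hx =>
    obtain ⟨j, hj, rfl⟩ := hx
    exact ⟨D.m j, by simpa using D.inner_rhoE ⟨j, hj⟩⟩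
  | zero => exact ⟨0, by simp⟩
  | add x y _ _ hx hy =>
    obtain ⟨a, ha⟩ := hx
    obtain ⟨c, hc⟩ := hy
    exact ⟨a + c, by rw [inner_add_right, ha, hc]; push_cast; rfl⟩
  | smul z x _ hx =>
    obtain ⟨a, ha⟩ := hx
    exact ⟨z * a, by rw [← Int.cast_smul_eq_zsmul ℝ, inner_smul_right, ha]; push_cast; rfl⟩

/-- `ρ^m`, half the sum of the positive roots of `Φ^m`, as an element of `P`. -/
def rho : S.P := ⟨D.rhoE, D.rhoE_mem⟩

end MetaplecticStructure

open MetaplecticStructure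

/-- The Hecke parameters, a `W`-invariant function `k : Φ → ℂˣ`, and the representation parameters
`g_j(y)`, `j ∈ ℤ`, `y ∈ {sh, lg}`. The condition `g_j(y) g_{n-j}(y) = k_y⁻²` for `j ∉ nℤ` is imposed
for the sizes `y` that occur in `Φ^m`; there `k_y` is the value of `k` at the roots `α` such that
`α^m` has size `y`. -/
structure Parameters {ι E : Type*} [Fintype ι] [NormedAddCommGroup E]
    [InnerProductSpace ℝ E] {S : BasedRootSystem ι E} (D : MetaplecticStructure S) where
  k : ι → ℂˣ
  k_smul : ∀ (w : S.W) (i : ι), k (w • i) = k i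
  g : ℤ → RootSize → ℂˣ
  g_of_dvd : ∀ (j : ℤ) (y : RootSize), (D.n : ℤ) ∣ j → g j y = -1
  g_mod : ∀ (j : ℤ) (y : RootSize), g j y = g (j % D.n) y
  g_mul : ∀ (i : ι) (j : ℤ), ¬ (D.n : ℤ) ∣ j →
    g j (D.size i) * g (D.n - j) (D.size i) = (k i ^ 2)⁻¹

/-! ### Existence and uniqueness of operators that are semilinear over `ℂ(P^m)` -/

namespace MetaplecticStructure

variable {ι E : Type*} [Fintype ι] [NormedAddCommGroup E] [InnerProductSpace ℝ E]
  {S : BasedRootSystem ι E} (D : MetaplecticStructure S)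

/-- `ℂ(P)` is spanned by the products `f x^λ` with `f ∈ ℂ(P^m)`. -/
lemma span_eq_top : Submodule.span ℂ {F | ∃ f ∈ D.Km, ∃ lam : S.P, F = f * S.X lam} = ⊤ := by
  set N : ℕ := ∏ i, D.m i with hN
  have hNpos : 0 < N := Finset.prod_pos fun i _ => D.m_pos i
  have hmemX : ∀ lam : S.P, S.X lam ^ N ∈ D.Km := by
    intro lam
    rw [← X_nsmul]
    refine IntermediateField.subset_adjoin _ _ ⟨_, ?_, rfl⟩
    refine (D.mem_Pm_iff _).2 fun i => ?_
    have h : pair (N • lam) i = N * pair lam i := by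
      have := map_nsmul (S.pairHom i) N lam
      simpa [pairHom] using this
    rw [h]
    exact Dvd.dvd.mul_right (by exact_mod_cast Finset.dvd_prod_of_mem D.m (Finset.mem_univ i)) _
  have hint : ∀ x ∈ Set.range S.X, IsAlgebraic D.Km x := by
    rintro _ ⟨lam, rfl⟩
    refine IsAlgebraic.of_pow hNpos ?_
    exact isAlgebraic_algebraMap (⟨_, hmemX lam⟩ : D.Km)
  have htop : IntermediateField.adjoin D.Km (Set.range S.X) = ⊤ := by
    rw [eq_top_iff]
    intro x _
    obtain ⟨a, c, hc, rfl⟩ := IsFractionRing.div_surjective (A := S.A) x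
    have hA : ∀ a : S.A, algebraMap S.A S.K a ∈ IntermediateField.adjoin D.Km (Set.range S.X) := by
      intro a
      induction a using AddMonoidAlgebra.induction_linear with
      | zero => rw [map_zero]; exact zero_mem _
      | add f g hf hg => rw [map_add]; exact add_mem hf hg
      | single lam c =>
        have : (AddMonoidAlgebra.single lam c : S.A) = c • AddMonoidAlgebra.single lam 1 := by
          simp
        rw [this, Algebra.algebraMap_eq_smul_one, smul_assoc, ← Algebra.algebraMap_eq_smul_one]
        have hX : S.X lam ∈ IntermediateField.adjoin D.Km (Set.range S.X) :=
          IntermediateField.subset_adjoin _ _ ⟨lam, rfl⟩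
        have hc : algebraMap ℂ S.K c ∈ IntermediateField.adjoin D.Km (Set.range S.X) :=
          IntermediateField.algebraMap_mem _ (algebraMap ℂ D.Km c)
        have := mul_mem hc hX
        rwa [← Algebra.smul_def] at this
    exact div_mem (hA a) (hA c)
  have hmul : ∀ x ∈ Submonoid.closure (Set.range S.X), x ∈ Set.range S.X := by
    intro x hx
    induction hx using Submonoid.closure_induction with
    | mem x hx => exact hx
    | one => exact ⟨0, S.X_zero⟩
    | mul x y _ _ hx hy =>
      obtain ⟨lam, rfl⟩ := hx
      obtain ⟨mu, rfl⟩ := hy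
      exact ⟨lam + mu, S.X_add lam mu⟩
  rw [eq_top_iff]
  intro x _
  have hx : x ∈ Algebra.adjoin D.Km (Set.range S.X) := by
    rw [← IntermediateField.adjoin_toSubalgebra_of_isAlgebraic hint, htop]
    trivial
  rw [← Subalgebra.mem_toSubmodule, Algebra.adjoin_eq_span] at hx
  induction hx using Submodule.span_induction with
  | mem x hx =>
    obtain ⟨lam, rfl⟩ := hmul x hx
    exact Submodule.subset_span ⟨1, one_mem _, lam, (one_mul _).symm⟩
  | zero => exact zero_mem _
  | add x y _ _ hx hy => exact add_mem (hx trivial) (hy trivial)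
  | smul a x _ hx =>
    have hx := hx trivial
    clear * - hx
    induction hx using Submodule.span_induction with
    | mem x hx =>
      obtain ⟨f, hf, lam, rfl⟩ := hx
      refine Submodule.subset_span ⟨a * f, mul_mem a.2 hf, lam, ?_⟩
      rw [mul_assoc]
      rfl
    | zero => rw [smul_zero]; exact zero_mem _
    | add x y _ _ hx hy => rw [smul_add]; exact add_mem hx hy
    | smul c x _ hx => rw [smul_comm]; exact Submodule.smul_mem _ _ hx

/-- There is an automorphism `x^λ ↦ z^{(λ, α^∨)} x^λ` of `ℂ(P)`. -/
lemma exists_twist (i : ι) (z : ℂˣ) : ∃ t : S.K →ₐ[ℂ] S.K,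
    ∀ lam : S.P, t (S.X lam) = ((z ^ pair lam i : ℂˣ) : ℂ) • S.X lam := by
  let c : ℂˣ → Multiplicative S.P →* ℂ := fun z =>
    { toFun := fun lam => ((z ^ pair lam.toAdd i : ℂˣ) : ℂ)
      map_one' := by
        have : pair (0 : S.P) i = 0 := map_zero (S.pairHom i)
        simp [this]
      map_mul' := fun lam mu => by
        rw [toAdd_mul, S.pair_add, zpow_add, Units.val_mul] }
  let f : ℂˣ → S.A →ₐ[ℂ] S.A := fun z =>
    AddMonoidAlgebra.lift ℂ S.A S.P
      { toFun := fun lam => AddMonoidAlgebra.single lam.toAdd (c z lam)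
        map_one' := by rw [(c z).map_one]; rfl
        map_mul' := fun lam mu => by
          rw [(c z).map_mul, toAdd_mul, AddMonoidAlgebra.single_mul_single] }
  have hf : ∀ z lam (a : ℂ), f z (AddMonoidAlgebra.single lam a) =
      AddMonoidAlgebra.single lam (a * ((z ^ pair lam i : ℂˣ) : ℂ)) := by
    intro z lam a
    simp [f, c, AddMonoidAlgebra.lift_single]
  have hinv : ∀ z a, f z⁻¹ (f z a) = a := by
    intro z a
    induction a using AddMonoidAlgebra.induction_linear with
    | zero => simp
    | add x y hx hy => rw [map_add, map_add, hx, hy]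
    | single lam a => rw [hf, hf, mul_assoc, ← Units.val_mul]; simp
  let e : S.A ≃ₐ[ℂ] S.A := AlgEquiv.ofAlgHom (f z) (f z⁻¹)
    (AlgHom.ext fun a => by simpa using hinv z⁻¹ a) (AlgHom.ext fun a => hinv z a)
  refine ⟨(IsFractionRing.fieldEquivOfAlgEquiv ℂ S.K S.K e : S.K →ₐ[ℂ] S.K), fun lam => ?_⟩
  have h : e (AddMonoidAlgebra.single lam 1) =
      ((z ^ pair lam i : ℂˣ) : ℂ) • AddMonoidAlgebra.single lam 1 := by
    change f z _ = _
    rw [hf]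
    simp
  change IsFractionRing.fieldEquivOfAlgEquiv ℂ S.K S.K e (S.X lam) = _
  rw [X, IsFractionRing.fieldEquivOfAlgEquiv_algebraMap, h, Algebra.algebraMap_eq_smul_one,
    smul_assoc, ← Algebra.algebraMap_eq_smul_one]

/-- An operator on `ℂ(P)` that multiplies `w(f x^λ)`, `f ∈ ℂ(P^m)`, by an element depending only on
`(λ, α^∨)` modulo `m(α)` exists and is unique. -/
lemma existsUnique_semilinear (i : ι) (w : S.W) (M : ℤ → S.K)
    (hM : ∀ c, M (c % D.m i) = M c) :
    ∃! T : Module.End ℂ S.K, ∀ f ∈ D.Km, ∀ lam : S.P,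
      T (f * S.X lam) = S.weylK w (f * S.X lam) * M (pair lam i) := by
  have hm0 : D.m i ≠ 0 := (D.m_pos i).ne'
  have hmC : (D.m i : ℂ) ≠ 0 := by exact_mod_cast hm0
  obtain ⟨ζ, hζ⟩ : ∃ ζ : ℂ, IsPrimitiveRoot ζ (D.m i) := ⟨_, Complex.isPrimitiveRoot_exp _ hm0⟩
  let z : ℂˣ := (hζ.isUnit hm0).unit
  have hz : IsPrimitiveRoot z (D.m i) := IsPrimitiveRoot.coe_units_iff.1 hζ
  choose t ht using fun k : ℕ => exists_twist (S := S) i (z ^ k)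
  have htK : ∀ k, ∀ f ∈ D.Km, t k f = f := by
    intro k f hf
    induction hf using IntermediateField.adjoin_induction with
    | mem x hx =>
      obtain ⟨lam, hlam, rfl⟩ := hx
      obtain ⟨q, hq⟩ := (D.mem_Pm_iff lam).1 hlam i
      rw [ht, hq, zpow_mul, zpow_natCast, ← pow_mul, mul_comm k, pow_mul, hz.pow_eq_one]
      simp
    | algebraMap x => exact (t k).commutes x
    | add x y _ _ hx hy => rw [map_add, hx, hy]
    | inv x _ hx => rw [map_inv₀, hx]
    | mul x y _ _ hx hy => rw [map_mul, hx, hy]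
  let T : Module.End ℂ S.K := ∑ c ∈ Finset.range (D.m i), LinearMap.mulRight ℂ (M c) ∘ₗ
    (S.weylK w).toLinearMap ∘ₗ
      ((D.m i : ℂ)⁻¹ • ∑ k ∈ Finset.range (D.m i),
        ((z ^ (-(k * c : ℤ)) : ℂˣ) : ℂ) • (t k).toLinearMap)
  have hT : ∀ f ∈ D.Km, ∀ lam : S.P,
      T (f * S.X lam) = S.weylK w (f * S.X lam) * M (pair lam i) := by
    intro f hf lam
    have hsum : ∀ c ∈ Finset.range (D.m i), (D.m i : ℂ)⁻¹ * ∑ k ∈ Finset.range (D.m i),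
        ((z ^ (-(k * c : ℤ)) : ℂˣ) : ℂ) * (((z ^ k) ^ pair lam i : ℂˣ) : ℂ) =
        if (c : ℤ) = pair lam i % D.m i then 1 else 0 := by
      intro c hc
      have h1 : ∀ k : ℕ, ((z ^ (-(k * c : ℤ)) : ℂˣ) : ℂ) * (((z ^ k) ^ pair lam i : ℂˣ) : ℂ) =
          (((z ^ (pair lam i - c) : ℂˣ) : ℂ)) ^ k := by
        intro k
        rw [← Units.val_mul, ← Units.val_pow_eq_pow_val]
        congr 1
        rw [← zpow_natCast z k, ← zpow_mul, ← zpow_add, ← zpow_natCast, ← zpow_mul]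
        congr 1
        ring
      simp_rw [h1]
      have hiff : z ^ (pair lam i - c) = 1 ↔ (c : ℤ) = pair lam i % D.m i := by
        rw [hz.zpow_eq_one_iff_dvd]
        have hc1 : (c : ℤ) % D.m i = c :=
          Int.emod_eq_of_lt (by positivity) (by exact_mod_cast Finset.mem_range.1 hc)
        constructor
        · intro h
          rw [← hc1]
          exact (Int.emod_eq_emod_iff_emod_sub_eq_zero.2 (Int.emod_eq_zero_of_dvd h)).symm
        · intro h
          exact Int.dvd_of_emod_eq_zero
            (Int.emod_eq_emod_iff_emod_sub_eq_zero.1 (hc1.trans h).symm)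
      split_ifs with h
      · rw [hiff.2 h]
        simp [hmC]
      · have hne : ((z ^ (pair lam i - c) : ℂˣ) : ℂ) ≠ 1 := by
          intro h'
          exact h (hiff.1 (Units.ext h'))
        have hp : ((z ^ (pair lam i - c) : ℂˣ) : ℂ) ^ D.m i = 1 := by
          rw [← Units.val_pow_eq_pow_val, ← zpow_natCast, ← zpow_mul, mul_comm, zpow_mul,
            zpow_natCast, hz.pow_eq_one, one_zpow, Units.val_one]
        rw [geom_sum_eq hne, hp]
        simp
    have hterm : ∀ c ∈ Finset.range (D.m i),
        ((D.m i : ℂ)⁻¹ • ∑ k ∈ Finset.range (D.m i),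
          ((z ^ (-(k * c : ℤ)) : ℂˣ) : ℂ) • (t k).toLinearMap) (f * S.X lam) =
        (if (c : ℤ) = pair lam i % D.m i then (1 : ℂ) else 0) • (f * S.X lam) := by
      intro c hc
      rw [← hsum c hc, LinearMap.smul_apply, LinearMap.sum_apply, mul_smul, Finset.sum_smul]
      congr 1
      refine Finset.sum_congr rfl fun k _ => ?_
      rw [LinearMap.smul_apply, mul_smul, AlgHom.toLinearMap_apply, map_mul, htK k f hf, ht,
        mul_smul_comm]
    have hr0 : 0 ≤ pair lam i % D.m i := Int.emod_nonneg _ (by exact_mod_cast hm0)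
    have hr1 : pair lam i % D.m i < D.m i := Int.emod_lt_of_pos _ (by exact_mod_cast D.m_pos i)
    obtain ⟨r, hr⟩ := Int.eq_ofNat_of_zero_le hr0
    have hrmem : r ∈ Finset.range (D.m i) := by
      rw [Finset.mem_range]
      omega
    simp only [T, LinearMap.sum_apply, LinearMap.comp_apply]
    rw [Finset.sum_eq_single_of_mem r hrmem]
    · rw [hterm r hrmem, if_pos hr.symm, one_smul, ← hM (pair lam i), hr]
      rfl
    · intro c hc hne
      rw [hterm c hc, if_neg (by rw [hr]; exact_mod_cast hne), zero_smul, map_zero, map_zero]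
  refine ⟨T, hT, fun T' hT' => ?_⟩
  refine LinearMap.ext_on (s := {F | ∃ f ∈ D.Km, ∃ lam : S.P, F = f * S.X lam}) D.span_eq_top ?_
  rintro _ ⟨f, hf, lam, rfl⟩
  rw [hT' f hf, hT f hf]

end MetaplecticStructure

namespace Parameters

variable {ι E : Type*} [Fintype ι] [NormedAddCommGroup E] [InnerProductSpace ℝ E]
  {S : BasedRootSystem ι E} {D : MetaplecticStructure S} (p : Parameters D)

/-- `𝐤_α ^ 2`, as an element of `ℂ(P)`. -/
def ksq (i : ι) : S.K := algebraMap ℂ S.K ((p.k i : ℂ) ^ 2)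

/-- The `c`-function `c_α = (1 - k_α² x^{α^m}) / (1 - x^{α^m})`. -/
def c (i : ι) : S.K := (1 - p.ksq i * S.X (D.mroot i)) / (1 - S.X (D.mroot i))

/-- The right hand side of the formula for `σ(s_i)(f x^λ)`. -/
def sigmaFormula (i : S.I) (f : S.K) (lam : S.P) : S.K :=
  (1 - p.ksq i) * S.X (D.qPair (-lam) i • D.mroot i) / (1 - p.ksq i * S.X (D.mroot i)) *
      S.weylK (S.s i) f * S.X lam +
    p.ksq i * algebraMap ℂ S.K (p.g (D.Qroot i - D.Broot lam i) (D.size i)) *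
      ((1 - S.X (-D.mroot i)) / (1 - p.ksq i * S.X (D.mroot i))) *
      S.weylK (S.s i) f * S.X (S.rootP i + S.s i • lam)

lemma existsUnique_sigma (i : S.I) : ∃! T : Module.End ℂ S.K,
    ∀ f ∈ D.Km, ∀ lam : S.P, T (f * S.X lam) = p.sigmaFormula i f lam := by
  let M : ℤ → S.K := fun a =>
    (1 - p.ksq i) / (1 - p.ksq i * S.X (D.mroot i)) * S.X ((-((-a) % D.m i)) • S.rootP i) +
    p.ksq i * algebraMap ℂ S.K (p.g (D.Qroot i - D.Qroot i * a) (D.size i)) *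
      ((1 - S.X (-D.mroot i)) / (1 - p.ksq i * S.X (D.mroot i))) * S.X (S.rootP i)
  have hM : ∀ a, M (a % D.m i) = M a := by
    intro a
    have h1 : (-(a % D.m i)) % (D.m i : ℤ) = (-a) % D.m i := (Int.mod_modEq a (D.m i)).neg
    have h2 : p.g (D.Qroot i - D.Qroot i * (a % D.m i)) (D.size i) =
        p.g (D.Qroot i - D.Qroot i * a) (D.size i) := by
      rw [p.g_mod, p.g_mod (D.Qroot i - D.Qroot i * a)]
      congr 1
      apply Int.emod_eq_emod_iff_emod_sub_eq_zero.2
      apply Int.emod_eq_zero_of_dvd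
      have e : D.Qroot i - D.Qroot i * (a % D.m i) - (D.Qroot i - D.Qroot i * a) =
          D.m i * D.Qroot i * (a / D.m i) := by
        have := Int.emod_add_mul_ediv a (D.m i)
        linear_combination D.Qroot i * (-1 : ℤ) * this
      rw [e]
      exact Dvd.dvd.mul_right (D.n_dvd i) _
    simp only [M, h1, h2]
  obtain ⟨T, hT, huniq⟩ := D.existsUnique_semilinear i (S.s i) M hM
  have hform : ∀ f, ∀ lam : S.P,
      S.weylK (S.s i) (f * S.X lam) * M (pair lam i) = p.sigmaFormula i f lam := by
    intro f lam
    have hneg : pair (-lam) i = - pair lam i := map_neg (S.pairHom i) lam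
    have hs : S.s i • lam = lam - pair lam i • S.rootP i := S.ofIdx_smul_P i lam
    have hX1 : S.X (S.s i • lam) * S.X ((-((-pair lam i) % D.m i)) • S.rootP i) =
        S.X (D.qPair (-lam) i • D.mroot i) * S.X lam := by
      rw [← X_add, ← X_add]
      congr 1
      have hq : D.qPair (-lam) i * (D.m i : ℤ) = -pair lam i - (-pair lam i) % D.m i := by
        rw [MetaplecticStructure.qPair, hneg]
        exact Int.ediv_mul_cancel Int.dvd_self_sub_emod
      rw [hs, mroot, ← natCast_zsmul, smul_smul, hq]
      module
    have hX2 : S.X (S.s i • lam) * S.X (S.rootP i) = S.X (S.rootP i + S.s i • lam) := by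
      rw [X_add, mul_comm]
    rw [sigmaFormula, Broot_eq, map_mul, weylK_X, ← hX2]
    simp only [M]
    linear_combination ((1 - p.ksq i) / (1 - p.ksq i * S.X (D.mroot i)) *
      S.weylK (S.s i) f) * hX1
  refine ⟨T, fun f hf lam => (hT f hf lam).trans (hform f lam), fun T' hT' => ?_⟩
  exact huniq T' fun f hf lam => (hT' f hf lam).trans (hform f lam).symm

/-- The operator `σ(s_i)` on `ℂ(P)`: the unique linear operator given by the metaplectic
(Chinta--Gunnells) formula on the elements `f x^λ`, `f ∈ ℂ(P^m)`, `λ ∈ P`. -/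
def sigmaSimple (i : S.I) : Module.End ℂ S.K := (p.existsUnique_sigma i).choose

/-- The operator `σ(w) = σ(s_{i_1}) ⋯ σ(s_{i_l})` for a reduced expression
`w = s_{i_1} ⋯ s_{i_l}`. -/
def sigma (w : S.W) : Module.End ℂ S.K := ((S.redWord w).map p.sigmaSimple).prod

/-- The operator `τ(T_i) = k_i + k_i⁻¹ c_i (σ(s_i) - 1)` by which the generator `T_i` of the localized
affine Hecke algebra acts on `ℂ(P)`. -/
def tauT (i : S.I) : Module.End ℂ S.K :=
  (p.k i : ℂ) • 1 + S.mulOp (algebraMap ℂ S.K (p.k i : ℂ)⁻¹ * p.c i) * (p.sigmaSimple i - 1)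

/-- The metaplectic Demazure--Lusztig operator `𝒯_i = -k_i x^{ρ^m} τ(T_i)⁻¹ x^{-ρ^m}`. -/
def DL (i : S.I) : Module.End ℂ S.K :=
  -(p.k i : ℂ) • (S.mulOp (S.X D.rho) * Ring.inverse (p.tauT i) * S.mulOp (S.X (-D.rho)))

/-- `𝒯_w = 𝒯_{i_1} ⋯ 𝒯_{i_l}` for a reduced expression `w = s_{i_1} ⋯ s_{i_l}`. -/
def DLW (w : S.W) : Module.End ℂ S.K := ((S.redWord w).map p.DL).prod

/-- `∏_{α ∈ Φ⁺} c_α`. -/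
def cProd : S.K := ∏ i ∈ S.posRoots, p.c i

/-- The metaplectic Whittaker function
`W̃_λ = (∏_{α > 0} c_α) ∑_w (-1)^{ℓ(w)} (∏_{α ∈ Φ(w⁻¹)} x^{α^m}) σ(w)(x^{w₀ λ})`. -/
def whittaker (lam : S.P) : S.K :=
  p.cProd * ∑ w : S.W, (-1) ^ S.length w * (∏ i ∈ S.inversions w⁻¹, S.X (D.mroot i)) *
    p.sigma w (S.X (S.w₀ • lam))

end Parameters

end

end Metaplectic

namespace Metaplectic

noncomputable section

/-! The starting point is semilinearity: `σ(s_i)` passes a factor `f ∈ ℂ(P^m)` as `s_i f`. For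
`τ(T_i)` this becomes the Bernstein relation `tauT_mul`. With weights shifted by `η = ρ - ρ^m`,
`τ(T_i)` has the shape familiar from Hecke algebra modules. If `0 ≤ (λ, α_i^∨) ≤ m(α_i)`, then
`x^{λ+η}` goes to a nonzero multiple of `x^{s_i λ+η}` (`tauT_X_of_le`). In the mirror range the
inverse scalar and a diagonal term `k_i - k_i⁻¹` appear (`tauT_X_of_neg`); this is where `g_j
g_{n-j} = k⁻²` enters. Translating by multiples of `α_i^m` then gives the quadratic relation, hence
invertibility.

For the braid relations let `d` be the difference of the two sides. The quadratic relations alone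
make `d` anticommute with the `τ(T_i)` up to inversion (`defect_mul_left`). Together with the
Bernstein relation they give `d x^ν = x^{Vν} d` for `ν` in the span of `α_i^m, α_j^m`, with `V` the
longest element of the dihedral group (`mroot_mem_defectComm`). On small dominant weights `d`
vanishes by direct computation. The anticommutation spreads this over dihedral orbits, translation
by the lattice reaches all monomials (`defect_X`), and linearity over the `W`-invariants of `ℂ(P^m)`
gives `d = 0` (`eq_zero_of_X`).

That `σ` is a representation is deduced afterwards. Every product of operators `σ(s_i)` lies in the
span over `ℂ(P^m)` of the well defined operators `τ(T_w)`. An element of this span is determined by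
its restriction to `ℂ(P^m) x^η` (`eq_zero_of_restrict`), and there `σ(s_i)` is just the automorphism
`s_i`, since it fixes `x^η`.

For the sum formula, `∑_w 𝒯_w` is an eigenvector of left multiplication by each `𝒯_i`, with
eigenvalue `k_i²` (`DL_mul_sum`). In the basis `σ(v)` this is a recursion relating the coefficients
at `v` and `s_i v`, so one coefficient determines all of them. At `w₀` only `𝒯_{w₀}` contributes,
with a computable leading coefficient, and the proposed closed form satisfies the same recursion
(`sumCoef_s_mul`). Polynomiality holds because each `𝒯_i` preserves `ℂ[Λ]`: the denominators combine
into finite geometric sums (`DL_X`). -/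

/-- The alternating list `[i, j, i, …]` of length `n`. -/
def altList {α : Type*} (i j : α) : ℕ → List α
  | 0 => []
  | n + 1 => i :: altList j i n

@[simp] lemma length_altList {α : Type*} (i j : α) (n : ℕ) : (altList i j n).length = n := by
  induction n generalizing i j with
  | zero => rfl
  | succ n ih => simp [altList, ih]

namespace BasedRootSystem

variable {ι E : Type*} [Fintype ι] [NormedAddCommGroup E] [InnerProductSpace ℝ E]
  (S : BasedRootSystem ι E)

/-! ### Lengths and left descents -/

lemma s_inv (i : S.I) : (S.s i)⁻¹ = S.s i := inv_eq_of_mul_eq_one_left (S.s_mul_s i)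

lemma s_mul_s_cancel (i : S.I) (w : S.W) : S.s i * (S.s i * w) = w := by
  rw [← mul_assoc, s_mul_s, one_mul]

lemma wordProd_nil : S.wordProd [] = 1 := rfl

lemma wordProd_cons (i : S.I) (ω : List S.I) : S.wordProd (i :: ω) = S.s i * S.wordProd ω := by
  simp [wordProd]

lemma wordProd_append (ω ω' : List S.I) :
    S.wordProd (ω ++ ω') = S.wordProd ω * S.wordProd ω' := by
  simp [wordProd]

/-- The index of the root `-α`. -/
def negIdx (i : ι) : ι := S.R.reflectionPerm i i

lemma root_negIdx (i : ι) : S.R.root (S.negIdx i) = - S.R.root i := by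
  rw [negIdx, RootPairing.root_reflectionPerm, RootPairing.reflection_apply_self]

lemma smul_negIdx (w : S.W) (i : ι) : w • S.negIdx i = S.negIdx (w • i) := by
  apply S.R.root.injective
  rw [root_smul, root_negIdx, root_negIdx, root_smul, smul_neg]

lemma isPos_negIdx (i : ι) : S.b.IsPos (S.negIdx i) ↔ ¬ S.b.IsPos i :=
  RootPairing.Base.IsPos.neg_iff_not S.b i

lemma negIdx_negIdx (i : ι) : S.negIdx (S.negIdx i) = i := by
  apply S.R.root.injective
  rw [root_negIdx, root_negIdx, neg_neg]

lemma mem_inversions (w : S.W) (i : ι) :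
    i ∈ S.inversions w ↔ S.b.IsPos i ∧ ¬ S.b.IsPos (w • i) := by simp [inversions]

/-- The map `β ↦ -w⁻¹β` is a bijection between the two inversion sets. -/
lemma length_inv (w : S.W) : S.length w⁻¹ = S.length w := by
  refine Finset.card_bij (fun j _ => S.negIdx (w⁻¹ • j)) ?_ ?_ ?_
  · intro j hj
    rw [mem_inversions] at hj ⊢
    rw [isPos_negIdx, smul_negIdx, isPos_negIdx, smul_inv_smul]
    exact ⟨hj.2, not_not.2 hj.1⟩
  · intro a _ b _ hab
    have := congrArg (fun l => w • S.negIdx l) hab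
    simpa [negIdx_negIdx] using this
  · intro j hj
    rw [mem_inversions] at hj
    refine ⟨S.negIdx (w • j), ?_, ?_⟩
    · rw [mem_inversions, smul_negIdx, inv_smul_smul, isPos_negIdx, isPos_negIdx]
      exact ⟨hj.2, not_not.2 hj.1⟩
    · rw [smul_negIdx, inv_smul_smul, negIdx_negIdx]

lemma length_s_mul_of_neg {w : S.W} {i : S.I} (h : ¬ S.b.IsPos (w⁻¹ • (i : ι))) :
    S.length (S.s i * w) + 1 = S.length w := by
  rw [← length_inv, mul_inv_rev, s_inv, ← S.length_inv w]
  exact S.length_mul_s _ _ h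

lemma isPos_inv_smul_s_mul (w : S.W) (i : S.I) :
    S.b.IsPos ((S.s i * w)⁻¹ • (i : ι)) ↔ ¬ S.b.IsPos (w⁻¹ • (i : ι)) := by
  rw [mul_inv_rev, s_inv, mul_smul, isPos_smul_s_self]

lemma length_s_mul_of_pos {w : S.W} {i : S.I} (h : S.b.IsPos (w⁻¹ • (i : ι))) :
    S.length (S.s i * w) = S.length w + 1 := by
  have := S.length_s_mul_of_neg (w := S.s i * w) (i := i)
    (by rw [isPos_inv_smul_s_mul]; exact not_not.2 h)
  rw [s_mul_s_cancel] at this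
  exact this.symm

lemma length_one : S.length 1 = 0 := by simp [length, inversions]

lemma length_s_mul_le (w : S.W) (i : S.I) : S.length (S.s i * w) ≤ S.length w + 1 := by
  by_cases h : S.b.IsPos (w⁻¹ • (i : ι))
  · exact (S.length_s_mul_of_pos h).le
  · have := S.length_s_mul_of_neg h
    omega

lemma length_wordProd_le (ω : List S.I) : S.length (S.wordProd ω) ≤ ω.length := by
  induction ω with
  | nil => simp [wordProd_nil, length_one]
  | cons i ω ih =>
    rw [wordProd_cons, List.length_cons]
    exact (S.length_s_mul_le _ _).trans (by omega)

variable {S} in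
lemma IsReducedWord.tail {i : S.I} {ω : List S.I} {w : S.W} (h : S.IsReducedWord (i :: ω) w) :
    S.IsReducedWord ω (S.s i * w) ∧ S.length w = S.length (S.s i * w) + 1 := by
  obtain ⟨rfl, h2⟩ := h
  rw [wordProd_cons, s_mul_s_cancel, List.length_cons] at *
  have h1 := S.length_wordProd_le ω
  have h3 := S.length_s_mul_le (S.wordProd ω) i
  exact ⟨⟨rfl, by omega⟩, by omega⟩

variable {S} in
lemma IsReducedWord.cons {i : S.I} {ω : List S.I} {w : S.W} (h : S.IsReducedWord ω w)
    (hl : S.length (S.s i * w) = S.length w + 1) : S.IsReducedWord (i :: ω) (S.s i * w) :=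
  ⟨by rw [wordProd_cons, h.1], by rw [List.length_cons, h.2, hl]⟩

variable {S} in
lemma IsReducedWord.neg_head {i : S.I} {ω : List S.I} {w : S.W}
    (h : S.IsReducedWord (i :: ω) w) : ¬ S.b.IsPos (w⁻¹ • (i : ι)) := by
  intro hp
  have := S.length_s_mul_of_pos hp
  have := h.tail.2
  omega

/-- Induction on the length. -/
lemma induction_length {p : S.W → Prop} (one : p 1)
    (cons : ∀ (i : S.I) (w : S.W), S.b.IsPos (w⁻¹ • (i : ι)) → p w → p (S.s i * w)) (w : S.W) :
    p w := by
  obtain ⟨ω, hω⟩ := S.exists_reducedWord w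
  induction ω generalizing w with
  | nil => rw [← hω.1]; exact one
  | cons i ω ih =>
    have h := ih _ hω.tail.1
    have := cons i _ ((S.isPos_inv_smul_s_mul w i).2 hω.neg_head) h
    rwa [s_mul_s_cancel] at this

/-! ### Pairs of simple roots -/

lemma s_smul (i : S.I) (lam : S.P) : S.s i • lam = lam - pair lam i • S.rootP i :=
  S.ofIdx_smul_P i lam

lemma rootP_smul (w : S.W) (i : ι) : S.rootP (w • i) = w • S.rootP i :=
  Subtype.ext (S.root_smul w i)

lemma pair_zero (i : ι) : pair (0 : S.P) i = 0 := map_zero (S.pairHom i)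

lemma pair_neg (lam : S.P) (i : ι) : pair (-lam) i = -pair lam i := map_neg (S.pairHom i) lam

lemma pair_sub (lam mu : S.P) (i : ι) : pair (lam - mu) i = pair lam i - pair mu i :=
  map_sub (S.pairHom i) lam mu

lemma pair_zsmul (z : ℤ) (lam : S.P) (i : ι) : pair (z • lam) i = z * pair lam i := by
  exact (map_zsmul (S.pairHom i) z lam).trans (smul_eq_mul _ _)

lemma pair_nsmul (z : ℕ) (lam : S.P) (i : ι) : pair (z • lam) i = z * pair lam i := by
  exact (map_nsmul (S.pairHom i) z lam).trans (nsmul_eq_mul _ _)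

lemma pair_smul_smul (w : S.W) (lam : S.P) (i : ι) : pair (w • lam) (w • i) = pair lam i := by
  have h : ((pair (w • lam) (w • i) : ℤ) : ℝ) = pair lam i := by
    rw [← pair_spec, ← pair_spec]
    exact S.inner_smul_coroot w lam i
  exact_mod_cast h

lemma pair_smul (w : S.W) (lam : S.P) (i : ι) : pair (w • lam) i = pair lam (w⁻¹ • i) := by
  rw [← S.pair_smul_smul w lam, smul_inv_smul]

lemma pair_rootP (i j : ι) : pair (S.rootP i) j = S.R.pairingIn ℤ i j := by
  have h : ((pair (S.rootP i) j : ℤ) : ℝ) = (S.R.pairingIn ℤ i j : ℤ) := by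
    rw [← pair_spec, ← S.pairing_eq]
    exact (S.R.algebraMap_pairingIn ℤ i j).symm
  exact_mod_cast h

lemma pair_rootP_self (i : ι) : pair (S.rootP i) i = 2 := by
  rw [pair_rootP, RootPairing.pairingIn_same]

/-- The negative `-(α_i, α_j^∨)` of a Cartan integer. -/
def car (i j : S.I) : ℤ := -pair (S.rootP i) j

lemma car_cases {i j : S.I} (h : i ≠ j) :
    (S.car i j = 0 ∧ S.car j i = 0) ∨ (S.car i j = 1 ∧ S.car j i = 1) ∨
    (S.car i j = 1 ∧ S.car j i = 2) ∨ (S.car i j = 2 ∧ S.car j i = 1) ∨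
    (S.car i j = 1 ∧ S.car j i = 3) ∨ (S.car i j = 3 ∧ S.car j i = 1) := by
  have hij : (i : ι) ≠ j := fun e => h (Subtype.ext e)
  have h1 := S.R.pairingIn_pairingIn_mem_set_of_isCrystal_of_isRed' i j
    (fun e => hij (S.R.root.injective e)) (S.b.root_ne_neg_of_ne i.2 j.2 hij)
  have h2 := S.b.pairingIn_le_zero_of_ne hij i.2 j.2
  rw [car, car, pair_rootP, pair_rootP]
  simp only [Set.mem_insert_iff, Set.mem_singleton_iff, Prod.mk.injEq] at h1
  omega

lemma pair_s_smul (i j : S.I) (lam : S.P) :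
    pair (S.s i • lam) j = pair lam j + S.car i j * pair lam i := by
  rw [s_smul, pair_sub, pair_zsmul, car]
  ring

lemma pair_s_smul_self (i : S.I) (lam : S.P) : pair (S.s i • lam) i = -pair lam i := by
  rw [s_smul, pair_sub, pair_zsmul, pair_rootP_self]
  ring

lemma eq_of_smul_P {w w' : S.W} (h : ∀ lam : S.P, w • lam = w' • lam) : w = w' := by
  refine S.smul_eq_of_index fun i => S.R.root.injective ?_
  rw [root_smul, root_smul]
  exact congrArg Subtype.val (h (S.rootP i))

/-- The order of `s_i s_j`. -/
def cox (i j : S.I) : ℕ :=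
  if S.car i j * S.car j i = 0 then 2 else if S.car i j * S.car j i = 1 then 3 else
    if S.car i j * S.car j i = 2 then 4 else 6

lemma cox_comm (i j : S.I) : S.cox i j = S.cox j i := by
  rw [cox, cox, mul_comm]

/-- On a coset `λ + ℤα_i + ℤα_j` the two reflections act on the integer coordinates `(a, c)`, so
identities between words in `s_i`, `s_j` become integer arithmetic. -/
lemma s_smul_coords (i j : S.I) (lam : S.P) (a c : ℤ) :
    S.s i • (lam - a • S.rootP i - c • S.rootP j) =
      lam - (pair lam i - a + c * S.car j i) • S.rootP i - c • S.rootP j := by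
  rw [s_smul, pair_sub, pair_sub, pair_zsmul, pair_zsmul, pair_rootP_self, car]
  module

lemma s_smul_coords' (i j : S.I) (lam : S.P) (a c : ℤ) :
    S.s j • (lam - a • S.rootP i - c • S.rootP j) =
      lam - a • S.rootP i - (pair lam j - c + a * S.car i j) • S.rootP j := by
  rw [s_smul, pair_sub, pair_sub, pair_zsmul, pair_zsmul, pair_rootP_self, car]
  module

lemma wordProd_altList {i j : S.I} (h : i ≠ j) :
    S.wordProd (altList i j (S.cox i j)) = S.wordProd (altList j i (S.cox i j)) := by
  refine S.eq_of_smul_P fun lam => ?_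
  have h0 : lam = lam - (0 : ℤ) • S.rootP i - (0 : ℤ) • S.rootP j := by simp
  have key : ∀ {a a' c c' : ℤ}, a = a' → c = c' →
      lam - a • S.rootP i - c • S.rootP j = lam - a' • S.rootP i - c' • S.rootP j := by
    rintro _ _ _ _ rfl rfl
    rfl
  rcases S.car_cases h with h' | h' | h' | h' | h' | h' <;> obtain ⟨h1, h2⟩ := h' <;>
    simp only [cox, h1, h2] <;> norm_num <;>
    simp only [altList, wordProd_cons, wordProd_nil, mul_one, mul_smul] <;>
    rw [h0] <;>
    simp only [s_smul_coords, s_smul_coords', h1, h2] <;>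
    exact key (by ring) (by ring)

/-! ### Descents in rank two and Matsumoto's theorem -/

/-- The height of `w⁻¹ α_i`. -/
def invHeight (w : S.W) (i : S.I) : ℤ := S.b.height (w⁻¹ • (i : ι))

lemma invHeight_neg_iff (w : S.W) (i : S.I) :
    S.invHeight w i < 0 ↔ ¬ S.b.IsPos (w⁻¹ • (i : ι)) := by
  rw [RootPairing.Base.isPos_iff', not_le]
  rfl

/-- Height is additive and `s_i α_j = α_j - (α_j, α_i^∨) α_i`. Left descents are thereby governed by
linear integer recursions. -/
lemma invHeight_s_mul (w : S.W) (i j : S.I) :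
    S.invHeight (S.s i * w) j = S.invHeight w j + S.car j i * S.invHeight w i := by
  refine S.b.height_add_zsmul ?_
  rw [mul_inv_rev, s_inv, mul_smul, root_smul, root_smul, root_smul]
  have h : S.s i • S.rootP j = S.rootP j + S.car j i • S.rootP i := by
    rw [s_smul, car]
    module
  have h' : S.s i • S.R.root j = S.R.root j + S.car j i • S.R.root i := by
    simpa [rootP] using congrArg Subtype.val h
  rw [h', smul_add]
  congr 1
  rw [smul_comm, root_smul]

lemma car_self (i : S.I) : S.car i i = -2 := by rw [car, pair_rootP_self]

/-- Successive left multiplication of `w` with the letters of the word decreases the length. -/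
def DescendsAlong : List S.I → S.W → Prop
  | [], _ => True
  | i :: ω, w => S.invHeight w i < 0 ∧ DescendsAlong ω (S.s i * w)

variable {S} in
lemma DescendsAlong.exists_reducedWord {ω : List S.I} {w : S.W} (h : S.DescendsAlong ω w) :
    ∃ c, S.IsReducedWord (ω ++ c) w := by
  induction ω generalizing w with
  | nil => exact S.exists_reducedWord w
  | cons i ω ih =>
    obtain ⟨c, hc⟩ := ih h.2
    refine ⟨c, ?_⟩
    have hl := S.length_s_mul_of_neg ((S.invHeight_neg_iff w i).1 h.1)
    have := hc.cons (i := i) (by rw [s_mul_s_cancel]; exact hl.symm)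
    rwa [s_mul_s_cancel] at this

/-- The heights met along the word are those of `w⁻¹β`, with `β` running over the positive roots of
the rank two subsystem. Each is a nonnegative combination of the two given negative heights. -/
lemma descendsAlong_altList {i j : S.I} (h : i ≠ j) {w : S.W} (hi : S.invHeight w i < 0)
    (hj : S.invHeight w j < 0) : S.DescendsAlong (altList i j (S.cox i j)) w := by
  rcases S.car_cases h with h' | h' | h' | h' | h' | h' <;> obtain ⟨h1, h2⟩ := h' <;>
    simp only [cox, h1, h2] <;> norm_num <;>
    simp only [altList, DescendsAlong, invHeight_s_mul, car_self, h1, h2, and_true] <;> omega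

/-- Matsumoto's theorem: a product over a reduced word does not depend on the word if the braid
relations hold. -/
theorem prod_reducedWord_eq {M : Type*} [Monoid M] (t : S.I → M)
    (ht : ∀ i j, i ≠ j →
      ((altList i j (S.cox i j)).map t).prod = ((altList j i (S.cox i j)).map t).prod)
    {w : S.W} {ω ω' : List S.I} (h : S.IsReducedWord ω w) (h' : S.IsReducedWord ω' w) :
    (ω.map t).prod = (ω'.map t).prod := by
  induction hn : S.length w generalizing w ω ω' with
  | zero =>
    obtain rfl := List.eq_nil_of_length_eq_zero (h.2.trans hn)
    obtain rfl := List.eq_nil_of_length_eq_zero (h'.2.trans hn)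
    rfl
  | succ n ih =>
    -- Reduced words with the same first letter are compared by stripping it and using the induction
    -- hypothesis.
    have hhead : ∀ {i ω ω'}, S.IsReducedWord (i :: ω) w → S.IsReducedWord (i :: ω') w →
        (((i :: ω).map t).prod : M) = ((i :: ω').map t).prod := by
      intro i ω ω' h h'
      have := h.tail.2
      rw [List.map_cons, List.map_cons, List.prod_cons, List.prod_cons,
        ih h.tail.1 h'.tail.1 (by omega)]
    obtain _ | ⟨i, a⟩ := ω
    · have := h.2; simp at this; omega
    obtain _ | ⟨j, a'⟩ := ω'
    · have := h'.2; simp at this; omega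
    by_cases hij : i = j
    · subst hij
      exact hhead h h'
    have hi := (S.invHeight_neg_iff w i).2 h.neg_head
    have hj := (S.invHeight_neg_iff w j).2 h'.neg_head
    -- Both `s_i` and `s_j` are left descents of `w`, so `w` has a reduced word beginning with a
    -- full side of the braid relation. It shares its first letter with one given word, and after
    -- one braid move with the other.
    obtain ⟨c, hc⟩ := (S.descendsAlong_altList hij hi hj).exists_reducedWord
    have hc' : S.IsReducedWord (altList j i (S.cox i j) ++ c) w := by
      refine ⟨?_, ?_⟩
      · rw [wordProd_append, ← S.wordProd_altList hij, ← wordProd_append, hc.1]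
      · rw [← hc.2]; simp
    have hpos : ∃ m, S.cox i j = m + 1 := ⟨S.cox i j - 1, by unfold cox; split_ifs <;> rfl⟩
    obtain ⟨m, hm⟩ := hpos
    have e := ht i j hij
    rw [hm] at hc hc' e
    refine (hhead h hc).trans (Eq.trans ?_ (hhead hc' h'))
    change ((altList i j (m + 1) ++ c).map t).prod = ((altList j i (m + 1) ++ c).map t).prod
    rw [List.map_append, List.map_append, List.prod_append, List.prod_append, e]

end BasedRootSystem

end

end Metaplectic

namespace Metaplectic

noncomputable section

namespace BasedRootSystem

variable {ι E : Type*} [Fintype ι] [NormedAddCommGroup E] [InnerProductSpace ℝ E]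
  (S : BasedRootSystem ι E)

/-! ### The field `ℂ(P)` -/

lemma algebraMap_single (lam : S.P) (a : ℂ) :
    algebraMap S.A S.K (AddMonoidAlgebra.single lam a) = algebraMap ℂ S.K a * S.X lam := by
  rw [X, IsScalarTower.algebraMap_apply ℂ S.A S.K, ← map_mul, ← Algebra.smul_def,
    AddMonoidAlgebra.smul_single, smul_eq_mul, mul_one]

/-- The coefficient of `x^0` is `1`, because `λ ≠ 0`. -/
lemma one_sub_algebraMap_mul_X_ne_zero (a : ℂ) {lam : S.P} (h : lam ≠ 0) :
    1 - algebraMap ℂ S.K a * S.X lam ≠ 0 := by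
  have e : 1 - algebraMap ℂ S.K a * S.X lam =
      algebraMap S.A S.K (1 - AddMonoidAlgebra.single lam a) := by
    rw [map_sub, map_one, algebraMap_single]
  rw [e, map_ne_zero_iff _ (IsFractionRing.injective S.A S.K)]
  intro h0
  have := DFunLike.congr_fun (F := S.P →₀ ℂ) (congrArg AddMonoidAlgebra.coeff h0) 0
  simp [AddMonoidAlgebra.one_def, h] at this

lemma one_sub_X_ne_zero {lam : S.P} (h : lam ≠ 0) : 1 - S.X lam ≠ 0 := by
  simpa using S.one_sub_algebraMap_mul_X_ne_zero 1 h

lemma X_neg (lam : S.P) : S.X (-lam) = (S.X lam)⁻¹ := by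
  refine eq_inv_of_mul_eq_one_left ?_
  rw [← X_add, neg_add_cancel, X_zero]

lemma X_sub (lam mu : S.P) : S.X (lam - mu) = S.X lam / S.X mu := by
  rw [sub_eq_add_neg, X_add, X_neg, div_eq_mul_inv]

lemma X_injective : Function.Injective S.X := by
  intro lam mu h
  by_contra hne
  refine S.one_sub_X_ne_zero (sub_ne_zero.2 hne) ?_
  rw [X_sub, h, div_self (S.X_ne_zero mu), sub_self]

@[simp] lemma mulOp_apply (f h : S.K) : S.mulOp f h = f * h := rfl

lemma mulOp_mul (f h : S.K) : S.mulOp (f * h) = S.mulOp f * S.mulOp h :=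
  LinearMap.ext fun x => mul_assoc f h x

lemma mulOp_one : S.mulOp 1 = 1 := LinearMap.ext fun x => one_mul x

lemma algHom_ext_X {φ ψ : S.K →ₐ[ℂ] S.K} (h : ∀ lam, φ (S.X lam) = ψ (S.X lam)) : φ = ψ := by
  refine AlgHom.coe_ringHom_injective (IsLocalization.ringHom_ext (nonZeroDivisors S.A) ?_)
  refine RingHom.ext fun a => ?_
  change φ (algebraMap S.A S.K a) = ψ (algebraMap S.A S.K a)
  induction a using AddMonoidAlgebra.induction_linear with
  | zero => simp
  | add x y hx hy => rw [map_add, map_add, map_add, hx, hy]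
  | single lam a => rw [algebraMap_single, map_mul, map_mul, h, φ.commutes, ψ.commutes]

lemma weylK_mul_apply (w w' : S.W) (f : S.K) : S.weylK (w * w') f = S.weylK w (S.weylK w' f) := by
  have : (S.weylK (w * w') : S.K →ₐ[ℂ] S.K) =
      (S.weylK w : S.K →ₐ[ℂ] S.K).comp (S.weylK w' : S.K →ₐ[ℂ] S.K) :=
    S.algHom_ext_X fun lam => by simp [mul_smul]
  exact DFunLike.congr_fun this f

lemma weylK_one_apply (f : S.K) : S.weylK 1 f = f := by
  have : (S.weylK 1 : S.K →ₐ[ℂ] S.K) = AlgHom.id ℂ S.K :=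
    S.algHom_ext_X fun lam => by simp
  exact DFunLike.congr_fun this f

lemma weylK_algebraMap (w : S.W) (a : ℂ) :
    S.weylK w (algebraMap ℂ S.K a) = algebraMap ℂ S.K a := (S.weylK w).commutes a

end BasedRootSystem

open BasedRootSystem

/-! ### Arithmetic of `m(α)` and stability of `P^m` and `ℂ(P^m)` under `W` -/

namespace MetaplecticStructure

variable {ι E : Type*} [Fintype ι] [NormedAddCommGroup E] [InnerProductSpace ℝ E]
  {S : BasedRootSystem ι E} (D : MetaplecticStructure S)

/-- After division by the gcd, `m(α)` is coprime to the cofactor of `Q(α)`. Consequently the index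
of `g`, taken modulo `n`, sees exactly `(λ, α^∨)` modulo `m(α)`. -/
lemma m_dvd_iff (i : ι) (x : ℤ) : (D.m i : ℤ) ∣ x ↔ (D.n : ℤ) ∣ D.Qroot i * x := by
  have hpos : 0 < Int.gcd D.n (D.Qroot i) :=
    Int.gcd_pos_of_ne_zero_left _ (by exact_mod_cast D.n_pos.ne')
  have hg : (Int.gcd D.n (D.Qroot i) : ℤ) ≠ 0 := by exact_mod_cast hpos.ne'
  have h : Int.gcd D.n (D.Qroot i) ∣ D.n := by
    exact_mod_cast Int.gcd_dvd_left (D.n : ℤ) (D.Qroot i)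
  have h2 : (D.n : ℤ) = D.m i * (Int.gcd D.n (D.Qroot i) : ℤ) := by
    exact_mod_cast (Nat.div_mul_cancel h).symm
  obtain ⟨r, hr⟩ := Int.gcd_dvd_right (D.n : ℤ) (D.Qroot i)
  constructor
  · rintro ⟨y, rfl⟩
    have := (D.n_dvd i).mul_right y
    rwa [mul_comm (D.m i : ℤ), mul_assoc] at this
  · intro hd
    have hcop : IsCoprime (D.m i : ℤ) r := by
      rw [Int.isCoprime_iff_gcd_eq_one]
      have h3 : Int.gcd (Int.gcd D.n (D.Qroot i) * (D.m i : ℤ)) (Int.gcd D.n (D.Qroot i) * r) =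
          Int.gcd D.n (D.Qroot i) := by
        rw [← hr, mul_comm, ← h2]
      rw [Int.gcd_mul_left, Int.natAbs_natCast] at h3
      exact Nat.eq_of_mul_eq_mul_left hpos (by rw [h3, mul_one])
    refine hcop.dvd_of_dvd_mul_left ?_
    refine (mul_dvd_mul_iff_left hg).1 ?_
    rw [mul_comm, ← h2, ← mul_assoc, ← hr]
    exact hd

lemma B_comm (lam mu : S.P) : D.B lam mu = D.B mu lam := by
  rw [B, B, add_comm lam mu]
  ring

lemma Qroot_mul_pair (i j : ι) :
    D.Qroot j * pair (S.rootP i) j = D.Qroot i * pair (S.rootP j) i := by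
  have h := D.B_comm (S.rootP i) (S.rootP j)
  rw [B_eq, B_eq] at h
  exact_mod_cast h

/-- Symmetry of `B` gives `Q(β)(α, β^∨) = Q(α)(β, α^∨)`, and `n` divides `m(α) Q(α)`. -/
lemma mroot_mem_Pm (i : ι) : D.mroot i ∈ D.Pm := by
  rw [mem_Pm_iff]
  intro j
  rw [m_dvd_iff, mroot, pair_nsmul]
  have e : D.Qroot j * (D.m i * pair (S.rootP i) j) =
      D.m i * D.Qroot i * pair (S.rootP j) i := by
    linear_combination (D.m i : ℤ) * D.Qroot_mul_pair i j
  rw [e]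
  exact (D.n_dvd i).mul_right _

lemma smul_mem_Pm (w : S.W) {lam : S.P} (h : lam ∈ D.Pm) : w • lam ∈ D.Pm := by
  rw [mem_Pm_iff] at *
  intro i
  rw [pair_smul, ← D.m_smul w⁻¹ i]
  exact h _

lemma X_mem_Km {lam : S.P} (h : lam ∈ D.Pm) : S.X lam ∈ D.Km :=
  IntermediateField.subset_adjoin _ _ ⟨lam, h, rfl⟩

lemma weylK_mem_Km (w : S.W) {f : S.K} (h : f ∈ D.Km) : S.weylK w f ∈ D.Km := by
  induction h using IntermediateField.adjoin_induction with
  | mem x hx =>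
    obtain ⟨lam, hlam, rfl⟩ := hx
    rw [weylK_X]
    exact D.X_mem_Km (D.smul_mem_Pm w hlam)
  | algebraMap a => rw [weylK_algebraMap]; exact D.Km.algebraMap_mem a
  | add x y _ _ hx hy => rw [map_add]; exact add_mem hx hy
  | inv x _ hx => rw [map_inv₀]; exact inv_mem hx
  | mul x y _ _ hx hy => rw [map_mul]; exact mul_mem hx hy

lemma mroot_ne_zero (i : ι) : D.mroot i ≠ 0 := by
  intro h
  have h1 : pair (D.mroot i) i = 0 := by rw [h, S.pair_zero]
  rw [mroot, pair_nsmul, pair_rootP_self] at h1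
  have := D.m_pos i
  omega

lemma pair_mroot_self (i : ι) : pair (D.mroot i) i = 2 * D.m i := by
  rw [mroot, pair_nsmul, pair_rootP_self]
  ring

lemma mroot_smul (w : S.W) (i : ι) : D.mroot (w • i) = w • D.mroot i := by
  rw [mroot, m_smul, rootP_smul, mroot, smul_comm]

lemma s_smul_of_pair_eq {i : S.I} {lam : S.P} {a : ℤ} (h : pair lam i = a * D.m i) :
    S.s i • lam = lam - a • D.mroot i := by
  rw [s_smul, h, mroot, ← natCast_zsmul, smul_smul]

lemma s_smul_mroot (i : S.I) : S.s i • D.mroot i = -D.mroot i := by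
  rw [D.s_smul_of_pair_eq (D.pair_mroot_self i)]
  module

end MetaplecticStructure

open MetaplecticStructure

namespace Parameters

variable {ι E : Type*} [Fintype ι] [NormedAddCommGroup E] [InnerProductSpace ℝ E]
  {S : BasedRootSystem ι E} {D : MetaplecticStructure S} (p : Parameters D)

lemma one_sub_mroot_ne_zero (D : MetaplecticStructure S) (i : ι) : 1 - S.X (D.mroot i) ≠ 0 :=
  S.one_sub_X_ne_zero (D.mroot_ne_zero i)

lemma one_sub_ksq_ne_zero (i : ι) : 1 - p.ksq i * S.X (D.mroot i) ≠ 0 :=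
  S.one_sub_algebraMap_mul_X_ne_zero _ (D.mroot_ne_zero i)

lemma c_ne_zero (i : ι) : p.c i ≠ 0 :=
  div_ne_zero (p.one_sub_ksq_ne_zero i) (one_sub_mroot_ne_zero D i)

lemma c_mem_Km (i : ι) : p.c i ∈ D.Km := by
  have hX := D.X_mem_Km (D.mroot_mem_Pm i)
  exact div_mem (sub_mem (one_mem _) (mul_mem (D.Km.algebraMap_mem _) hX))
    (sub_mem (one_mem _) hX)

lemma weylK_c (w : S.W) (i : ι) : S.weylK w (p.c i) = p.c (w • i) := by
  simp only [c, map_div₀, map_sub, map_one, map_mul, weylK_X, ksq, weylK_algebraMap,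
    D.mroot_smul, p.k_smul]

lemma sigmaSimple_apply (i : S.I) {f : S.K} (hf : f ∈ D.Km) (lam : S.P) :
    p.sigmaSimple i (f * S.X lam) = p.sigmaFormula i f lam :=
  (p.existsUnique_sigma i).choose_spec.1 f hf lam

lemma sigmaSimple_X (i : S.I) (lam : S.P) :
    p.sigmaSimple i (S.X lam) = p.sigmaFormula i 1 lam := by
  simpa using p.sigmaSimple_apply i (one_mem D.Km) lam

end Parameters

namespace MetaplecticStructure

variable {ι E : Type*} [Fintype ι] [NormedAddCommGroup E] [InnerProductSpace ℝ E]
  {S : BasedRootSystem ι E} (D : MetaplecticStructure S)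

/-- Additive maps on `ℂ(P)` agree if they agree on all `f x^{λ+μ}` with `f ∈ ℂ(P^m)`. -/
lemma induction_K {p : S.K → Prop} (mu : S.P) (add : ∀ x y, p x → p y → p (x + y))
    (mul : ∀ f ∈ D.Km, ∀ lam : S.P, p (f * S.X (lam + mu))) (x : S.K) : p x := by
  have hx : x ∈ Submodule.span ℂ {F | ∃ f ∈ D.Km, ∃ lam : S.P, F = f * S.X lam} := by
    rw [D.span_eq_top]
    trivial
  have hm : ∀ (a : ℂ) f, f ∈ D.Km → ∀ lam : S.P, p (a • (f * S.X lam)) := by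
    intro a f hf lam
    have := mul (a • f) (D.Km.smul_mem hf) (lam - mu)
    rwa [sub_add_cancel, smul_mul_assoc] at this
  induction hx using Submodule.span_induction with
  | mem x hx =>
    obtain ⟨f, hf, lam, rfl⟩ := hx
    simpa using hm 1 f hf lam
  | zero => simpa using hm 0 0 (zero_mem _) 0
  | add x y _ _ hx hy => exact add _ _ hx hy
  | smul a x hx h =>
    clear h
    induction hx using Submodule.span_induction generalizing a with
    | mem x hx =>
      obtain ⟨f, hf, lam, rfl⟩ := hx
      exact hm a f hf lam
    | zero => simpa using hm 0 0 (zero_mem _) 0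
    | add x y _ _ hx hy => rw [smul_add]; exact add _ _ (hx a) (hy a)
    | smul b x _ hx => rw [smul_smul]; exact hx _

end MetaplecticStructure

/-! ### Semilinearity of `σ(s_i)` and the Bernstein relation -/

namespace Parameters

variable {ι E : Type*} [Fintype ι] [NormedAddCommGroup E] [InnerProductSpace ℝ E]
  {S : BasedRootSystem ι E} {D : MetaplecticStructure S} (p : Parameters D)

lemma sigmaSimple_mul (i : S.I) {f : S.K} (hf : f ∈ D.Km) (h : S.K) :
    p.sigmaSimple i (f * h) = S.weylK (S.s i) f * p.sigmaSimple i h := by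
  induction h using D.induction_K 0 with
  | add x y hx hy => rw [mul_add, map_add, map_add, hx, hy, mul_add]
  | mul f' hf' lam =>
    rw [add_zero, ← mul_assoc, p.sigmaSimple_apply i (mul_mem hf hf'), p.sigmaSimple_apply i hf',
      sigmaFormula, sigmaFormula, map_mul]
    ring

/-- `k_i - k_i⁻¹`. -/
def q (i : ι) : ℂ := p.k i - (p.k i : ℂ)⁻¹

lemma tauT_apply (i : S.I) (h : S.K) : p.tauT i h = algebraMap ℂ S.K (p.k i) * h +
    algebraMap ℂ S.K (p.k i : ℂ)⁻¹ * p.c i * (p.sigmaSimple i h - h) := by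
  simp [tauT, Algebra.smul_def]

lemma k_ne_zero (i : ι) : algebraMap ℂ S.K (p.k i) ≠ 0 :=
  (map_ne_zero_iff _ (algebraMap ℂ S.K).injective).2 (p.k i).ne_zero

lemma k_sub_inv_c (i : ι) : algebraMap ℂ S.K (p.k i) - algebraMap ℂ S.K (p.k i : ℂ)⁻¹ * p.c i =
    algebraMap ℂ S.K (p.q i) / (1 - S.X (D.mroot i)) := by
  have h1 := one_sub_mroot_ne_zero D i
  have h2 := p.k_ne_zero i
  rw [q, map_sub, map_inv₀, c, ksq, map_pow]
  field_simp
  ring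

/-- The Bernstein relation. The only non-semilinear part of `τ(T_i)` is multiplication by `k_i -
k_i⁻¹ c_i`, which `k_sub_inv_c` rewrites as `(k_i - k_i⁻¹)/(1 - x^{α_i^m})`. -/
lemma tauT_mul (i : S.I) {f : S.K} (hf : f ∈ D.Km) (h : S.K) :
    p.tauT i (f * h) = S.weylK (S.s i) f * p.tauT i h +
      algebraMap ℂ S.K (p.q i) * (f - S.weylK (S.s i) f) / (1 - S.X (D.mroot i)) * h := by
  rw [tauT_apply, tauT_apply, p.sigmaSimple_mul i hf]
  linear_combination (f - S.weylK (S.s i) f) * h * p.k_sub_inv_c i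

end Parameters

end

end Metaplectic

namespace Metaplectic

noncomputable section

open BasedRootSystem MetaplecticStructure

/-! ### Action of `τ(T_i)` on shifted monomials and the quadratic relation -/

namespace MetaplecticStructure

variable {ι E : Type*} [Fintype ι] [NormedAddCommGroup E] [InnerProductSpace ℝ E]
  {S : BasedRootSystem ι E} (D : MetaplecticStructure S)

lemma pair_rho (i : S.I) : pair D.rho i = D.m i := by
  have h : ((pair D.rho i : ℤ) : ℝ) = (D.m i : ℤ) := by
    rw [← pair_spec]
    exact_mod_cast D.inner_rhoE i
  exact_mod_cast h

lemma exists_eta : ∃ eta : S.P, ∀ i : S.I, pair eta i = 1 - D.m i := by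
  -- For the trivial structure all `m(α)` are `1`, so its `ρ^m` is the ordinary `ρ`.
  let D₁ : MetaplecticStructure S :=
    { Q := 0, Q_smul := fun _ _ => rfl, Q_integral := fun _ _ => ⟨0, by simp⟩, n := 1,
      n_pos := one_pos }
  refine ⟨D₁.rho - D.rho, fun i => ?_⟩
  have h1 : D₁.m i = 1 := by
    rw [m]
    change 1 / Int.gcd ((1 : ℕ) : ℤ) _ = 1
    simp
  rw [S.pair_sub, pair_rho, pair_rho, h1]
  rfl

/-- The difference `ρ - ρ^m`. -/
def eta : S.P := D.exists_eta.choose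

lemma pair_eta (i : S.I) : pair D.eta i = 1 - D.m i := D.exists_eta.choose_spec i

/-- The shift by `η` adds `m - 1` to `-(λ, α_i^∨)`. Its remainder becomes `m - 1` minus that of `(λ,
α_i^∨)`, and the rounding in `qPair` turns into a floor. -/
lemma qPair_neg_add_eta (i : S.I) (lam : S.P) :
    D.qPair (-(lam + D.eta)) i = -(pair lam i / D.m i) := by
  have hm : (0 : ℤ) < D.m i := by exact_mod_cast D.m_pos i
  have h1 := Int.emod_nonneg (pair lam i) hm.ne'
  have h2 := Int.emod_lt_of_pos (pair lam i) hm
  have h3 := Int.emod_add_mul_ediv (pair lam i) (D.m i)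
  have h4 : pair (-(lam + D.eta)) i = (D.m i - 1 - pair lam i % D.m i) +
      D.m i * (-(pair lam i / D.m i)) := by
    rw [pair_neg, pair_add, pair_eta]
    linear_combination h3
  have h5 : (D.m i - 1 - pair lam i % D.m i : ℤ) % D.m i = D.m i - 1 - pair lam i % D.m i :=
    Int.emod_eq_of_lt (by omega) (by omega)
  rw [qPair, h4, Int.add_mul_emod_self_left, h5, add_sub_cancel_left,
    Int.mul_ediv_cancel_left _ hm.ne']

end MetaplecticStructure

namespace Parameters

variable {ι E : Type*} [Fintype ι] [NormedAddCommGroup E] [InnerProductSpace ℝ E]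
  {S : BasedRootSystem ι E} {D : MetaplecticStructure S} (p : Parameters D)

lemma g_congr {a a' : ℤ} (y : RootSize) (h : (D.n : ℤ) ∣ a - a') : p.g a y = p.g a' y := by
  rw [p.g_mod a, p.g_mod a', Int.emod_eq_emod_iff_emod_sub_eq_zero.2 (Int.emod_eq_zero_of_dvd h)]

/-- The action of `τ(T_i)` on monomials. -/
lemma tauT_X_add_eta (i : S.I) (lam : S.P) :
    p.tauT i (S.X (lam + D.eta)) =
      algebraMap ℂ S.K (p.q i) * ((1 - S.X (-(pair lam i / D.m i) • D.mroot i)) /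
        (1 - S.X (D.mroot i))) * S.X (lam + D.eta) -
      algebraMap ℂ S.K (p.k i * p.g (-(D.Qroot i * pair lam i)) (D.size i)) *
        S.X (S.s i • lam + D.eta) := by
  have hg : p.g (D.Qroot i - D.Broot (lam + D.eta) i) (D.size i) =
      p.g (-(D.Qroot i * pair lam i)) (D.size i) := by
    refine p.g_congr _ ?_
    rw [Broot_eq, pair_add, pair_eta]
    have e : D.Qroot i - D.Qroot i * (pair lam i + (1 - D.m i)) - -(D.Qroot i * pair lam i) =
        D.m i * D.Qroot i := by ring
    rw [e]
    exact D.n_dvd i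
  have hX : S.X (S.rootP i + S.s i • (lam + D.eta)) =
      S.X (S.s i • lam + D.eta) * S.X (D.mroot i) := by
    rw [← X_add, smul_add, S.s_smul i D.eta, pair_eta, mroot]
    generalize S.s i • lam = mu
    congr 1
    module
  have h1 := one_sub_mroot_ne_zero D i
  have h2 := p.one_sub_ksq_ne_zero i
  have h3 := p.k_ne_zero i
  have h4 := S.X_ne_zero (D.mroot i)
  rw [tauT_apply, sigmaSimple_X, sigmaFormula, qPair_neg_add_eta, hg, hX, map_one, X_neg, c, q]
  simp only [map_mul, map_sub, map_inv₀]
  have hk : p.ksq i = algebraMap ℂ S.K (p.k i) ^ 2 := by rw [ksq, map_pow]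
  rw [hk] at h2 ⊢
  field_simp
  ring

/-- The scalar by which `τ(T_i)` acts on `x^{λ+η}` up to `x^λ ↦ x^{s_i λ}`, where
`0 ≤ (λ, α_i^∨) ≤ m(α_i)`. -/
def coef (i : ι) (a : ℤ) : ℂ :=
  if a = D.m i then (p.k i : ℂ)⁻¹ else -(p.k i * p.g (-(D.Qroot i * a)) (D.size i))

lemma coef_ne_zero (i : ι) (a : ℤ) : p.coef i a ≠ 0 := by
  rw [coef]
  split_ifs <;> simp

lemma coef_zero (i : ι) : p.coef i 0 = p.k i := by
  have h : ¬ (0 : ℤ) = D.m i := by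
    have := D.m_pos i
    omega
  rw [coef, if_neg h, p.g_of_dvd _ _ (by simp)]
  simp

/-- Below `m(α_i)` the floor is `0` and the diagonal term vanishes. At the endpoint `m(α_i)` the
monomial `x^{λ+η-α_i^m}` of the diagonal term is `x^{s_i λ+η}` itself, and `k_i - (k_i - k_i⁻¹) =
k_i⁻¹`; this explains the exceptional value of `coef`. -/
lemma tauT_X_of_le (i : S.I) {lam : S.P} (h0 : 0 ≤ pair lam i) (h1 : pair lam i ≤ D.m i) :
    p.tauT i (S.X (lam + D.eta)) =
      algebraMap ℂ S.K (p.coef i (pair lam i)) * S.X (S.s i • lam + D.eta) := by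
  have hm : (0 : ℤ) < D.m i := by exact_mod_cast D.m_pos i
  rw [tauT_X_add_eta, coef]
  split_ifs with h
  · have hd : pair lam i / D.m i = 1 := by rw [h]; exact Int.ediv_self hm.ne'
    have hs : lam + D.eta = S.s i • lam + D.eta + D.mroot i := by
      rw [D.s_smul_of_pair_eq (a := 1) (by rw [one_mul]; exact h)]
      module
    rw [hd, p.g_of_dvd _ _ (by rw [h, dvd_neg, mul_comm]; exact D.n_dvd i), neg_smul, one_smul,
      X_neg, hs, X_add, q]
    have h1 := one_sub_mroot_ne_zero D i
    have h3 := p.k_ne_zero i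
    have h4 := S.X_ne_zero (D.mroot i)
    simp only [map_mul, map_sub, map_inv₀, Units.val_neg, Units.val_one, map_neg, map_one]
    field_simp
    ring
  · have hd : pair lam i / D.m i = 0 := Int.ediv_eq_zero_of_lt h0 (by omega)
    rw [hd, neg_zero, zero_smul, X_zero, map_neg]
    ring

/-- For `0 < a < m(α)` the index `Q(α) a` is not divisible by `n`, and the claim is the relation
`g_j g_{n-j} = k⁻²`. For `a = m(α)` it is `g = -1`. -/
lemma coef_mul (i : ι) {a : ℤ} (h0 : 0 < a) (h1 : a ≤ D.m i) :
    p.coef i a * -(p.k i * p.g (D.Qroot i * a) (D.size i)) = 1 := by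
  rw [coef]
  split_ifs with h
  · rw [p.g_of_dvd _ _ (by rw [h, mul_comm]; exact D.n_dvd i)]
    simp
  · have hn : ¬ (D.n : ℤ) ∣ D.Qroot i * a := by
      rw [← m_dvd_iff]
      intro hd
      have := Int.le_of_dvd h0 hd
      omega
    have h2 := p.g_mul i _ hn
    rw [p.g_congr (a := D.n - D.Qroot i * a) (a' := -(D.Qroot i * a)) _ (by simp)] at h2
    have h3 : (p.k i ^ 2 * (p.g (D.Qroot i * a) (D.size i) *
        p.g (-(D.Qroot i * a)) (D.size i)) : ℂˣ) = 1 := by rw [h2, mul_inv_cancel]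
    have h4 := congrArg Units.val h3
    push_cast at h4
    linear_combination h4

lemma tauT_X_of_neg (i : S.I) {lam : S.P} (h0 : pair lam i < 0) (h1 : -pair lam i ≤ D.m i) :
    p.tauT i (S.X (lam + D.eta)) = algebraMap ℂ S.K (p.q i) * S.X (lam + D.eta) +
      algebraMap ℂ S.K (p.coef i (-pair lam i))⁻¹ * S.X (S.s i • lam + D.eta) := by
  have hm : (0 : ℤ) < D.m i := by exact_mod_cast D.m_pos i
  have hd : pair lam i / D.m i = -1 := by
    rw [Int.ediv_eq_iff_of_pos hm]
    constructor <;> linarith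
  rw [inv_eq_of_mul_eq_one_right (p.coef_mul i (neg_pos.2 h0) h1), tauT_X_add_eta, hd, neg_neg,
    one_smul, div_self (one_sub_mroot_ne_zero D i), mul_one, map_neg, mul_neg]
  ring

/-- By the Bernstein relation and `s_i² = 1`, the quadratic expression in `τ(T_i)` is linear over
`ℂ(P^m)`. The quadratic relation may thus be checked after translating a weight by multiples of
`α_i^m`. -/
lemma tauT_quadratic_mul (i : S.I) {f : S.K} (hf : f ∈ D.Km) (h : S.K) :
    p.tauT i (p.tauT i (f * h)) - algebraMap ℂ S.K (p.q i) * p.tauT i (f * h) - f * h =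
      f * (p.tauT i (p.tauT i h) - algebraMap ℂ S.K (p.q i) * p.tauT i h - h) := by
  have hss : S.weylK (S.s i) (S.weylK (S.s i) f) = f := by
    rw [← weylK_mul_apply, s_mul_s, weylK_one_apply]
  have hX := D.X_mem_Km (D.mroot_mem_Pm i)
  have hsf := D.weylK_mem_Km (S.s i) hf
  have hd : algebraMap ℂ S.K (p.q i) * (f - S.weylK (S.s i) f) / (1 - S.X (D.mroot i)) ∈ D.Km :=
    div_mem (mul_mem (D.Km.algebraMap_mem _) (sub_mem hf hsf)) (sub_mem (one_mem _) hX)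
  rw [p.tauT_mul i hf, map_add, p.tauT_mul i hsf, p.tauT_mul i hd, hss]
  simp only [map_div₀, map_mul, map_sub, map_one, weylK_X, weylK_algebraMap, hss, s_smul_mroot,
    X_neg]
  have h1 := one_sub_mroot_ne_zero D i
  have h4 := S.X_ne_zero (D.mroot i)
  have h5 : S.X (D.mroot i) - 1 ≠ 0 := by rw [← neg_ne_zero, neg_sub]; exact h1
  field_simp
  ring

lemma tauT_quadratic (i : S.I) (x : S.K) :
    p.tauT i (p.tauT i x) = algebraMap ℂ S.K (p.q i) * p.tauT i x + x := by
  have hm : (0 : ℤ) < D.m i := by exact_mod_cast D.m_pos i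
  suffices h : p.tauT i (p.tauT i x) - algebraMap ℂ S.K (p.q i) * p.tauT i x - x = 0 by
    linear_combination h
  induction x using D.induction_K D.eta with
  | add x y hx hy =>
    simp only [map_add]
    linear_combination hx + hy
  | mul f hf lam =>
    -- Translation by `t α_i^m` lowers the pairing by `2 t m(α_i)`; this rounding of `t` places it
    -- between `1 - m(α_i)` and `m(α_i)`. There `τ(T_i)` acts explicitly on the span of `x^{μ+η}`
    -- and `x^{s_i μ+η}`.
    set t := (pair lam i + D.m i - 1) / (2 * D.m i) with ht
    have e : f * S.X (lam + D.eta) = (f * S.X (t • D.mroot i)) *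
        S.X (lam - t • D.mroot i + D.eta) := by
      rw [mul_assoc, ← X_add]
      congr 2
      module
    have hmem : f * S.X (t • D.mroot i) ∈ D.Km :=
      mul_mem hf (D.X_mem_Km (zsmul_mem (D.mroot_mem_Pm i) _))
    rw [e, p.tauT_quadratic_mul i hmem]
    refine mul_eq_zero_of_right _ ?_
    set mu := lam - t • D.mroot i with hmu
    have hpair : pair mu i = pair lam i - t * (2 * D.m i) := by
      rw [hmu, pair_sub, pair_zsmul, pair_mroot_self]
    have hlt := Int.lt_ediv_add_one_mul_self (pair lam i + D.m i - 1) (show 0 < 2 * (D.m i : ℤ) by omega)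
    have hle := Int.ediv_mul_le (pair lam i + D.m i - 1) (show 2 * (D.m i : ℤ) ≠ 0 by omega)
    rw [← ht, add_mul] at hlt
    rw [← ht] at hle
    have hcc : ∀ a, algebraMap ℂ S.K (p.coef i a) * algebraMap ℂ S.K (p.coef i a)⁻¹ = 1 := by
      intro a
      rw [← map_mul, mul_inv_cancel₀ (p.coef_ne_zero i a), map_one]
    have hss : S.s i • S.s i • mu = mu := by rw [← mul_smul, s_mul_s, one_smul]
    have hps : pair (S.s i • mu) i = -pair mu i := S.pair_s_smul_self i mu
    rcases lt_trichotomy (pair mu i) 0 with h0 | h0 | h0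
    · have h1 := p.tauT_X_of_neg i h0 (by omega)
      have h2 := p.tauT_X_of_le i (lam := S.s i • mu) (by omega) (by omega)
      rw [hss, hps] at h2
      have h3 := p.tauT i |>.map_add (algebraMap ℂ S.K (p.q i) * S.X (mu + D.eta))
        (algebraMap ℂ S.K (p.coef i (-pair mu i))⁻¹ * S.X (S.s i • mu + D.eta))
      rw [← h1, ← Algebra.smul_def, ← Algebra.smul_def, map_smul, map_smul, Algebra.smul_def,
        Algebra.smul_def, h2] at h3
      linear_combination h3 + S.X (mu + D.eta) * hcc (-pair mu i)
    · have h1 := p.tauT_X_of_le i (lam := mu) h0.ge (by omega)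
      have hs : S.s i • mu = mu := by rw [s_smul, h0, zero_smul, sub_zero]
      rw [hs, h0, coef_zero] at h1
      rw [h1, ← Algebra.smul_def, map_smul, h1, Algebra.smul_def, Algebra.smul_def, q, map_sub,
        map_inv₀]
      have := p.k_ne_zero (D := D) i
      field_simp
      ring
    · have h1 := p.tauT_X_of_le i (lam := mu) h0.le (by omega)
      have h2 := p.tauT_X_of_neg i (lam := S.s i • mu) (by omega) (by omega)
      rw [hss, hps, neg_neg] at h2
      rw [h1, ← Algebra.smul_def, map_smul, h2, Algebra.smul_def, Algebra.smul_def]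
      linear_combination S.X (mu + D.eta) * hcc (pair mu i)

/-- The inverse of `τ(T_i)`. -/
def tauTInv (i : S.I) : Module.End ℂ S.K := p.tauT i - p.q i • 1

lemma tauTInv_apply (i : S.I) (x : S.K) :
    p.tauTInv i x = p.tauT i x - algebraMap ℂ S.K (p.q i) * x := by
  simp [tauTInv, Algebra.smul_def]

lemma tauT_eq (i : S.I) : p.tauT i = p.tauTInv i + p.q i • 1 := by simp [tauTInv]

lemma tauT_mul_tauTInv (i : S.I) : p.tauT i * p.tauTInv i = 1 := by
  ext x
  rw [Module.End.mul_apply, tauTInv_apply, map_sub, ← Algebra.smul_def, map_smul, tauT_quadratic,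
    Algebra.smul_def, Module.End.one_apply]
  ring

lemma tauTInv_mul_tauT (i : S.I) : p.tauTInv i * p.tauT i = 1 := by
  ext x
  rw [Module.End.mul_apply, tauTInv_apply, tauT_quadratic, Module.End.one_apply]
  ring

lemma isUnit_tauT (i : S.I) : IsUnit (p.tauT i) :=
  ⟨⟨p.tauT i, p.tauTInv i, p.tauT_mul_tauTInv i, p.tauTInv_mul_tauT i⟩, rfl⟩

lemma ringInverse_tauT (i : S.I) : Ring.inverse (p.tauT i) = p.tauTInv i :=
  Ring.inverse_unit ⟨p.tauT i, p.tauTInv i, p.tauT_mul_tauTInv i, p.tauTInv_mul_tauT i⟩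

/-- `τ(T_i)` and a monomial `x^ν` with `(ν, α_i^{m∨}) = 0`. -/
lemma tauT_mulOp_zero (i : S.I) {nu : S.P} (h : nu ∈ D.Pm) (h0 : pair nu i = 0) :
    p.tauT i * S.mulOp (S.X nu) = S.mulOp (S.X nu) * p.tauT i := by
  ext x
  simp only [Module.End.mul_apply, mulOp_apply]
  rw [p.tauT_mul i (D.X_mem_Km h), weylK_X, s_smul, h0]
  simp

/-- `τ(T_i)` and a monomial `x^ν` with `(ν, α_i^{m∨}) = 1`. -/
lemma tauT_mulOp_one (i : S.I) {nu : S.P} (h : nu ∈ D.Pm) (h1 : pair nu i = D.m i) :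
    p.tauT i * S.mulOp (S.X nu) = S.mulOp (S.X (S.s i • nu)) * p.tauTInv i := by
  ext x
  simp only [Module.End.mul_apply, mulOp_apply]
  have hs : nu = S.s i • nu + D.mroot i := by
    rw [D.s_smul_of_pair_eq (a := 1) (by rw [one_mul]; exact h1)]
    module
  have e : S.X nu = S.X (S.s i • nu) * S.X (D.mroot i) := by rw [← X_add, ← hs]
  rw [p.tauT_mul i (D.X_mem_Km h), weylK_X, tauTInv_apply, e]
  have h1 := one_sub_mroot_ne_zero D i
  field_simp
  ring

/-- `τ(T_i)` and the monomial `x^{α_i^m}`. -/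
lemma tauT_mulOp_mroot (i : S.I) : p.tauT i * S.mulOp (S.X (D.mroot i)) =
    S.mulOp (S.X (-D.mroot i)) * p.tauTInv i - p.q i • 1 := by
  ext x
  simp only [Module.End.mul_apply, mulOp_apply, LinearMap.sub_apply, LinearMap.smul_apply,
    Module.End.one_apply]
  rw [p.tauT_mul i (D.X_mem_Km (D.mroot_mem_Pm i)), weylK_X, s_smul_mroot, tauTInv_apply, X_neg,
    Algebra.smul_def]
  have h1 := one_sub_mroot_ne_zero D i
  have h4 := S.X_ne_zero (D.mroot i)
  field_simp
  ring

end Parameters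

end

end Metaplectic

namespace Metaplectic

noncomputable section

open BasedRootSystem MetaplecticStructure

/-! ### Rank two computations from the quadratic relations -/

section Braid

variable {R : Type*} [Ring R]

/-- The difference of the two sides of the braid relation of length `m`. -/
def braidDefect (s t : R) (m : ℕ) : R := (altList s t m).prod - (altList t s m).prod

lemma braidDefect_swap (s t : R) (m : ℕ) : braidDefect t s m = -braidDefect s t m := by
  rw [braidDefect, braidDefect, neg_sub]

lemma mul_comm_assoc {s x y z : R} (h : s * x = y * z) (r : R) : s * (x * r) = y * (z * r) := by
  rw [← mul_assoc, h, mul_assoc]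

lemma mul_anticomm_assoc {s x y z : R} (h : s * x = -(y * z)) (r : R) :
    s * (x * r) = -(y * (z * r)) := by
  rw [← mul_assoc, h, neg_mul, mul_assoc]

variable [Algebra ℂ R] {s s' t t' : R} {a b : ℂ}

/-- `s` is invertible with inverse `s' = s - a`. -/
structure QuadraticPair (s s' : R) (a : ℂ) : Prop where
  mul_inv : s * s' = 1
  inv_mul : s' * s = 1
  eq_add : s = s' + a • 1

lemma QuadraticPair.mul_inv_assoc (h : QuadraticPair s s' a) (x : R) : s * (s' * x) = x := by
  rw [← mul_assoc, h.mul_inv, one_mul]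

lemma QuadraticPair.inv_mul_assoc (h : QuadraticPair s s' a) (x : R) : s' * (s * x) = x := by
  rw [← mul_assoc, h.inv_mul, one_mul]

lemma QuadraticPair.inv_eq (h : QuadraticPair s s' a) : s' = s - a • 1 :=
  eq_sub_of_add_eq h.eq_add.symm

lemma QuadraticPair.sq (h : QuadraticPair s s' a) : s * s = 1 + a • s := by
  nth_rewrite 2 [h.eq_add]
  rw [mul_add, h.mul_inv, mul_smul_comm, mul_one]

lemma QuadraticPair.sq_assoc (h : QuadraticPair s s' a) (x : R) :
    s * (s * x) = x + a • (s * x) := by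
  rw [← mul_assoc, h.sq, add_mul, one_mul, smul_mul_assoc]

/-- No braid relation is needed. Multiplying the alternating words by `s` either lengthens them or
produces `s² = 1 + a s`, and the words of length `m + 1` and `m - 1` match on the two sides. -/
lemma braidDefect_mul_even (hs : QuadraticPair s s' a) {m : ℕ}
    (hm : m = 2 ∨ m = 4 ∨ m = 6) : braidDefect s t m * s = -(s' * braidDefect s t m) := by
  rw [hs.inv_eq]
  rcases hm with rfl | rfl | rfl <;>
    simp only [braidDefect, altList, List.prod_cons, List.prod_nil, mul_one, mul_assoc, mul_sub,
      sub_mul, hs.sq, hs.sq_assoc, mul_add, smul_mul_assoc, one_mul, mul_smul_comm] <;>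
    module

lemma braidDefect_mul_odd (hs : QuadraticPair s s' a) (ht : QuadraticPair t t' a) :
    braidDefect s t 3 * s = -(t' * braidDefect s t 3) := by
  rw [ht.inv_eq]
  simp only [braidDefect, altList, List.prod_cons, List.prod_nil, mul_one, mul_assoc, mul_sub,
      sub_mul, hs.sq, ht.sq_assoc, mul_add, smul_mul_assoc, one_mul, mul_smul_comm]
  module

lemma QuadraticPair.mul_inv_eq_of_mul_eq (hs : QuadraticPair s s' a) (ht : QuadraticPair t t' b)
    {d : R} (h : d * s = -(t' * d)) : d * s' = -(t * d) := by
  have h1 : t * (d * s) * s' = -(t * (t' * d)) * s' := by rw [h, mul_neg]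
  rw [ht.mul_inv_assoc, mul_assoc, mul_assoc, hs.mul_inv, mul_one] at h1
  rw [h1, neg_mul, neg_neg]

variable {x₀ x₁ x₂ x₃ x₄ x₅ : R}

lemma mul_comm_sub_assoc {s x y z : R} (h : s * x = y * z - b • 1) (r : R) :
    s * (x * r) = y * (z * r) - b • r := by
  rw [← mul_assoc, h, sub_mul, mul_assoc, smul_mul_assoc, one_mul]

/-- In this and the next three lemmas the `x_i` stand for monomials on the string from a dominant
root to its negative. Pushing `x₀` through either word meets the correction `-b • 1` (here `-a • 1`)
exactly once. The two correction terms are equal and cancel in the defect. -/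
lemma braidDefect_two_mul (hs : QuadraticPair s s' a)
    (h₁ : t * x₀ = x₀ * t) (h₂ : s * x₀ = x₁ * s' - a • 1) (h₃ : t * x₁ = x₁ * t) :
    braidDefect s t 2 * x₀ = x₁ * braidDefect s t 2 := by
  simp only [braidDefect, altList, List.prod_cons, List.prod_nil, mul_one, mul_assoc, sub_mul,
    h₁, h₂, h₃, mul_sub, mul_comm_sub_assoc h₂, mul_comm_assoc h₃, mul_smul_comm, hs.inv_eq, smul_mul_assoc,
    one_mul]
  module

lemma braidDefect_three_mul (hs : QuadraticPair s s' a) (ht : QuadraticPair t t' a)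
    {y₁ y₂ : R} (h₁ : s * x₀ = x₁ * s') (h₂ : t * x₁ = x₂ * t' - a • 1) (h₃ : s * x₂ = x₃ * s')
    (h₄ : t * x₀ = y₁ * t') (h₅ : s * y₁ = y₂ * s' - a • 1) (h₆ : t * y₂ = x₃ * t') :
    braidDefect s t 3 * x₀ = x₃ * braidDefect s t 3 := by
  -- After `x₀` has been pushed through, inverses replace the operators. The difference of inverses
  -- is `-(sts)⁻¹ (sts - tst) (tst)⁻¹`; moving the defect through the right factor by
  -- anticommutation turns that factor into `sts` on its left with a sign, and everything cancels.
  -- The lengths four and six use the same device.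
  have e : s' * (t' * s') - t' * (s' * t') = braidDefect s t 3 := by
    have hd := hs.mul_inv_eq_of_mul_eq ht (braidDefect_mul_odd hs ht)
    have hd' := ht.mul_inv_eq_of_mul_eq hs (braidDefect_mul_odd ht hs)
    rw [braidDefect_swap, neg_mul, mul_neg, neg_neg, neg_eq_iff_eq_neg] at hd'
    have h : s' * (t' * s') - t' * (s' * t') =
        -(s' * (t' * (s' * (braidDefect s t 3 * (t' * (s' * t')))))) := by
      simp only [braidDefect, altList, List.prod_cons, List.prod_nil, sub_mul, mul_sub,
        mul_assoc, hs.mul_inv_assoc, ht.mul_inv_assoc, hs.inv_mul_assoc, ht.inv_mul_assoc,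
        ht.mul_inv, mul_one]
      abel
    rw [h]
    simp only [hd', mul_anticomm_assoc hd, mul_anticomm_assoc hd', mul_neg, neg_neg,
      hs.inv_mul_assoc, ht.inv_mul_assoc]
  have h : braidDefect s t 3 * x₀ = x₃ * (s' * (t' * s') - t' * (s' * t')) := by
    simp only [braidDefect, altList, List.prod_cons, List.prod_nil, mul_one, mul_assoc, sub_mul,
      h₁, h₄, mul_comm_sub_assoc h₂, mul_comm_assoc h₃, mul_comm_sub_assoc h₅, mul_comm_assoc h₆,
      mul_sub, mul_smul_comm, hs.mul_inv, ht.mul_inv]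
    abel
  rw [h, e]

lemma braidDefect_four_mul (hs : QuadraticPair s s' a) (ht : QuadraticPair t t' b)
    (h₁ : t * x₀ = x₀ * t) (h₂ : s * x₀ = x₁ * s') (h₃ : t * x₁ = x₂ * t' - b • 1)
    (h₄ : s * x₂ = x₃ * s') (h₅ : t * x₃ = x₃ * t) :
    braidDefect s t 4 * x₀ = x₃ * braidDefect s t 4 := by
  have e : s' * (t' * (s' * t)) - t * (s' * (t' * s')) = braidDefect s t 4 := by
    have hd := hs.mul_inv_eq_of_mul_eq hs (braidDefect_mul_even (t := t) hs (m := 4) (by simp))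
    have hd' := ht.mul_inv_eq_of_mul_eq ht (braidDefect_mul_even (t := s) ht (m := 4) (by simp))
    rw [braidDefect_swap, neg_mul, mul_neg, neg_neg, neg_eq_iff_eq_neg] at hd'
    have h : s' * (t' * (s' * t)) - t * (s' * (t' * s')) =
        -(s' * (t' * (s' * (braidDefect s t 4 * (s' * (t' * s')))))) := by
      simp only [braidDefect, altList, List.prod_cons, List.prod_nil, sub_mul, mul_sub,
        mul_assoc, hs.mul_inv_assoc, ht.mul_inv_assoc, hs.inv_mul_assoc, ht.inv_mul_assoc,
        hs.mul_inv, mul_one]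
      abel
    rw [h]
    simp only [hd, mul_anticomm_assoc hd, mul_anticomm_assoc hd', mul_neg, neg_neg,
      hs.inv_mul_assoc, ht.inv_mul_assoc]
  have h : braidDefect s t 4 * x₀ =
      x₃ * (s' * (t' * (s' * t)) - t * (s' * (t' * s'))) := by
    simp only [braidDefect, altList, List.prod_cons, List.prod_nil, mul_one, mul_assoc, sub_mul,
      h₁, h₂, mul_comm_assoc h₂, mul_comm_sub_assoc h₃, mul_comm_assoc h₄, mul_comm_assoc h₅,
      mul_sub, mul_smul_comm, hs.mul_inv, hs.mul_inv_assoc]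
    abel
  rw [h, e]

lemma braidDefect_six_mul (hs : QuadraticPair s s' a) (ht : QuadraticPair t t' b)
    (h₁ : s * x₀ = x₀ * s) (h₂ : t * x₀ = x₁ * t') (h₃ : s * x₁ = x₂ * s')
    (h₄ : t * x₂ = x₃ * t' - b • 1) (h₅ : s * x₃ = x₄ * s') (h₆ : t * x₄ = x₅ * t')
    (h₇ : s * x₅ = x₅ * s) :
    braidDefect s t 6 * x₀ = x₅ * braidDefect s t 6 := by
  have e : s * (t' * (s' * (t' * (s' * t')))) - t' * (s' * (t' * (s' * (t' * s)))) =
      braidDefect s t 6 := by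
    have hd := hs.mul_inv_eq_of_mul_eq hs (braidDefect_mul_even (t := t) hs (m := 6) (by simp))
    have hd' := ht.mul_inv_eq_of_mul_eq ht (braidDefect_mul_even (t := s) ht (m := 6) (by simp))
    rw [braidDefect_swap, neg_mul, mul_neg, neg_neg, neg_eq_iff_eq_neg] at hd'
    have h : s * (t' * (s' * (t' * (s' * t')))) - t' * (s' * (t' * (s' * (t' * s)))) =
        -(t' * (s' * (t' * (s' * (t' * (braidDefect s t 6 * (t' * (s' * (t' * (s' * t')))))))))) := by
      simp only [braidDefect, altList, List.prod_cons, List.prod_nil, sub_mul, mul_sub,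
        mul_assoc, hs.mul_inv_assoc, ht.mul_inv_assoc, hs.inv_mul_assoc, ht.inv_mul_assoc,
        ht.mul_inv, mul_one]
      abel
    rw [h]
    simp only [hd', mul_anticomm_assoc hd, mul_anticomm_assoc hd', mul_neg, neg_neg,
      hs.inv_mul_assoc, ht.inv_mul_assoc]
  have h : braidDefect s t 6 * x₀ =
      x₅ * (s * (t' * (s' * (t' * (s' * t')))) - t' * (s' * (t' * (s' * (t' * s))))) := by
    simp only [braidDefect, altList, List.prod_cons, List.prod_nil, mul_one, mul_assoc, sub_mul,
      h₁, h₂, mul_comm_assoc h₂, mul_comm_assoc h₃, mul_comm_sub_assoc h₄, mul_comm_assoc h₅,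
      mul_comm_assoc h₆, mul_comm_assoc h₇, mul_sub, mul_smul_comm, hs.mul_inv_assoc,
      ht.mul_inv, ht.mul_inv_assoc]
    abel
  rw [h, e]

end Braid

end

end Metaplectic

namespace Metaplectic

noncomputable section

open BasedRootSystem MetaplecticStructure

lemma map_altList {α β : Type*} (f : α → β) (i j : α) (n : ℕ) :
    (altList i j n).map f = altList (f i) (f j) n := by
  induction n generalizing i j with
  | zero => rfl
  | succ n ih => rw [altList, altList, List.map_cons, ih]

/-! ### The longest element of a rank two parabolic subgroup -/

namespace BasedRootSystem

variable {ι E : Type*} [Fintype ι] [NormedAddCommGroup E] [InnerProductSpace ℝ E]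
  (S : BasedRootSystem ι E)

/-- The longest element of the subgroup generated by `s_i` and `s_j`. -/
def dihedralLongest (i j : S.I) : S.W := S.wordProd (altList i j (S.cox i j))

lemma dihedralLongest_comm {i j : S.I} (h : i ≠ j) :
    S.dihedralLongest j i = S.dihedralLongest i j := by
  rw [dihedralLongest, dihedralLongest, S.wordProd_altList h, cox_comm]

open Classical in
/-- `w α_i = -α_{opp i j}` for the longest element `w` of the subgroup generated by
`s_i` and `s_j`. -/
def opp (i j : S.I) : S.I := if S.cox i j = 3 then j else i

lemma dihedralLongest_smul_left {i j : S.I} (h : i ≠ j) :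
    S.dihedralLongest i j • S.rootP i = -S.rootP (S.opp i j) := by
  have h0 : S.rootP i = S.rootP i - (0 : ℤ) • S.rootP i - (0 : ℤ) • S.rootP j := by simp
  rw [dihedralLongest]
  rcases S.car_cases h with h' | h' | h' | h' | h' | h' <;> obtain ⟨h1, h2⟩ := h' <;>
    simp only [opp, cox, h1, h2] <;> norm_num <;>
    simp only [altList, wordProd_cons, wordProd_nil, mul_one, mul_smul] <;>
    nth_rewrite 1 [h0] <;>
    simp only [s_smul_coords, s_smul_coords', h1, h2, pair_rootP_self] <;>
    simp only [show pair (S.rootP i) j = -S.car i j by rw [car, neg_neg], h1] <;>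
    module

lemma dihedralLongest_smul_right {i j : S.I} (h : i ≠ j) :
    S.dihedralLongest i j • S.rootP j = -S.rootP (S.opp j i) := by
  rw [← S.dihedralLongest_comm h, S.dihedralLongest_smul_left h.symm]

lemma dihedralLongest_smul_idx {i j : S.I} (h : i ≠ j) :
    S.dihedralLongest i j • (i : ι) = S.s (S.opp i j) • (S.opp i j : ι) := by
  have h1 := congrArg Subtype.val (S.dihedralLongest_smul_left h)
  apply S.R.root.injective
  rw [root_smul]
  exact h1.trans (S.root_negIdx _).symm

lemma cox_cases (i j : S.I) : S.cox i j = 3 ∨ S.cox i j = 2 ∨ S.cox i j = 4 ∨ S.cox i j = 6 := by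
  unfold cox
  split_ifs <;> simp

end BasedRootSystem

namespace MetaplecticStructure

variable {ι E : Type*} [Fintype ι] [NormedAddCommGroup E] [InnerProductSpace ℝ E]
  {S : BasedRootSystem ι E} (D : MetaplecticStructure S)

/-- The Cartan integers of `Φ^m` for a pair of simple roots. -/
lemma exists_cartan {i j : S.I} (h : i ≠ j) : ∃ A B : ℤ,
    pair (D.mroot i) j = -(A * D.m j) ∧ pair (D.mroot j) i = -(B * D.m i) ∧
    ((S.cox i j = 2 ∧ A = 0 ∧ B = 0) ∨ (S.cox i j = 3 ∧ A = 1 ∧ B = 1) ∨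
      (S.cox i j = 4 ∧ A = 2 ∧ B = 1) ∨ (S.cox i j = 4 ∧ A = 1 ∧ B = 2) ∨
      (S.cox i j = 6 ∧ A = 3 ∧ B = 1) ∨ (S.cox i j = 6 ∧ A = 1 ∧ B = 3)) := by
  have hmi : (0 : ℤ) < D.m i := by exact_mod_cast D.m_pos i
  have hmj : (0 : ℤ) < D.m j := by exact_mod_cast D.m_pos j
  obtain ⟨A, hA⟩ := (D.mem_Pm_iff _).1 (D.mroot_mem_Pm i) j
  obtain ⟨B, hB⟩ := (D.mem_Pm_iff _).1 (D.mroot_mem_Pm j) i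
  have hA' : D.m i * S.car i j = -A * D.m j := by
    rw [mroot, pair_nsmul] at hA
    rw [car]
    linarith
  have hB' : D.m j * S.car j i = -B * D.m i := by
    rw [mroot, pair_nsmul] at hB
    rw [car]
    linarith
  -- The factors `m(α_i)`, `m(α_j)` cancel in the product, so `Φ^m` has the same Coxeter order as
  -- `Φ` for this pair, although long and short roots may be exchanged.
  have hAB : A * B = S.car i j * S.car j i := by
    have : (D.m i * D.m j : ℤ) * (A * B) = (D.m i * D.m j) * (S.car i j * S.car j i) := by
      linear_combination (-(D.m j * S.car j i)) * hA' + (A * D.m j) * hB'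
    exact mul_left_cancel₀ (mul_pos hmi hmj).ne' this
  have hc : 0 ≤ S.car i j ∧ 0 ≤ S.car j i := by
    rcases S.car_cases h with h | h | h | h | h | h <;> omega
  have hA0 : 0 ≤ -A := by
    by_contra hn
    have := mul_nonneg hmi.le hc.1
    nlinarith
  have hB0 : 0 ≤ -B := by
    by_contra hn
    have := mul_nonneg hmj.le hc.2
    nlinarith
  refine ⟨-A, -B, by rw [hA]; ring, by rw [hB]; ring, ?_⟩
  have hle : ∀ k : ℤ, 0 < k → k ≤ 3 → A * B = k → -A ≤ 3 ∧ -B ≤ 3 ∧ 1 ≤ -A ∧ 1 ≤ -B := by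
    intro k hk hk3 he
    have h1 : 1 ≤ -A := by
      by_contra hn
      have : A = 0 := by omega
      rw [this] at he
      omega
    have h2 : 1 ≤ -B := by
      by_contra hn
      have : B = 0 := by omega
      rw [this] at he
      omega
    exact ⟨by nlinarith, by nlinarith, h1, h2⟩
  rcases S.car_cases h with h' | h' | h' | h' | h' | h' <;> obtain ⟨h1, h2⟩ := h' <;>
    rw [h1, h2] at hAB <;> simp only [cox, h1, h2] <;> norm_num
  · rw [h1] at hA'
    rw [h2] at hB'
    constructor
    · by_contra hn
      exact (mul_ne_zero (neg_ne_zero.2 hn) hmj.ne') (by linarith)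
    · by_contra hn
      exact (mul_ne_zero (neg_ne_zero.2 hn) hmi.ne') (by linarith)
  all_goals
    obtain ⟨h3, h4, h5, h6⟩ := hle _ (by norm_num) (by norm_num) hAB
    generalize hA'' : -A = a at *
    generalize hB'' : -B = b at *
    obtain rfl : A = -a := by omega
    obtain rfl : B = -b := by omega
    clear hA hB hA' hB' hA'' hB'' hle
    interval_cases a <;> interval_cases b <;> omega

end MetaplecticStructure

/-! ### Commutation of the braid defect with `τ(T_i)` and with monomials -/

namespace Parameters

variable {ι E : Type*} [Fintype ι] [NormedAddCommGroup E] [InnerProductSpace ℝ E]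
  {S : BasedRootSystem ι E} {D : MetaplecticStructure S} (p : Parameters D)

lemma quadraticPair (i : S.I) : QuadraticPair (p.tauT i) (p.tauTInv i) (p.q i) :=
  ⟨p.tauT_mul_tauTInv i, p.tauTInv_mul_tauT i, p.tauT_eq i⟩

/-- The difference of the two sides of the braid relation for `τ(T_i)` and `τ(T_j)`. -/
def defect (i j : S.I) : Module.End ℂ S.K := braidDefect (p.tauT i) (p.tauT j) (S.cox i j)

lemma defect_swap (i j : S.I) : p.defect j i = -p.defect i j := by
  rw [defect, cox_comm, braidDefect_swap, defect]

lemma k_opp {i j : S.I} (h : i ≠ j) : p.k (S.opp i j) = p.k i := by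
  rw [← p.k_smul (S.dihedralLongest i j) i, S.dihedralLongest_smul_idx h, p.k_smul]

lemma m_opp (D : MetaplecticStructure S) {i j : S.I} (h : i ≠ j) : D.m (S.opp i j) = D.m i := by
  rw [← D.m_smul (S.dihedralLongest i j) i, S.dihedralLongest_smul_idx h, D.m_smul]

/-- For order three the longest dihedral element maps `α_i` to `-α_j`, so the two Hecke parameters
agree. The odd case of the defect computation needs this. -/
lemma q_eq {i j : S.I} (h : i ≠ j) (h3 : S.cox i j = 3) : p.q j = p.q i := by
  have := p.k_opp h
  rw [opp, if_pos h3] at this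
  rw [q, q, this]

lemma defect_mul_left {i j : S.I} (h : i ≠ j) :
    p.defect i j * p.tauT i = -(p.tauTInv (S.opp i j) * p.defect i j) := by
  rcases S.cox_cases i j with h3 | h3
  · have hj := p.quadraticPair j
    rw [p.q_eq h h3] at hj
    rw [opp, if_pos h3, defect, h3, braidDefect_mul_odd (p.quadraticPair i) hj]
  · rw [opp, if_neg (by omega), defect, braidDefect_mul_even (p.quadraticPair i) h3]

lemma neg_mul_end (f g : Module.End ℂ S.K) : -f * g = -(f * g) := neg_mul f g

lemma mul_neg_end (f g : Module.End ℂ S.K) : f * -g = -(f * g) := mul_neg f g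

lemma defect_mul_right {i j : S.I} (h : i ≠ j) :
    p.defect i j * p.tauT j = -(p.tauTInv (S.opp j i) * p.defect i j) := by
  have := p.defect_mul_left h.symm
  rwa [defect_swap, neg_mul_end, mul_neg_end, neg_neg, neg_eq_iff_eq_neg] at this

/-- The exponents `ν` such that the defect of the braid relation intertwines multiplication by `x^ν`
and by `x^{wν}`, `w` the longest element of the dihedral group. -/
def defectComm {i j : S.I} : AddSubgroup S.P where
  carrier := {nu | p.defect i j * S.mulOp (S.X nu) =
    S.mulOp (S.X (S.dihedralLongest i j • nu)) * p.defect i j}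
  zero_mem' := by simp [X_zero, mulOp_one]
  add_mem' {a b} ha hb := by
    rw [Set.mem_ofPred_eq] at *
    rw [X_add, mulOp_mul, ← mul_assoc, ha, mul_assoc, hb, smul_add, X_add, mulOp_mul, mul_assoc]
  neg_mem' {a} ha := by
    rw [Set.mem_ofPred_eq] at *
    have h : ∀ a : S.P, S.mulOp (S.X (-a)) * S.mulOp (S.X a) = 1 := by
      intro a
      rw [← mulOp_mul, ← X_add, neg_add_cancel, X_zero, mulOp_one]
    have h' : S.mulOp (S.X a) * S.mulOp (S.X (-a)) = 1 := by
      simpa using h (-a)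
    have h2 := congrArg (fun x => S.mulOp (S.X (S.dihedralLongest i j • -a)) * x *
      S.mulOp (S.X (-a))) ha
    simp only [mul_assoc] at h2
    rw [h', mul_one, ← mul_assoc (S.mulOp (S.X (S.dihedralLongest i j • -a))), smul_neg, h,
      one_mul] at h2
    rw [smul_neg]
    exact h2.symm

lemma mem_defectComm {i j : S.I} {nu : S.P} : nu ∈ p.defectComm (i := i) (j := j) ↔
    p.defect i j * S.mulOp (S.X nu) =
      S.mulOp (S.X (S.dihedralLongest i j • nu)) * p.defect i j := Iff.rfl

lemma mem_defectComm_swap {i j : S.I} (h : i ≠ j) {nu : S.P} :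
    nu ∈ p.defectComm (i := j) (j := i) ↔ nu ∈ p.defectComm (i := i) (j := j) := by
  rw [mem_defectComm, mem_defectComm, defect_swap, S.dihedralLongest_comm h, neg_mul_end, mul_neg_end,
    neg_inj]

lemma tauT_mulOp_sub (i : S.I) {nu nu' : S.P} (h : nu ∈ D.Pm) (h1 : pair nu i = D.m i)
    (h' : nu' = nu - D.mroot i) :
    p.tauT i * S.mulOp (S.X nu) = S.mulOp (S.X nu') * p.tauTInv i := by
  rw [p.tauT_mulOp_one i h h1, D.s_smul_of_pair_eq (a := 1) (by rw [one_mul]; exact h1), one_smul,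
    h']

/-- When `(ν, α_i^{m∨}) = 1` one has `x^{ν-α_i^m} = τ(T_i) x^ν τ(T_i)`. The defect passes both outer
factors, and the two signs cancel. One good exponent thus yields further ones down the string. -/
lemma sub_mem_defectComm {i j : S.I} (h : i ≠ j) {nu : S.P} (hnu : nu ∈ D.Pm)
    (h1 : pair nu i = D.m i) (hmem : nu ∈ p.defectComm (i := i) (j := j)) :
    nu - D.mroot i ∈ p.defectComm (i := i) (j := j) := by
  rw [mem_defectComm] at *
  set V := S.dihedralLongest i j with hV
  set i' := S.opp i j with hi'
  have hroot : V • D.mroot i = -D.mroot i' := by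
    rw [mroot, smul_comm V, S.dihedralLongest_smul_left h, mroot, m_opp D h, smul_neg]
  have hp : pair (V • nu) i' = -D.m i := by
    have h2 : pair (V • nu) (V • (i : ι)) = pair nu i := S.pair_smul_smul V nu i
    rw [S.dihedralLongest_smul_idx h, ← hi', ← S.s_inv, ← pair_smul, pair_s_smul_self, h1] at h2
    omega
  have hp' : pair (V • (nu - D.mroot i)) i' = D.m i' := by
    rw [smul_sub, hroot, pair_sub, pair_neg, hp, pair_mroot_self, m_opp D h]
    ring
  have hPm : V • (nu - D.mroot i) ∈ D.Pm := D.smul_mem_Pm V (sub_mem hnu (D.mroot_mem_Pm i))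
  have e1 := p.tauT_mulOp_sub i' (nu' := V • nu) hPm hp' (by rw [smul_sub, hroot]; abel)
  have e2 := p.tauT_mulOp_sub i hnu h1 rfl
  have e3 : S.mulOp (S.X (nu - D.mroot i)) = p.tauT i * (S.mulOp (S.X nu) * p.tauT i) := by
    rw [← mul_assoc, e2, mul_assoc, tauTInv_mul_tauT, mul_one]
  have e4 : p.tauTInv i' * S.mulOp (S.X (V • nu)) =
      S.mulOp (S.X (V • (nu - D.mroot i))) * p.tauT i' := by
    have := congrArg (fun x => p.tauTInv i' * x * p.tauT i') e1
    simp only [mul_assoc, tauTInv_mul_tauT, mul_one] at this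
    rw [← mul_assoc (p.tauTInv i'), tauTInv_mul_tauT, one_mul] at this
    exact this.symm
  rw [e3, ← mul_assoc, p.defect_mul_left h, neg_mul_end, mul_assoc, ← mul_assoc (p.defect i j), hmem,
    mul_assoc, p.defect_mul_left h, mul_neg_end, mul_neg_end, neg_neg, ← mul_assoc, e4, mul_assoc,
    ← mul_assoc (p.tauT _), tauT_mul_tauTInv, one_mul]

/-- The longest element is `-1` on the span of the two roots, combined with the swap of `i` and `j`
when the order is three. The assumption on `a` and `c` makes `ν` invariant under that swap. -/
lemma mem_defectComm_of_neg {i j : S.I} (h : i ≠ j) {a c : ℕ} {nu : S.P}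
    (hnu : nu = a • D.mroot i + c • D.mroot j) (hac : S.cox i j = 3 → a = c)
    (hd : p.defect i j * S.mulOp (S.X nu) = S.mulOp (S.X (-nu)) * p.defect i j) :
    nu ∈ p.defectComm (i := i) (j := j) := by
  have hi : S.dihedralLongest i j • D.mroot i = -D.mroot (S.opp i j) := by
    rw [mroot, smul_comm (S.dihedralLongest i j), S.dihedralLongest_smul_left h, mroot, m_opp D h,
      smul_neg]
  have hj : S.dihedralLongest i j • D.mroot j = -D.mroot (S.opp j i) := by
    rw [mroot, smul_comm (S.dihedralLongest i j), S.dihedralLongest_smul_right h, mroot,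
      m_opp D h.symm, smul_neg]
  have hV : S.dihedralLongest i j • nu = -nu := by
    rw [hnu, smul_add, smul_comm _ a, smul_comm _ c, hi, hj, opp, opp, S.cox_comm j i]
    split_ifs with h3
    · rw [hac h3, smul_neg, smul_neg]
      abel
    · rw [smul_neg, smul_neg]
      abel
  rw [mem_defectComm, hV, hd]

end Parameters

end

end Metaplectic

namespace Metaplectic

noncomputable section

open BasedRootSystem MetaplecticStructure

namespace Parameters

variable {ι E : Type*} [Fintype ι] [NormedAddCommGroup E] [InnerProductSpace ℝ E]
  {S : BasedRootSystem ι E} {D : MetaplecticStructure S} (p : Parameters D)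

lemma mroot_mem_defectComm_two {i j : S.I} (h : i ≠ j) (hc : S.cox i j = 2)
    (h1 : pair (D.mroot i) j = 0) : D.mroot i ∈ p.defectComm (i := i) (j := j) := by
  have hi := D.mroot_mem_Pm i
  refine p.mem_defectComm_of_neg h (a := 1) (c := 0) (by simp) (by omega) ?_
  rw [defect, hc]
  exact braidDefect_two_mul (p.quadraticPair i) (p.tauT_mulOp_zero j hi h1)
    (p.tauT_mulOp_mroot i) (p.tauT_mulOp_zero j (neg_mem hi) (by rw [pair_neg, h1, neg_zero]))

/-- The rank two computation is applied to the dominant root `α_i^m + α_j^m`. Subtracting `α_i^m`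
then reaches `α_j^m`, and the group structure supplies the other generator. For orders four and six
the starting point is the dominant short root of `Φ^m`. -/
lemma mroot_mem_defectComm_three {i j : S.I} (h : i ≠ j) (hc : S.cox i j = 3)
    (h1 : pair (D.mroot i) j = -D.m j) (h2 : pair (D.mroot j) i = -D.m i) :
    D.mroot i ∈ p.defectComm (i := i) (j := j) ∧ D.mroot j ∈ p.defectComm (i := i) (j := j) := by
  have hi := D.mroot_mem_Pm i
  have hj := D.mroot_mem_Pm j
  have h3 := D.pair_mroot_self i
  have h4 := D.pair_mroot_self j
  have hmu : D.mroot i + D.mroot j ∈ p.defectComm (i := i) (j := j) := by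
    refine p.mem_defectComm_of_neg h (a := 1) (c := 1) (by simp) (fun _ => rfl) ?_
    have hq := p.quadraticPair j
    rw [p.q_eq h hc] at hq
    rw [defect, hc]
    refine braidDefect_three_mul (p.quadraticPair i) hq
      (p.tauT_mulOp_sub i (nu' := D.mroot j) (add_mem hi hj) ?_ ?_) ?_
      (p.tauT_mulOp_sub i (nu := -D.mroot j) (neg_mem hj) ?_ ?_)
      (p.tauT_mulOp_sub j (nu' := D.mroot i) (add_mem hi hj) ?_ ?_)
      (p.tauT_mulOp_mroot i)
      (p.tauT_mulOp_sub j (neg_mem hi) ?_ ?_)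
    · rw [pair_add]; omega
    · abel
    · rw [← p.q_eq h hc]; exact p.tauT_mulOp_mroot j
    · rw [pair_neg]; omega
    · abel
    · rw [pair_add]; omega
    · abel
    · rw [pair_neg]; omega
    · abel
  have h5 : D.mroot j ∈ p.defectComm (i := i) (j := j) := by
    have := p.sub_mem_defectComm h (add_mem hi hj) (by rw [pair_add]; omega) hmu
    rwa [add_sub_cancel_left] at this
  refine ⟨?_, h5⟩
  have := sub_mem hmu h5
  rwa [add_sub_cancel_right] at this

lemma mroot_mem_defectComm_four {i j : S.I} (h : i ≠ j) (hc : S.cox i j = 4)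
    (h1 : pair (D.mroot i) j = -(2 * D.m j)) (h2 : pair (D.mroot j) i = -D.m i) :
    D.mroot i ∈ p.defectComm (i := i) (j := j) ∧ D.mroot j ∈ p.defectComm (i := i) (j := j) := by
  have hi := D.mroot_mem_Pm i
  have hj := D.mroot_mem_Pm j
  have h3 := D.pair_mroot_self i
  have h4 := D.pair_mroot_self j
  have hmu : D.mroot i + D.mroot j ∈ p.defectComm (i := i) (j := j) := by
    refine p.mem_defectComm_of_neg h (a := 1) (c := 1) (by simp) (fun _ => rfl) ?_
    rw [defect, hc]
    refine braidDefect_four_mul (p.quadraticPair i) (p.quadraticPair j)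
      (p.tauT_mulOp_zero j (add_mem hi hj) ?_)
      (p.tauT_mulOp_sub i (nu' := D.mroot j) (add_mem hi hj) ?_ ?_)
      (p.tauT_mulOp_mroot j)
      (p.tauT_mulOp_sub i (neg_mem hj) ?_ ?_)
      (p.tauT_mulOp_zero j (neg_mem (add_mem hi hj)) ?_)
    · rw [pair_add]; omega
    · rw [pair_add]; omega
    · abel
    · rw [pair_neg]; omega
    · abel
    · rw [pair_neg, pair_add]; omega
  have h5 : D.mroot j ∈ p.defectComm (i := i) (j := j) := by
    have := p.sub_mem_defectComm h (add_mem hi hj) (by rw [pair_add]; omega) hmu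
    rwa [add_sub_cancel_left] at this
  refine ⟨?_, h5⟩
  have := sub_mem hmu h5
  rwa [add_sub_cancel_right] at this

lemma mroot_mem_defectComm_six {i j : S.I} (h : i ≠ j) (hc : S.cox i j = 6)
    (h1 : pair (D.mroot i) j = -(3 * D.m j)) (h2 : pair (D.mroot j) i = -D.m i) :
    D.mroot i ∈ p.defectComm (i := i) (j := j) ∧ D.mroot j ∈ p.defectComm (i := i) (j := j) := by
  have hi := D.mroot_mem_Pm i
  have hj := D.mroot_mem_Pm j
  have h3 := D.pair_mroot_self i
  have h4 := D.pair_mroot_self j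
  have hP : D.mroot i + 2 • D.mroot j ∈ D.Pm := add_mem hi (nsmul_mem hj 2)
  have hmu : D.mroot i + 2 • D.mroot j ∈ p.defectComm (i := i) (j := j) := by
    refine p.mem_defectComm_of_neg h (a := 1) (c := 2) (by simp) (by omega) ?_
    rw [defect, hc]
    refine braidDefect_six_mul (p.quadraticPair i) (p.quadraticPair j)
      (p.tauT_mulOp_zero i hP ?_)
      (p.tauT_mulOp_sub j (nu' := D.mroot i + D.mroot j) hP ?_ ?_)
      (p.tauT_mulOp_sub i (nu' := D.mroot j) (add_mem hi hj) ?_ ?_)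
      (p.tauT_mulOp_mroot j)
      (p.tauT_mulOp_sub i (nu' := -(D.mroot i + D.mroot j)) (neg_mem hj) ?_ ?_)
      (p.tauT_mulOp_sub j (neg_mem (add_mem hi hj)) ?_ ?_)
      (p.tauT_mulOp_zero i (neg_mem hP) ?_)
    · rw [pair_add, pair_nsmul]; push_cast; omega
    · rw [pair_add, pair_nsmul]; push_cast; omega
    · abel
    · rw [pair_add]; omega
    · abel
    · rw [pair_neg]; omega
    · abel
    · rw [pair_neg, pair_add]; omega
    · abel
    · rw [pair_neg, pair_add, pair_nsmul]; push_cast; omega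
  have h5 : D.mroot i + D.mroot j ∈ p.defectComm (i := i) (j := j) := by
    rw [← p.mem_defectComm_swap h] at hmu ⊢
    have := p.sub_mem_defectComm h.symm hP
      (by rw [pair_add, pair_nsmul]; push_cast; omega) hmu
    have e : D.mroot i + 2 • D.mroot j - D.mroot j = D.mroot i + D.mroot j := by abel
    rwa [e] at this
  have h6 : D.mroot j ∈ p.defectComm (i := i) (j := j) := by
    have := p.sub_mem_defectComm h (add_mem hi hj) (by rw [pair_add]; omega) h5
    rwa [add_sub_cancel_left] at this
  refine ⟨?_, h6⟩
  have := sub_mem h5 h6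
  rwa [add_sub_cancel_right] at this

lemma mroot_mem_defectComm {i j : S.I} (h : i ≠ j) :
    D.mroot i ∈ p.defectComm (i := i) (j := j) ∧ D.mroot j ∈ p.defectComm (i := i) (j := j) := by
  obtain ⟨A, B, hA, hB, hc⟩ := D.exists_cartan h
  have hcomm := S.cox_comm i j
  rcases hc with ⟨hc, rfl, rfl⟩ | ⟨hc, rfl, rfl⟩ | ⟨hc, rfl, rfl⟩ | ⟨hc, rfl, rfl⟩ |
    ⟨hc, rfl, rfl⟩ | ⟨hc, rfl, rfl⟩ <;> simp only [zero_mul, one_mul, neg_zero] at hA hB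
  · refine ⟨p.mroot_mem_defectComm_two h hc hA, ?_⟩
    rw [← p.mem_defectComm_swap h]
    exact p.mroot_mem_defectComm_two h.symm (by omega) hB
  · exact p.mroot_mem_defectComm_three h hc hA hB
  · exact p.mroot_mem_defectComm_four h hc hA hB
  · rw [← p.mem_defectComm_swap h, ← p.mem_defectComm_swap h]
    exact (p.mroot_mem_defectComm_four h.symm (by omega) hB hA).symm
  · exact p.mroot_mem_defectComm_six h hc hA hB
  · rw [← p.mem_defectComm_swap h, ← p.mem_defectComm_swap h]
    exact (p.mroot_mem_defectComm_six h.symm (by omega) hB hA).symm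

end Parameters

/-! ### Reduction of weights modulo a rank two lattice -/

namespace BasedRootSystem

variable {ι E : Type*} [Fintype ι] [NormedAddCommGroup E] [InnerProductSpace ℝ E]
  (S : BasedRootSystem ι E)

/-- The subgroup generated by `s_i` and `s_j`. -/
def dihedral (i j : S.I) : Subgroup S.W := Subgroup.closure {S.s i, S.s j}

/-- A `W`-invariant positive definite quadratic form on `P`. -/
def sumSq (lam : S.P) : ℤ := ∑ g, pair lam g ^ 2

lemma sumSq_smul (w : S.W) (lam : S.P) : S.sumSq (w • lam) = S.sumSq lam := by
  refine Fintype.sum_equiv (MulAction.toPerm w⁻¹) _ _ fun g => ?_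
  rw [pair_smul]
  rfl

/-- Invariance under the reflection in `α` forces `2(λ, α)/(α, α) = (λ, α^∨)` for the polarization
of this form. When `(λ, α^∨) = 0` invariance at `λ` itself is vacuous, and it is applied to `λ - α`
instead. -/
lemma sumSq_sub_zsmul (lam : S.P) (g : ι) (c : ℤ) :
    S.sumSq (lam - c • S.rootP g) = S.sumSq lam + c * (c - pair lam g) * S.sumSq (S.rootP g) := by
  have key : ∀ c : ℤ, S.sumSq (lam - c • S.rootP g) = S.sumSq lam -
      2 * c * (∑ h, pair lam h * pair (S.rootP g) h) + c ^ 2 * S.sumSq (S.rootP g) := by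
    intro c
    rw [sumSq, sumSq, sumSq, Finset.mul_sum, Finset.mul_sum, ← Finset.sum_sub_distrib,
      ← Finset.sum_add_distrib]
    refine Finset.sum_congr rfl fun h _ => ?_
    rw [pair_sub, pair_zsmul]
    ring
  by_cases h0 : pair lam g = 0
  · have h2 : ∑ h, pair lam h * pair (S.rootP g) h = 0 := by
      have h1 : S.sumSq ((RootPairing.weylGroup.ofIdx S.R g : S.W) • (lam - S.rootP g)) =
          S.sumSq (lam - S.rootP g) := S.sumSq_smul _ _
      have e : (RootPairing.weylGroup.ofIdx S.R g : S.W) • (lam - S.rootP g) =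
          lam - (-1 : ℤ) • S.rootP g := by
        rw [ofIdx_smul_P, pair_sub, h0, pair_rootP_self]
        module
      have k1 := key 1
      rw [one_smul] at k1
      rw [e, key, k1] at h1
      linarith
    rw [key, h2, h0]
    ring
  · have h1 := S.sumSq_smul (RootPairing.weylGroup.ofIdx S.R g) lam
    rw [ofIdx_smul_P, key] at h1
    have h2 : 2 * (∑ h, pair lam h * pair (S.rootP g) h) = pair lam g * S.sumSq (S.rootP g) :=
      mul_left_cancel₀ h0 (by linear_combination -h1)
    rw [key]
    linear_combination -c * h2

lemma sumSq_rootP_pos (g : ι) : 0 < S.sumSq (S.rootP g) := by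
  refine Finset.sum_pos' (fun _ _ => sq_nonneg _) ⟨g, Finset.mem_univ g, ?_⟩
  rw [pair_rootP_self]
  norm_num

lemma sumSq_nonneg (lam : S.P) : 0 ≤ S.sumSq lam := Finset.sum_nonneg fun _ _ => sq_nonneg _

/-- An orbit of the dihedral group contains a dominant element. -/
lemma exists_smul_dominant (i j : S.I) (lam : S.P) :
    ∃ u ∈ S.dihedral i j, 0 ≤ pair (u • lam) i ∧ 0 ≤ pair (u • lam) j := by
  -- The trivial structure supplies the ordinary `ρ`. An orbit element with the largest inner
  -- product with `ρ` cannot be improved by a simple reflection, hence is dominant for both roots.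
  let D₁ : MetaplecticStructure S :=
    { Q := 0, Q_smul := fun _ _ => rfl, Q_integral := fun _ _ => ⟨0, by simp⟩, n := 1,
      n_pos := one_pos }
  obtain ⟨⟨u, hu⟩, hmax⟩ := Finite.exists_max
    (fun u : S.dihedral i j => inner ℝ D₁.rhoE ((u : S.W) • (lam : E)))
  have key : ∀ l : S.I, S.s l ∈ S.dihedral i j → 0 ≤ pair (u • lam) l := by
    intro l hl
    have h := hmax ⟨S.s l * u, mul_mem hl hu⟩
    simp only [mul_smul] at h
    have e : S.s l • u • (lam : E) = u • (lam : E) - (pair (u • lam) l : ℝ) • S.R.root l := by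
      rw [← pair_spec]
      exact S.ofIdx_smul_eq l _
    have hpos : 0 < inner ℝ D₁.rhoE (S.R.root l) := by
      have h1 := D₁.inner_rhoE l
      rw [S.coroot_eq, inner_smul_right] at h1
      have h2 : (0 : ℝ) < D₁.m l := by exact_mod_cast D₁.m_pos l
      rw [← h1] at h2
      exact (pos_iff_pos_of_mul_pos h2).1 (lt_of_le_of_ne (by positivity) fun h0 => by
        rw [← h0, zero_mul] at h2
        exact lt_irrefl _ h2)
    rw [e, inner_sub_right, inner_smul_right] at h
    have h3 : 0 ≤ (pair (u • lam) l : ℝ) * inner ℝ D₁.rhoE (S.R.root l) := by linarith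
    exact_mod_cast nonneg_of_mul_nonneg_left h3 hpos
  exact ⟨u, hu, key i (Subgroup.subset_closure (by simp)),
    key j (Subgroup.subset_closure (by simp))⟩

end BasedRootSystem

namespace MetaplecticStructure

variable {ι E : Type*} [Fintype ι] [NormedAddCommGroup E] [InnerProductSpace ℝ E]
  {S : BasedRootSystem ι E} (D : MetaplecticStructure S)

/-- The lattice spanned by `α_i^m` and `α_j^m`. -/
def pairLattice (i j : S.I) : AddSubgroup S.P := AddSubgroup.closure {D.mroot i, D.mroot j}

lemma s_smul_mem_pairLattice (i j l : S.I) (hl : l = i ∨ l = j) {nu : S.P}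
    (h : nu ∈ D.pairLattice i j) : S.s l • nu ∈ D.pairLattice i j := by
  have hi : D.mroot i ∈ D.pairLattice i j := AddSubgroup.subset_closure (by simp)
  have hj : D.mroot j ∈ D.pairLattice i j := AddSubgroup.subset_closure (by simp)
  have hle : D.pairLattice i j ≤ D.Pm := by
    rw [pairLattice, AddSubgroup.closure_le]
    rintro x (rfl | rfl) <;> exact D.mroot_mem_Pm _
  obtain ⟨a, ha⟩ := (D.mem_Pm_iff nu).1 (hle h) l
  rw [D.s_smul_of_pair_eq (a := a) (by rw [ha, mul_comm])]
  refine sub_mem h (zsmul_mem ?_ _)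
  rcases hl with rfl | rfl <;> assumption

lemma smul_mem_pairLattice {i j : S.I} {u : S.W} (hu : u ∈ S.dihedral i j) :
    ∀ nu ∈ D.pairLattice i j, u • nu ∈ D.pairLattice i j := by
  induction hu using Subgroup.closure_induction'' with
  | mem x hx =>
    rcases hx with rfl | rfl
    · exact fun nu h => D.s_smul_mem_pairLattice i j i (Or.inl rfl) h
    · exact fun nu h => D.s_smul_mem_pairLattice i j j (Or.inr rfl) h
  | inv_mem x hx =>
    rcases hx with rfl | rfl
    · rw [s_inv]; exact fun nu h => D.s_smul_mem_pairLattice i j i (Or.inl rfl) h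
    · rw [s_inv]; exact fun nu h => D.s_smul_mem_pairLattice i j j (Or.inr rfl) h
  | one => exact fun nu h => by rwa [one_smul]
  | mul x y _ _ hx hy => exact fun nu h => by rw [mul_smul]; exact hx _ (hy _ h)

/-- The weights `λ` with `|(λ, β^{m∨})| ≤ 1` for the roots `β` in the orbits of `α_i`, `α_j`. -/
def IsSmall (i j : S.I) (lam : S.P) : Prop :=
  ∀ u ∈ S.dihedral i j, |pair (u • lam) i| ≤ D.m i ∧ |pair (u • lam) j| ≤ D.m j

/-- A representative of minimal norm modulo the lattice works: moving it by a lattice root cannot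
shorten it, which bounds the pairing with that root. -/
lemma exists_isSmall (i j : S.I) (lam : S.P) :
    ∃ nu ∈ D.pairLattice i j, D.IsSmall i j (lam - nu) := by
  classical
  have hex : ∃ k : ℕ, ∃ nu ∈ D.pairLattice i j, (S.sumSq (lam - nu)).toNat = k :=
    ⟨_, 0, zero_mem _, rfl⟩
  obtain ⟨nu, hnu, hk⟩ := Nat.find_spec hex
  have hmin : ∀ mu ∈ D.pairLattice i j, S.sumSq (lam - nu) ≤ S.sumSq (lam - nu - mu) := by
    intro mu hmu
    have h := Nat.find_min' hex ⟨nu + mu, add_mem hnu hmu, rfl⟩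
    rw [← hk, sub_add_eq_sub_sub] at h
    have h1 := S.sumSq_nonneg (lam - nu)
    have h2 := S.sumSq_nonneg (lam - nu - mu)
    omega
  refine ⟨nu, hnu, ?_⟩
  have key : ∀ l : S.I, l = i ∨ l = j → ∀ u ∈ S.dihedral i j,
      |pair (u • (lam - nu)) l| ≤ D.m l := by
    intro l hl u hu
    have hm : (0 : ℤ) < D.m l := by exact_mod_cast D.m_pos l
    have hmem : D.mroot l ∈ D.pairLattice i j := by
      rcases hl with rfl | rfl <;> exact AddSubgroup.subset_closure (by simp)
    -- Minimality is tested against translation by `u⁻¹(z α_l^m)`; the values `z = 1` and `z = -1`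
    -- give the two bounds.
    have hstep : ∀ z : ℤ, 0 ≤ z * D.m l * (z * D.m l - pair (u • (lam - nu)) l) := by
      intro z
      have h := hmin _ (D.smul_mem_pairLattice (inv_mem hu) _ (zsmul_mem hmem z))
      have e : u • (lam - nu - u⁻¹ • z • D.mroot l) =
          u • (lam - nu) - (z * D.m l) • S.rootP l := by
        rw [smul_sub, smul_inv_smul, mroot, ← natCast_zsmul, smul_smul]
      rw [← S.sumSq_smul u (lam - nu), ← S.sumSq_smul u (_ - _ - _), e, sumSq_sub_zsmul] at h
      have := S.sumSq_rootP_pos l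
      exact nonneg_of_mul_nonneg_left (by linarith) this
    rw [abs_le]
    constructor
    · have h : 0 ≤ (D.m l : ℤ) * (D.m l + pair (u • (lam - nu)) l) := by linarith [hstep (-1)]
      have := nonneg_of_mul_nonneg_right h hm
      linarith
    · have := nonneg_of_mul_nonneg_right (hstep 1) (by linarith)
      linarith
  exact fun u hu => ⟨key i (Or.inl rfl) u hu, key j (Or.inr rfl) u hu⟩

end MetaplecticStructure

end

end Metaplectic

namespace Metaplectic

noncomputable section

open BasedRootSystem MetaplecticStructure

/-! ### Vanishing of the braid defect -/

namespace Parameters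

variable {ι E : Type*} [Fintype ι] [NormedAddCommGroup E] [InnerProductSpace ℝ E]
  {S : BasedRootSystem ι E} {D : MetaplecticStructure S} (p : Parameters D)

lemma norm_root_eq {i j : S.I} (hi : S.car i j = 1) (hj : S.car j i = 1) :
    ‖S.R.root i‖ = ‖S.R.root j‖ := by
  have h : ∀ {i j : S.I}, S.car i j = 1 →
      2 * inner ℝ (S.R.root i) (S.R.root j) = -‖S.R.root j‖ ^ 2 := by
    intro i j h
    have h1 := pair_spec (S.rootP i) j
    have hne : ‖S.R.root j‖ ≠ 0 := norm_ne_zero_iff.2 (S.R.ne_zero j)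
    rw [show pair (S.rootP i) j = -1 by rw [← h, car, neg_neg], S.coroot_eq, inner_smul_right] at h1
    change 2 / ‖S.R.root j‖ ^ 2 * inner ℝ (S.R.root i) _ = _ at h1
    field_simp at h1
    rw [h1]
    push_cast
    ring
  have h1 := h hi
  have h2 := h hj
  rw [real_inner_comm] at h2
  exact (sq_eq_sq₀ (norm_nonneg _) (norm_nonneg _)).1 (by linarith)

/-- In type `A₂` the simple roots are conjugate, so `k`, `m` and `Q` agree on them. Equal lengths of
`α_i^m` and `α_j^m` give equal sizes, so the same family `g` enters. -/
lemma coef_eq {i j : S.I} (h : i ≠ j) (hi : S.car i j = 1) (hj : S.car j i = 1) :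
    p.coef j = p.coef i := by
  have h3 : S.cox i j = 3 := by simp [cox, hi, hj]
  have ho : S.opp i j = j := if_pos h3
  have hm : D.m j = D.m i := by rw [← m_opp D h, ho]
  have hk : p.k j = p.k i := by rw [← p.k_opp h, ho]
  have hQ : D.Qroot j = D.Qroot i := by
    rw [← D.Qroot_smul (S.dihedralLongest i j) i, S.dihedralLongest_smul_idx h, D.Qroot_smul, ho]
  have hs : D.size j = D.size i := by
    have : ‖D.mrootE j‖ = ‖D.mrootE i‖ := by
      rw [mrootE, mrootE, norm_smul, norm_smul, hm, norm_root_eq hi hj]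
    rw [size, size, this]
  funext a
  rw [coef, coef, hm, hk, hQ, hs]

/-- The scalar by which a product of the operators `τ(T_i)` acts on a small dominant monomial. -/
def wordCoef (lam : S.P) : List S.I → ℂ
  | [] => 1
  | i :: ω => wordCoef lam ω * p.coef i (pair (S.wordProd ω • lam) i)

end Parameters

namespace BasedRootSystem

variable {ι E : Type*} [Fintype ι] [NormedAddCommGroup E] [InnerProductSpace ℝ E]
  (S : BasedRootSystem ι E)

/-- All roots along the word are nonnegative at `λ`. -/
def NonnegAlong (lam : S.P) : List S.I → Prop
  | [] => True
  | i :: ω => NonnegAlong lam ω ∧ 0 ≤ pair (S.wordProd ω • lam) i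

lemma wordProd_mem_dihedral {i j : S.I} (ω : List S.I) (h : ∀ l ∈ ω, l = i ∨ l = j) :
    S.wordProd ω ∈ S.dihedral i j := by
  induction ω with
  | nil => exact one_mem _
  | cons l ω ih =>
    rw [wordProd_cons]
    refine mul_mem (Subgroup.subset_closure ?_) (ih fun a ha => h a (List.mem_cons_of_mem _ ha))
    rcases h l (by simp) with rfl | rfl <;> simp

end BasedRootSystem

lemma mem_altList {α : Type*} (i j : α) (n : ℕ) : ∀ l ∈ altList i j n, l = i ∨ l = j := by
  induction n generalizing i j with
  | zero => simp [altList]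
  | succ n ih =>
    intro l hl
    rw [altList, List.mem_cons] at hl
    rcases hl with rfl | hl
    · exact Or.inl rfl
    · exact (ih j i l hl).symm

namespace Parameters

variable {ι E : Type*} [Fintype ι] [NormedAddCommGroup E] [InnerProductSpace ℝ E]
  {S : BasedRootSystem ι E} {D : MetaplecticStructure S} (p : Parameters D)

lemma prod_tauT_X {i j : S.I} {lam : S.P} (hlam : D.IsSmall i j lam) (ω : List S.I)
    (h : ∀ l ∈ ω, l = i ∨ l = j) (h0 : S.NonnegAlong lam ω) :
    (ω.map p.tauT).prod (S.X (lam + D.eta)) =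
      algebraMap ℂ S.K (p.wordCoef lam ω) * S.X (S.wordProd ω • lam + D.eta) := by
  induction ω with
  | nil => simp [wordCoef, wordProd_nil]
  | cons l ω ih =>
    have hω : ∀ l ∈ ω, l = i ∨ l = j := fun a ha => h a (List.mem_cons_of_mem _ ha)
    have hs := hlam _ (S.wordProd_mem_dihedral ω hω)
    have hl : pair (S.wordProd ω • lam) l ≤ D.m l := by
      rcases h l (by simp) with rfl | rfl
      · exact (abs_le.1 hs.1).2
      · exact (abs_le.1 hs.2).2
    rw [List.map_cons, List.prod_cons, Module.End.mul_apply, ih hω h0.1, ← Algebra.smul_def, map_smul,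
      p.tauT_X_of_le l h0.2 hl, Algebra.smul_def, wordCoef, map_mul, wordProd_cons, mul_smul,
      mul_assoc]

lemma nonnegAlong_altList {i j : S.I} (h : i ≠ j) {lam : S.P} (hi : 0 ≤ pair lam i)
    (hj : 0 ≤ pair lam j) : S.NonnegAlong lam (altList i j (S.cox i j)) := by
  rcases S.car_cases h with h' | h' | h' | h' | h' | h' <;> obtain ⟨h1, h2⟩ := h' <;>
    simp only [cox, h1, h2] <;> norm_num [altList, NonnegAlong] <;>
    simp only [wordProd_cons, wordProd_nil, mul_one, mul_smul, pair_s_smul, h1, h2, car_self,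
      one_smul] <;>
    and_intros <;> omega

/-- Both products run over the positive roots `β` of the rank two system, in opposite orders, with
the factor `coef` of the type of `β` at `(λ, β^∨)`. In the simply laced case, where the types mix,
`coef_eq` identifies the two functions. -/
lemma wordCoef_altList {i j : S.I} (h : i ≠ j) (lam : S.P) :
    p.wordCoef lam (altList i j (S.cox i j)) = p.wordCoef lam (altList j i (S.cox i j)) := by
  rcases S.car_cases h with h' | h' | h' | h' | h' | h' <;> obtain ⟨h1, h2⟩ := h' <;>
    simp only [cox, h1, h2] <;> norm_num [altList, wordCoef] <;>
    simp only [wordProd_cons, wordProd_nil, mul_one, mul_smul, pair_s_smul, h1, h2, car_self,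
      one_smul] <;>
    (try rw [show p.coef j = p.coef i from p.coef_eq h h1 h2]) <;>
    ring_nf

/-- Along a small dominant weight each letter acts by a scalar times a reflection. Both words
therefore give the same multiple of the same monomial. -/
lemma defect_X_of_dominant {i j : S.I} (h : i ≠ j) {lam : S.P} (hlam : D.IsSmall i j lam)
    (hi : 0 ≤ pair lam i) (hj : 0 ≤ pair lam j) : p.defect i j (S.X (lam + D.eta)) = 0 := by
  have h1 := nonnegAlong_altList h hi hj
  have h2 := nonnegAlong_altList h.symm hj hi
  rw [cox_comm] at h2
  rw [defect, braidDefect, LinearMap.sub_apply, ← map_altList, ← map_altList,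
    p.prod_tauT_X hlam _ (mem_altList i j _) h1,
    p.prod_tauT_X hlam _ (fun l hl => (mem_altList j i _ l hl).symm) h2,
    p.wordCoef_altList h, S.wordProd_altList h, sub_self]

lemma exists_tauT_X (l : S.I) {lam : S.P} (h : |pair lam l| ≤ D.m l) : ∃ a b : ℂ, b ≠ 0 ∧
    p.tauT l (S.X (lam + D.eta)) = a • S.X (lam + D.eta) + b • S.X (S.s l • lam + D.eta) := by
  obtain ⟨h1, h2⟩ := abs_le.1 h
  rcases le_or_gt 0 (pair lam l) with h0 | h0
  · refine ⟨0, _, p.coef_ne_zero l (pair lam l), ?_⟩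
    rw [p.tauT_X_of_le l h0 h2, zero_smul, zero_add, Algebra.smul_def]
  · refine ⟨p.q l, _, inv_ne_zero (p.coef_ne_zero l (-pair lam l)), ?_⟩
    rw [p.tauT_X_of_neg l h0 (by omega), Algebra.smul_def, Algebra.smul_def]

/-- The defect also kills `τ(T_l) x^{λ+η}`, by anticommutation. That vector contains `x^{s_l λ+η}`
with nonzero coefficient next to a multiple of `x^{λ+η}`. -/
lemma defect_X_s_smul {i j : S.I} (h : i ≠ j) {l : S.I} (hl : l = i ∨ l = j) {lam : S.P}
    (hlam : |pair lam l| ≤ D.m l) (h0 : p.defect i j (S.X (lam + D.eta)) = 0) :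
    p.defect i j (S.X (S.s l • lam + D.eta)) = 0 := by
  obtain ⟨a, b, hb, hT⟩ := p.exists_tauT_X l hlam
  have hz : p.defect i j (p.tauT l (S.X (lam + D.eta))) = 0 := by
    rw [← Module.End.mul_apply]
    rcases hl with rfl | rfl
    · rw [p.defect_mul_left h, LinearMap.neg_apply, Module.End.mul_apply, h0, map_zero, neg_zero]
    · rw [p.defect_mul_right h, LinearMap.neg_apply, Module.End.mul_apply, h0, map_zero, neg_zero]
  rw [hT, map_add, map_smul, map_smul, h0, smul_zero, zero_add] at hz
  exact (smul_eq_zero.1 hz).resolve_left hb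

end Parameters

namespace MetaplecticStructure

variable {ι E : Type*} [Fintype ι] [NormedAddCommGroup E] [InnerProductSpace ℝ E]
  {S : BasedRootSystem ι E} {D : MetaplecticStructure S}

lemma IsSmall.smul {i j : S.I} {lam : S.P} (h : D.IsSmall i j lam) {u : S.W}
    (hu : u ∈ S.dihedral i j) : D.IsSmall i j (u • lam) := by
  intro v hv
  rw [← mul_smul]
  exact h _ (mul_mem hv hu)

end MetaplecticStructure

namespace Parameters

variable {ι E : Type*} [Fintype ι] [NormedAddCommGroup E] [InnerProductSpace ℝ E]
  {S : BasedRootSystem ι E} {D : MetaplecticStructure S} (p : Parameters D)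

lemma defect_X_smul {i j : S.I} (h : i ≠ j) {u : S.W} (hu : u ∈ S.dihedral i j) :
    ∀ lam : S.P, D.IsSmall i j lam → p.defect i j (S.X (lam + D.eta)) = 0 →
      p.defect i j (S.X (u • lam + D.eta)) = 0 := by
  have key : ∀ l, l = i ∨ l = j → ∀ lam : S.P, D.IsSmall i j lam →
      p.defect i j (S.X (lam + D.eta)) = 0 →
      p.defect i j (S.X (S.s l • lam + D.eta)) = 0 := by
    intro l hl lam hlam h0
    refine p.defect_X_s_smul h hl ?_ h0
    have := hlam 1 (one_mem _)
    rw [one_smul] at this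
    rcases hl with rfl | rfl
    · exact this.1
    · exact this.2
  induction hu using Subgroup.closure_induction'' with
  | mem x hx =>
    rcases hx with rfl | rfl
    · exact key _ (Or.inl rfl)
    · exact key _ (Or.inr rfl)
  | inv_mem x hx =>
    rcases hx with rfl | rfl
    · rw [s_inv]; exact key _ (Or.inl rfl)
    · rw [s_inv]; exact key _ (Or.inr rfl)
  | one => exact fun lam _ h0 => by rwa [one_smul]
  | mul x y hx hy ihx ihy =>
    intro lam hlam h0
    rw [mul_smul]
    exact ihx _ (hlam.smul hy) (ihy _ hlam h0)

lemma defect_X {i j : S.I} (h : i ≠ j) (lam : S.P) : p.defect i j (S.X lam) = 0 := by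
  obtain ⟨nu, hnu, hsmall⟩ := D.exists_isSmall i j (lam - D.eta)
  have h0 : p.defect i j (S.X (lam - D.eta - nu + D.eta)) = 0 := by
    obtain ⟨u, hu, hi, hj⟩ := S.exists_smul_dominant i j (lam - D.eta - nu)
    have := p.defect_X_smul h (inv_mem hu) _ (hsmall.smul hu)
      (p.defect_X_of_dominant h (hsmall.smul hu) hi hj)
    rwa [inv_smul_smul] at this
  have hle : D.pairLattice i j ≤ p.defectComm (i := i) (j := j) := by
    rw [pairLattice, AddSubgroup.closure_le]
    rintro _ (rfl | rfl)
    · exact (p.mroot_mem_defectComm h).1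
    · exact (p.mroot_mem_defectComm h).2
  have := LinearMap.congr_fun (p.mem_defectComm.1 (hle hnu)) (S.X (lam - D.eta - nu + D.eta))
  rw [Module.End.mul_apply, Module.End.mul_apply, h0, map_zero, mulOp_apply, ← X_add] at this
  rwa [show nu + (lam - D.eta - nu + D.eta) = lam by abel] at this

end Parameters

namespace MetaplecticStructure

variable {ι E : Type*} [Fintype ι] [NormedAddCommGroup E] [InnerProductSpace ℝ E]
  {S : BasedRootSystem ι E} (D : MetaplecticStructure S)

/-- An operator that is linear over the invariants of `ℂ(P^m)` is determined by its values on
monomials. -/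
lemma eq_zero_of_X {G : Module.End ℂ S.K}
    (hG : ∀ f ∈ D.Km, (∀ w, S.weylK w f = f) → ∀ h, G (f * h) = f * G h)
    (hX : ∀ lam, G (S.X lam) = 0) : G = 0 := by
  have hA : ∀ a : S.A, G (algebraMap S.A S.K a) = 0 := by
    intro a
    induction a using AddMonoidAlgebra.induction_linear with
    | zero => rw [map_zero, map_zero]
    | add f g hf hg => rw [map_add, map_add, hf, hg, add_zero]
    | single lam c =>
      have : (AddMonoidAlgebra.single lam c : S.A) = c • AddMonoidAlgebra.single lam 1 := by
        simp
      rw [this, Algebra.algebraMap_eq_smul_one, smul_assoc, ← Algebra.algebraMap_eq_smul_one,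
        map_smul]
      exact (congrArg (c • ·) (hX lam)).trans (smul_zero c)
  let R := (IsScalarTower.toAlgHom ℂ S.A S.K).range
  have hle : Algebra.adjoin ℂ (S.X '' (D.Pm : Set S.P)) ≤ R :=
    Algebra.adjoin_le (by rintro _ ⟨lam, _, rfl⟩; exact ⟨_, rfl⟩)
  have hR : ∀ w, ∀ f ∈ R, S.weylK w f ∈ R := by
    rintro w _ ⟨a, rfl⟩
    exact ⟨_, (IsFractionRing.fieldEquivOfAlgEquiv_algebraMap _ _ _ _ _).symm⟩
  ext x
  induction x using D.induction_K 0 with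
  | add x y hx hy => rw [map_add, hx, hy, LinearMap.zero_apply, LinearMap.zero_apply,
      LinearMap.zero_apply, add_zero]
  | mul f hf lam =>
    obtain ⟨a, ha, c, hc, rfl⟩ := IntermediateField.mem_adjoin_iff_div.1 hf
    rw [add_zero, LinearMap.zero_apply]
    by_cases hc0 : c = 0
    · rw [hc0, div_zero, zero_mul, map_zero]
    have hcK : c ∈ D.Km := IntermediateField.algebra_adjoin_le_adjoin _ _ hc
    classical
    -- The product of all Weyl conjugates of the denominator is invariant. Extending the fraction by
    -- the other conjugates leaves an invariant denominator and a numerator in `ℂ[P]`.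
    have hN : ∀ w, S.weylK w (∏ v, S.weylK v c) = ∏ v, S.weylK v c := by
      intro w
      rw [map_prod]
      exact Fintype.prod_equiv (Equiv.mulLeft w) _ _ fun v => (S.weylK_mul_apply w v c).symm
    have hmul : c * ∏ v ∈ Finset.univ.erase (1 : S.W), S.weylK v c = ∏ v, S.weylK v c := by
      rw [← Finset.mul_prod_erase _ _ (Finset.mem_univ (1 : S.W)), weylK_one_apply]
    have hN0 : ∏ v, S.weylK v c ≠ 0 :=
      Finset.prod_ne_zero_iff.2 fun v _ => (map_ne_zero_iff _ (S.weylK v).injective).2 hc0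
    have hrew : a / c * S.X lam = (∏ v, S.weylK v c)⁻¹ *
        (a * (∏ v ∈ Finset.univ.erase (1 : S.W), S.weylK v c) * S.X lam) := by
      rw [← hmul] at hN0 ⊢
      have := right_ne_zero_of_mul hN0
      field_simp
    rw [hrew, hG]
    · have hmem : a * (∏ v ∈ Finset.univ.erase (1 : S.W), S.weylK v c) * S.X lam ∈ R :=
        mul_mem (mul_mem (hle ha) (prod_mem fun v _ => hR v c (hle hc))) ⟨_, rfl⟩
      obtain ⟨b, hb⟩ := hmem
      rw [← hb]
      exact mul_eq_zero_of_right _ (hA b)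
    · exact inv_mem (prod_mem fun v _ => D.weylK_mem_Km v hcK)
    · intro w
      rw [map_inv₀, hN]

end MetaplecticStructure

namespace Parameters

variable {ι E : Type*} [Fintype ι] [NormedAddCommGroup E] [InnerProductSpace ℝ E]
  {S : BasedRootSystem ι E} {D : MetaplecticStructure S} (p : Parameters D)

lemma prod_tauT_mul (ω : List S.I) {f : S.K} (hf : f ∈ D.Km) (hw : ∀ w, S.weylK w f = f)
    (h : S.K) : (ω.map p.tauT).prod (f * h) = f * (ω.map p.tauT).prod h := by
  induction ω with
  | nil => rfl
  | cons i ω ih =>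
    rw [List.map_cons, List.prod_cons, Module.End.mul_apply, ih, p.tauT_mul i hf, hw, sub_self,
      mul_zero, zero_div, zero_mul, add_zero, Module.End.mul_apply]

/-- The braid relations for the operators `τ(T_i)`. -/
lemma tauT_braid {i j : S.I} (h : i ≠ j) : ((altList i j (S.cox i j)).map p.tauT).prod =
    ((altList j i (S.cox i j)).map p.tauT).prod := by
  have h0 : p.defect i j = 0 := by
    refine D.eq_zero_of_X (fun f hf hw x => ?_) fun lam => p.defect_X h lam
    rw [defect, braidDefect, LinearMap.sub_apply, LinearMap.sub_apply, ← map_altList, ← map_altList,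
      p.prod_tauT_mul _ hf hw, p.prod_tauT_mul _ hf hw, mul_sub]
  rw [map_altList, map_altList]
  exact sub_eq_zero.1 h0

end Parameters

end

end Metaplectic

namespace Metaplectic

noncomputable section

open BasedRootSystem MetaplecticStructure

/-! ### The operators `τ(T_w)` and the representation `σ` -/

namespace BasedRootSystem

variable {ι E : Type*} [Fintype ι] [NormedAddCommGroup E] [InnerProductSpace ℝ E]
  (S : BasedRootSystem ι E)

lemma isReducedWord_redWord (w : S.W) : S.IsReducedWord (S.redWord w) w :=
  (S.exists_reducedWord w).choose_spec

variable {S} in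
lemma IsReducedWord.cons_of_pos {ω : List S.I} {w : S.W} {i : S.I} (h : S.IsReducedWord ω w)
    (hi : S.b.IsPos (w⁻¹ • (i : ι))) : S.IsReducedWord (i :: ω) (S.s i * w) :=
  ⟨by rw [wordProd_cons, h.1], by rw [List.length_cons, h.2, S.length_s_mul_of_pos hi]⟩

lemma redWord_one : S.redWord 1 = [] :=
  List.eq_nil_of_length_eq_zero ((S.isReducedWord_redWord 1).2.trans S.length_one)

/-- The product of the `t_i` over a reduced expression. -/
def redProd {M : Type*} [Monoid M] (t : S.I → M) (w : S.W) : M := ((S.redWord w).map t).prod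

variable {M : Type*} [Monoid M] (t : S.I → M)

lemma redProd_one : S.redProd t 1 = 1 := by rw [redProd, redWord_one, List.map_nil, List.prod_nil]

lemma redProd_s_mul (ht : ∀ i j, i ≠ j →
      ((altList i j (S.cox i j)).map t).prod = ((altList j i (S.cox i j)).map t).prod)
    {i : S.I} {w : S.W} (hi : S.b.IsPos (w⁻¹ • (i : ι))) :
    S.redProd t (S.s i * w) = t i * S.redProd t w := by
  rw [redProd, S.prod_reducedWord_eq t ht (S.isReducedWord_redWord _)
    ((S.isReducedWord_redWord w).cons_of_pos hi), List.map_cons, List.prod_cons, redProd]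

end BasedRootSystem

namespace MetaplecticStructure

variable {ι E : Type*} [Fintype ι] [NormedAddCommGroup E] [InnerProductSpace ℝ E]
  {S : BasedRootSystem ι E} (D : MetaplecticStructure S)

lemma mroot_injective {i j : ι} (hm : D.m i = D.m j) (h : D.mroot i = D.mroot j) : i = j := by
  apply S.R.root.injective
  have h1 := congrArg Subtype.val h
  rw [coe_mroot, coe_mroot, mrootE, mrootE, hm] at h1
  exact smul_right_injective E (by exact_mod_cast (D.m_pos j).ne') h1

/-- The automorphism `w` of `ℂ(P)`, restricted to `ℂ(P^m)`. -/
def weylKm (w : S.W) : D.Km →* S.K :=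
  ((S.weylK w : S.K →ₐ[ℂ] S.K) : S.K →* S.K).comp (D.Km.val : D.Km →* S.K)

lemma weylKm_apply (w : S.W) (f : D.Km) : D.weylKm w f = S.weylK w f := rfl

lemma weylKm_injective : Function.Injective D.weylKm := by
  intro u v h
  refine S.smul_eq_of_index fun i => D.mroot_injective (by rw [m_smul, m_smul]) ?_
  have := DFunLike.congr_fun h ⟨_, D.X_mem_Km (D.mroot_mem_Pm i)⟩
  rw [weylKm_apply, weylKm_apply, weylK_X, weylK_X, ← mroot_smul, ← mroot_smul] at this
  exact S.X_injective this

/-- Independence of characters, applied to the restrictions of the elements of `W` to `ℂ(P^m)`.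
These are distinct because `W` acts faithfully on the roots `α^m`. -/
lemma eq_zero_of_sum_weylK {a : S.W → S.K} (h : ∀ f ∈ D.Km, ∑ w, a w * S.weylK w f = 0) :
    a = 0 := by
  have hli := (linearIndependent_monoidHom D.Km S.K).comp _ D.weylKm_injective
  rw [Fintype.linearIndependent_iff] at hli
  funext w
  refine hli a (funext fun f => ?_) w
  simp only [Finset.sum_apply, Pi.smul_apply, smul_eq_mul, Function.comp_apply]
  exact h f f.2

end MetaplecticStructure

namespace Parameters

variable {ι E : Type*} [Fintype ι] [NormedAddCommGroup E] [InnerProductSpace ℝ E]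
  {S : BasedRootSystem ι E} {D : MetaplecticStructure S} (p : Parameters D)

lemma inv_k_mul_c_ne_zero (i : ι) : algebraMap ℂ S.K (p.k i : ℂ)⁻¹ * p.c i ≠ 0 :=
  mul_ne_zero (by rw [map_inv₀]; exact inv_ne_zero (p.k_ne_zero i)) (p.c_ne_zero i)

/-- The weight `0` gives `τ(T_i) x^η = k_i x^η`, and `c_i ≠ 0`. -/
lemma sigmaSimple_X_eta (i : S.I) : p.sigmaSimple i (S.X D.eta) = S.X D.eta := by
  have h0 : pair (0 : S.P) i = 0 := S.pair_zero _
  have h := p.tauT_X_of_le i (lam := 0) h0.ge (by rw [h0]; positivity)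
  rw [smul_zero, zero_add, h0, coef_zero, tauT_apply, add_eq_left] at h
  exact sub_eq_zero.1 ((mul_eq_zero.1 h).resolve_left (p.inv_k_mul_c_ne_zero i))

lemma prod_sigmaSimple_mul (ω : List S.I) {f : S.K} (hf : f ∈ D.Km) (h : S.K) :
    (ω.map p.sigmaSimple).prod (f * h) =
      S.weylK (S.wordProd ω) f * (ω.map p.sigmaSimple).prod h := by
  induction ω with
  | nil => rw [wordProd_nil, weylK_one_apply]; rfl
  | cons i ω ih =>
    rw [List.map_cons, List.prod_cons, Module.End.mul_apply, Module.End.mul_apply, ih,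
      p.sigmaSimple_mul i (D.weylK_mem_Km _ hf), wordProd_cons, weylK_mul_apply]

lemma prod_sigmaSimple_X_eta (ω : List S.I) :
    (ω.map p.sigmaSimple).prod (S.X D.eta) = S.X D.eta := by
  induction ω with
  | nil => rfl
  | cons i ω ih => rw [List.map_cons, List.prod_cons, Module.End.mul_apply, ih, sigmaSimple_X_eta]

/-- The operators `τ(T_w)`. -/
def tauTW (w : S.W) : Module.End ℂ S.K := S.redProd p.tauT w

lemma tauTW_s_mul {i : S.I} {w : S.W} (hi : S.b.IsPos (w⁻¹ • (i : ι))) :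
    p.tauTW (S.s i * w) = p.tauT i * p.tauTW w :=
  S.redProd_s_mul p.tauT (fun _ _ h => p.tauT_braid h) hi

/-- The span of the operators `τ(T_w)` over `ℂ(P^m)`. -/
def tauSpan : Submodule D.Km (Module.End ℂ S.K) := Submodule.span D.Km (Set.range p.tauTW)

lemma tauT_mul_tauTW_mem (i : S.I) (w : S.W) : p.tauT i * p.tauTW w ∈ p.tauSpan := by
  by_cases h : S.b.IsPos (w⁻¹ • (i : ι))
  · rw [← p.tauTW_s_mul h]
    exact Submodule.subset_span ⟨_, rfl⟩
  · obtain ⟨v, rfl⟩ : ∃ v, w = S.s i * v := ⟨S.s i * w, (S.s_mul_s_cancel i w).symm⟩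
    have hv := (S.isPos_inv_smul_s_mul (S.s i * v) i).2 h
    rw [s_mul_s_cancel] at hv
    have e : p.tauT i * p.tauTW (S.s i * v) =
        algebraMap ℂ D.Km (p.q i) • p.tauTW (S.s i * v) + p.tauTW v := by
      rw [p.tauTW_s_mul hv]
      ext x
      exact p.tauT_quadratic i _
    rw [e]
    exact add_mem (Submodule.smul_mem _ _ (Submodule.subset_span ⟨_, rfl⟩))
      (Submodule.subset_span ⟨_, rfl⟩)

lemma tauT_mul_mem (i : S.I) {G : Module.End ℂ S.K} (hG : G ∈ p.tauSpan) :
    p.tauT i * G ∈ p.tauSpan := by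
  induction hG using Submodule.span_induction with
  | mem x hx =>
    obtain ⟨w, rfl⟩ := hx
    exact p.tauT_mul_tauTW_mem i w
  | zero => rw [mul_zero]; exact zero_mem _
  | add x y _ _ hx hy => rw [mul_add]; exact add_mem hx hy
  | smul f x hx h =>
    have hs := D.weylK_mem_Km (S.s i) f.2
    have hX := D.X_mem_Km (D.mroot_mem_Pm i)
    have hr : algebraMap ℂ S.K (p.q i) * (f - S.weylK (S.s i) f) / (1 - S.X (D.mroot i)) ∈ D.Km :=
      div_mem (mul_mem (D.Km.algebraMap_mem _) (sub_mem f.2 hs)) (sub_mem (one_mem _) hX)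
    have e : p.tauT i * (f • x) = (⟨_, hs⟩ : D.Km) • (p.tauT i * x) + (⟨_, hr⟩ : D.Km) • x := by
      ext y
      exact p.tauT_mul i f.2 (x y)
    rw [e]
    exact add_mem (Submodule.smul_mem _ _ h) (Submodule.smul_mem _ _ hx)

/-- Solving the definition of `τ(T_i)` gives `σ(s_i) = 1 + (k_i⁻¹ c_i)⁻¹ (τ(T_i) - k_i)`. -/
lemma sigmaSimple_mul_mem (i : S.I) {G : Module.End ℂ S.K} (hG : G ∈ p.tauSpan) :
    p.sigmaSimple i * G ∈ p.tauSpan := by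
  have hr : (algebraMap ℂ S.K (p.k i : ℂ)⁻¹ * p.c i)⁻¹ ∈ D.Km :=
    inv_mem (mul_mem (D.Km.algebraMap_mem _) (p.c_mem_Km i))
  have e : p.sigmaSimple i * G = G + (⟨_, hr⟩ : D.Km) •
      (p.tauT i * G - algebraMap ℂ D.Km (p.k i) • G) := by
    ext x
    change p.sigmaSimple i (G x) = G x + (algebraMap ℂ S.K (p.k i : ℂ)⁻¹ * p.c i)⁻¹ *
      (p.tauT i (G x) - algebraMap ℂ S.K (p.k i) * G x)
    rw [tauT_apply, add_sub_cancel_left, inv_mul_cancel_left₀ (p.inv_k_mul_c_ne_zero i)]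
    ring
  rw [e]
  exact add_mem hG (Submodule.smul_mem _ _ (sub_mem (p.tauT_mul_mem i hG)
    (Submodule.smul_mem _ _ hG)))

lemma prod_sigmaSimple_mem (ω : List S.I) : (ω.map p.sigmaSimple).prod ∈ p.tauSpan := by
  induction ω with
  | nil => exact Submodule.subset_span ⟨1, S.redProd_one p.tauT⟩
  | cons i ω ih =>
    rw [List.map_cons, List.prod_cons]
    exact p.sigmaSimple_mul_mem i ih

lemma exists_prod_sigmaSimple_eq (ω : List S.I) : ∃ a : S.W → S.K,
    (ω.map p.sigmaSimple).prod = ∑ w, S.mulOp (a w) * p.tauTW w := by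
  obtain ⟨a, ha⟩ := (Submodule.mem_span_range_iff_exists_fun D.Km).1 (p.prod_sigmaSimple_mem ω)
  exact ⟨fun w => a w, ha.symm⟩

/-- Since `σ(s_i)` fixes `x^η`, on `ℂ(P^m) x^η` the operator `τ(T_i)` is `k_i + k_i⁻¹ c_i (s_i -
1)`. Words therefore act there through the twisted group algebra of `W` over `ℂ(P^m)`. -/
lemma exists_prod_tauT_eq (ω : List S.I) : ∃ d : S.W → S.K, (∀ u, d u ∈ D.Km) ∧ ∀ f ∈ D.Km,
    (ω.map p.tauT).prod (f * S.X D.eta) = (∑ u, d u * S.weylK u f) * S.X D.eta := by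
  classical
  induction ω with
  | nil =>
    refine ⟨Pi.single 1 1, fun u => ?_, fun f _ => ?_⟩
    · rw [Pi.single_apply]
      split_ifs
      · exact one_mem _
      · exact zero_mem _
    · simp [Pi.single_apply, weylK_one_apply]
  | cons i ω ih =>
    obtain ⟨d, hd, h⟩ := ih
    have hc : algebraMap ℂ S.K (p.k i : ℂ)⁻¹ * p.c i ∈ D.Km :=
      mul_mem (D.Km.algebraMap_mem _) (p.c_mem_Km i)
    refine ⟨fun u => algebraMap ℂ S.K (p.k i) * d u + algebraMap ℂ S.K (p.k i : ℂ)⁻¹ * p.c i *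
      (S.weylK (S.s i) (d (S.s i * u)) - d u), fun u => ?_, fun f hf => ?_⟩
    · exact add_mem (mul_mem (D.Km.algebraMap_mem _) (hd u))
        (mul_mem hc (sub_mem (D.weylK_mem_Km _ (hd _)) (hd u)))
    · have hF : ∑ u, d u * S.weylK u f ∈ D.Km :=
        sum_mem fun u _ => mul_mem (hd u) (D.weylK_mem_Km u hf)
      have hs : S.weylK (S.s i) (∑ u, d u * S.weylK u f) =
          ∑ u, S.weylK (S.s i) (d (S.s i * u)) * S.weylK u f := by
        rw [map_sum]
        refine Fintype.sum_equiv (Equiv.mulLeft (S.s i)) _ _ fun u => ?_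
        rw [map_mul, Equiv.coe_mulLeft, s_mul_s_cancel, weylK_mul_apply]
      rw [List.map_cons, List.prod_cons, Module.End.mul_apply, h f hf, tauT_apply,
        p.sigmaSimple_mul i hF, sigmaSimple_X_eta, hs]
      simp only [add_mul, mul_sub, sub_mul, Finset.sum_add_distrib, Finset.sum_sub_distrib,
        Finset.mul_sum, mul_assoc, Finset.sum_mul]

/-- Operators in the span of the `τ(T_w)` are determined by their restriction to
`ℂ(P^m) x^η`. -/
lemma eq_zero_of_restrict {a : S.W → S.K}
    (h : ∀ f ∈ D.Km, (∑ w, S.mulOp (a w) * p.tauTW w) (f * S.X D.eta) = 0) : a = 0 := by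
  classical
  choose d hd hT using fun w : S.W => p.exists_prod_tauT_eq (S.redWord w)
  have hsum : ∀ b : S.W → S.K, ∀ f ∈ D.Km, (∑ w, S.mulOp (b w) * p.tauTW w) (f * S.X D.eta) =
      (∑ u, Matrix.vecMul b (Matrix.of d) u * S.weylK u f) * S.X D.eta := by
    intro b f hf
    simp only [LinearMap.sum_apply, Module.End.mul_apply, mulOp_apply]
    have hT' : ∀ w, p.tauTW w (f * S.X D.eta) = _ := fun w => hT w f hf
    simp only [hT']
    simp only [Matrix.vecMul, dotProduct, Matrix.of_apply, Finset.sum_mul, Finset.mul_sum]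
    rw [Finset.sum_comm]
    exact Finset.sum_congr rfl fun u _ => Finset.sum_congr rfl fun w _ => by ring
  have hX := S.X_ne_zero D.eta
  -- The matrix `d` expresses the restricted `τ(T_w)` by the automorphisms `u ∈ W`. Each basis
  -- vector `u` is attained, because a product of `σ(s_i)` over a word for `u` lies in the span and
  -- restricts to `u`. A surjective square matrix is injective, which is what is needed.
  have hsurj : Function.Surjective (Matrix.vecMulLinear (Matrix.of d)) := by
    rw [← LinearMap.range_eq_top, eq_top_iff, ← (Pi.basisFun S.K S.W).span_eq,
      Submodule.span_le]
    rintro _ ⟨u, rfl⟩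
    obtain ⟨b, hb⟩ := p.exists_prod_sigmaSimple_eq (S.redWord u)
    refine ⟨b, ?_⟩
    rw [Pi.basisFun_apply, ← sub_eq_zero]
    refine D.eq_zero_of_sum_weylK fun f hf => ?_
    have h1 := p.prod_sigmaSimple_mul (S.redWord u) hf (S.X D.eta)
    rw [hb, hsum b f hf, ← hb, prod_sigmaSimple_X_eta, (S.isReducedWord_redWord u).1] at h1
    have h2 := mul_right_cancel₀ hX h1
    simp [sub_mul, Finset.sum_sub_distrib, Pi.single_apply, h2]
  have hinj := LinearMap.injective_iff_surjective.2 hsurj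
  refine hinj ?_
  rw [map_zero]
  refine D.eq_zero_of_sum_weylK fun f hf => ?_
  have := h f hf
  rw [hsum a f hf] at this
  exact (mul_eq_zero.1 this).resolve_right hX

/-- Both products lie in the span of the `τ(T_w)` and act on `ℂ(P^m) x^η` through the same Weyl
group element, so determinacy by restriction applies. No braid relation for `σ(s_i)` is verified
directly. -/
lemma prod_sigmaSimple_eq {ω ω' : List S.I} (h : S.wordProd ω = S.wordProd ω') :
    (ω.map p.sigmaSimple).prod = (ω'.map p.sigmaSimple).prod := by
  obtain ⟨a, ha⟩ := p.exists_prod_sigmaSimple_eq ω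
  obtain ⟨b, hb⟩ := p.exists_prod_sigmaSimple_eq ω'
  have e : ∀ f ∈ D.Km, (ω.map p.sigmaSimple).prod (f * S.X D.eta) =
      (ω'.map p.sigmaSimple).prod (f * S.X D.eta) := by
    intro f hf
    rw [p.prod_sigmaSimple_mul ω hf, p.prod_sigmaSimple_mul ω' hf, prod_sigmaSimple_X_eta,
      prod_sigmaSimple_X_eta, h]
  have : (fun w => a w - b w) = 0 := by
    refine p.eq_zero_of_restrict fun f hf => ?_
    have h1 := e f hf
    rw [ha, hb] at h1
    have h2 : ∑ w, S.mulOp (a w - b w) * p.tauTW w =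
        ∑ w, S.mulOp (a w) * p.tauTW w - ∑ w, S.mulOp (b w) * p.tauTW w := by
      rw [← Finset.sum_sub_distrib]
      refine Finset.sum_congr rfl fun w _ => LinearMap.ext fun x => sub_mul _ _ _
    rw [h2, LinearMap.sub_apply, h1, sub_self]
  rw [ha, hb, show a = b from funext fun w => sub_eq_zero.1 (congrFun this w)]

lemma sigma_wordProd (ω : List S.I) : p.sigma (S.wordProd ω) = (ω.map p.sigmaSimple).prod :=
  p.prod_sigmaSimple_eq (S.isReducedWord_redWord _).1

lemma sigma_s_mul (i : S.I) (w : S.W) : p.sigma (S.s i * w) = p.sigmaSimple i * p.sigma w := by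
  obtain ⟨ω, rfl⟩ := S.exists_word w
  rw [← wordProd_cons, sigma_wordProd, sigma_wordProd, List.map_cons, List.prod_cons]

lemma sigma_one : p.sigma 1 = 1 := p.sigma_wordProd []

lemma sigma_mul (w : S.W) {f : S.K} (hf : f ∈ D.Km) (h : S.K) :
    p.sigma w (f * h) = S.weylK w f * p.sigma w h := by
  rw [sigma, p.prod_sigmaSimple_mul _ hf, (S.isReducedWord_redWord w).1]

lemma eq_zero_of_sum_sigma {a : S.W → S.K} (h : ∑ w, S.mulOp (a w) * p.sigma w = 0) : a = 0 := by
  refine D.eq_zero_of_sum_weylK fun f hf => ?_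
  have h1 := LinearMap.congr_fun h (f * S.X D.eta)
  simp only [LinearMap.sum_apply, Module.End.mul_apply, mulOp_apply, p.sigma_mul _ hf] at h1
  have h2 : ∀ w, p.sigma w (S.X D.eta) = S.X D.eta := fun w => p.prod_sigmaSimple_X_eta _
  simp only [h2, ← mul_assoc, ← Finset.sum_mul] at h1
  exact (mul_eq_zero.1 h1).resolve_right (S.X_ne_zero _)

end Parameters

end

end Metaplectic

namespace Metaplectic

noncomputable section

open BasedRootSystem MetaplecticStructure

/-! ### Inversion sets, the longest element and `ρ^m` -/

namespace BasedRootSystem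

variable {ι E : Type*} [Fintype ι] [NormedAddCommGroup E] [InnerProductSpace ℝ E]
  (S : BasedRootSystem ι E)

/-- Maximality of the length makes every `s_i` a left descent, so `w₀⁻¹` sends simple roots to
negative ones. Additivity of the height extends this to all positive roots. -/
lemma inversions_w₀_inv : S.inversions S.w₀⁻¹ = S.posRoots := by
  classical
  have hsimple : ∀ i : S.I, ¬ S.b.IsPos (S.w₀⁻¹ • (i : ι)) := by
    intro i hi
    have h1 := S.length_s_mul_of_pos hi
    have h2 := S.exists_longest.choose_spec (S.s i * S.w₀)
    change _ ≤ S.length S.w₀ at h2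
    omega
  ext i
  rw [mem_inversions, show i ∈ S.posRoots ↔ S.b.IsPos i by simp [posRoots], and_iff_left_iff_imp]
  intro hi
  refine hi.induction_on_add (p := fun i => ¬ S.b.IsPos (S.w₀⁻¹ • i))
    (fun j hj => hsimple ⟨j, hj⟩) ?_
  intro i j k hk hi hj
  have hj := hsimple ⟨j, hj⟩
  have e : S.R.root (S.w₀⁻¹ • k) = S.R.root (S.w₀⁻¹ • i) + S.R.root (S.w₀⁻¹ • j) := by
    rw [root_smul, root_smul, root_smul, hk, smul_add]
  rw [RootPairing.Base.isPos_iff, not_lt] at *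
  rw [S.b.height_add e]
  exact add_nonpos hi hj

lemma s_smul_smul_idx (i : S.I) (j : ι) : S.s i • S.s i • j = j := by
  rw [← mul_smul, s_mul_s, one_smul]

lemma s_smul_self_idx (i : S.I) : S.s i • (i : ι) = S.negIdx i := rfl

/-- If `s_i w` is longer than `w`, then `Φ((s_i w)⁻¹)` is the disjoint union of `{α_i}` and `s_i
Φ(w⁻¹)`. -/
lemma prod_inversions_s_mul {M : Type*} [CommMonoid M] {w : S.W} {i : S.I}
    (h : S.b.IsPos (w⁻¹ • (i : ι))) (F : ι → M) :
    ∏ j ∈ S.inversions (S.s i * w)⁻¹, F j = F i * ∏ j ∈ S.inversions w⁻¹, F (S.s i • j) := by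
  classical
  have hmem : ∀ j, j ∈ S.inversions (S.s i * w)⁻¹ ↔ S.b.IsPos j ∧
      ¬ S.b.IsPos (w⁻¹ • S.s i • j) := by
    intro j
    rw [mem_inversions, mul_inv_rev, s_inv, mul_smul]
  have hi : (i : ι) ∈ S.inversions (S.s i * w)⁻¹ := by
    rw [hmem, s_smul_self_idx, smul_negIdx, isPos_negIdx]
    exact ⟨S.isPos_simple i, not_not.2 h⟩
  rw [← Finset.mul_prod_erase _ _ hi]
  congr 1
  refine Finset.prod_nbij' (fun j => S.s i • j) (fun j => S.s i • j) ?_ ?_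
    (fun j _ => S.s_smul_smul_idx i j) (fun j _ => S.s_smul_smul_idx i j)
    (fun j _ => by rw [s_smul_smul_idx])
  · intro j hj
    rw [Finset.mem_erase, hmem] at hj
    rw [mem_inversions]
    exact ⟨S.isPos_s_smul hj.2.1 hj.1, hj.2.2⟩
  · intro j hj
    rw [mem_inversions] at hj
    have hne : j ≠ i := by
      rintro rfl
      exact hj.2 h
    rw [Finset.mem_erase, hmem, s_smul_smul_idx]
    refine ⟨fun he => ?_, S.isPos_s_smul hj.1 hne, hj.2⟩
    have := congrArg (S.s i • ·) he
    simp only [s_smul_smul_idx, s_smul_self_idx] at this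
    rw [this, isPos_negIdx] at hj
    exact hj.1 (S.isPos_simple i)

lemma neg_one_pow_length_s_mul {A : Type*} [Ring A] (i : S.I) (w : S.W) :
    (-1 : A) ^ S.length (S.s i * w) = -(-1) ^ S.length w := by
  by_cases h : S.b.IsPos (w⁻¹ • (i : ι))
  · rw [S.length_s_mul_of_pos h, pow_succ, mul_neg_one]
  · rw [← S.length_s_mul_of_neg h, pow_succ, mul_neg_one, neg_neg]

end BasedRootSystem

namespace MetaplecticStructure

variable {ι E : Type*} [Fintype ι] [NormedAddCommGroup E] [InnerProductSpace ℝ E]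
  {S : BasedRootSystem ι E} (D : MetaplecticStructure S)

lemma s_smul_rho (i : S.I) : S.s i • D.rho = D.rho - D.mroot i := by
  rw [D.s_smul_of_pair_eq (a := 1) (by rw [pair_rho, one_mul]), one_smul]

/-- The divisibility holds at simple roots by `pair_rho`. It propagates along simple reflections
because `s_j ρ^m = ρ^m - α_j^m` and `α_j^m ∈ P^m`. -/
lemma rho_mem_Pm : D.rho ∈ D.Pm := by
  rw [mem_Pm_iff]
  intro i
  refine S.b.induction_reflect i (p := fun i => (D.m i : ℤ) ∣ pair D.rho i) ?_ ?_ ?_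
  · intro i h
    change (D.m (S.negIdx i) : ℤ) ∣ pair D.rho (S.negIdx i)
    have hm : D.m (S.negIdx i) = D.m i := D.m_smul (RootPairing.weylGroup.ofIdx S.R i) i
    have hp := S.pair_smul_smul (RootPairing.weylGroup.ofIdx S.R i)
      ((RootPairing.weylGroup.ofIdx S.R i : S.W) • D.rho) i
    have hr : (RootPairing.weylGroup.ofIdx S.R i : S.W) •
        (RootPairing.weylGroup.ofIdx S.R i : S.W) • D.rho = D.rho := by
      rw [ofIdx_smul_P, ofIdx_smul_P, pair_sub, pair_zsmul, pair_rootP_self]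
      module
    rw [hr, ofIdx_smul_P, pair_sub, pair_zsmul, pair_rootP_self] at hp
    have hp' : pair D.rho (S.negIdx i) = -pair D.rho i := by
      refine Eq.trans hp ?_
      ring
    rw [hm, hp', dvd_neg]
    exact h
  · intro i hi
    exact (D.pair_rho ⟨i, hi⟩) ▸ dvd_rfl
  · intro i j h hj
    change (D.m (S.s ⟨j, hj⟩ • i) : ℤ) ∣ pair D.rho (S.s ⟨j, hj⟩ • i)
    have hp := S.pair_smul (S.s ⟨j, hj⟩) D.rho i
    rw [s_inv, s_smul_rho, pair_sub] at hp
    rw [m_smul, ← hp]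
    exact dvd_sub h ((D.mem_Pm_iff _).1 (D.mroot_mem_Pm j) i)

/-- This identity converts the `ρ^m`-conjugated form of the sum into the form with inversion sets.
-/
lemma X_rho_sub_smul (w : S.W) :
    S.X (D.rho - w • D.rho) = ∏ i ∈ S.inversions w⁻¹, S.X (D.mroot i) := by
  induction w using S.induction_length with
  | one =>
    have : S.inversions 1⁻¹ = ∅ := by simp [inversions]
    rw [this, one_smul, sub_self, X_zero, Finset.prod_empty]
  | cons i w h ih =>
    have e : D.rho - (S.s i * w) • D.rho = D.mroot i + S.s i • (D.rho - w • D.rho) := by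
      rw [smul_sub, s_smul_rho, mul_smul]
      abel
    rw [e, X_add, ← weylK_X, ih, map_prod, S.prod_inversions_s_mul h]
    congr 1
    exact Finset.prod_congr rfl fun j _ => by rw [weylK_X, mroot_smul]

end MetaplecticStructure

namespace Parameters

variable {ι E : Type*} [Fintype ι] [NormedAddCommGroup E] [InnerProductSpace ℝ E]
  {S : BasedRootSystem ι E} {D : MetaplecticStructure S} (p : Parameters D)

/-! ### Braid relations for the Demazure--Lusztig operators -/

lemma DL_eq (i : S.I) : p.DL i =
    -(p.k i : ℂ) • (S.mulOp (S.X D.rho) * p.tauTInv i * S.mulOp (S.X (-D.rho))) := by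
  rw [DL, ringInverse_tauT]

lemma prod_DL_eq (ω : List S.I) : (ω.map p.DL).prod = (ω.map fun i : S.I => -(p.k i : ℂ)).prod •
    (S.mulOp (S.X D.rho) * (ω.map p.tauTInv).prod * S.mulOp (S.X (-D.rho))) := by
  have hX : S.mulOp (S.X (-D.rho)) * S.mulOp (S.X D.rho) = 1 := by
    rw [← mulOp_mul, ← X_add, neg_add_cancel, X_zero, mulOp_one]
  have hX' : S.mulOp (S.X D.rho) * S.mulOp (S.X (-D.rho)) = 1 := by
    rw [← mulOp_mul, ← X_add, add_neg_cancel, X_zero, mulOp_one]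
  induction ω with
  | nil => simp [hX']
  | cons i ω ih =>
    simp only [List.map_cons, List.prod_cons]
    rw [ih, DL_eq, smul_mul_smul_comm]
    congr 1
    simp only [mul_assoc]
    rw [← mul_assoc (S.mulOp (S.X (-D.rho))) (S.mulOp (S.X D.rho)), hX, one_mul]

/-- `τ(T_i)` as a unit. -/
def tauUnit (i : S.I) : (Module.End ℂ S.K)ˣ :=
  ⟨p.tauT i, p.tauTInv i, p.tauT_mul_tauTInv i, p.tauTInv_mul_tauT i⟩

lemma tauTInv_braid {i j : S.I} (h : i ≠ j) : ((altList i j (S.cox i j)).map p.tauTInv).prod =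
    ((altList j i (S.cox i j)).map p.tauTInv).prod := by
  have h1 : ((altList i j (S.cox i j)).map p.tauUnit).prod =
      ((altList j i (S.cox i j)).map p.tauUnit).prod := by
    apply Units.ext
    have := p.tauT_braid h
    rwa [← Units.coeHom_apply, ← Units.coeHom_apply, map_list_prod, map_list_prod, List.map_map,
      List.map_map]
  have h2 : ((altList i j (S.cox i j)).map fun l => (p.tauUnit l)⁻¹).prod =
      ((altList j i (S.cox i j)).map fun l => (p.tauUnit l)⁻¹).prod := by
    have h3 := congrArg (·⁻¹) h1
    -- Inversion reverses words: for even length this exchanges the two sides of the relation, for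
    -- length three it preserves them.
    rcases S.cox_cases i j with hc | hc | hc | hc <;> rw [hc] at h3 ⊢ <;>
      simp only [altList, List.map_cons, List.map_nil, List.prod_cons, List.prod_nil, mul_one,
        mul_inv_rev, mul_assoc] at h3 ⊢ <;>
      first | exact h3 | exact h3.symm
  have h4 := congrArg (Units.coeHom _) h2
  rwa [map_list_prod, map_list_prod, List.map_map, List.map_map] at h4

lemma DL_braid {i j : S.I} (h : i ≠ j) : ((altList i j (S.cox i j)).map p.DL).prod =
    ((altList j i (S.cox i j)).map p.DL).prod := by
  rw [prod_DL_eq, prod_DL_eq, p.tauTInv_braid h]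
  congr 1
  rcases S.cox_cases i j with hc | hc | hc | hc
  · have hk := p.k_opp h
    rw [opp, if_pos hc] at hk
    simp [hc, altList, hk]
  all_goals simp only [hc, altList, List.map_cons, List.map_nil, List.prod_cons, List.prod_nil]; ring

lemma DLW_eq {w : S.W} {ω : List S.I} (h : S.IsReducedWord ω w) :
    p.DLW w = (ω.map p.DL).prod :=
  S.prod_reducedWord_eq p.DL (fun _ _ h => p.DL_braid h) (S.isReducedWord_redWord w) h

lemma DLW_one : p.DLW 1 = 1 := S.redProd_one p.DL

lemma DLW_s_mul {i : S.I} {w : S.W} (hi : S.b.IsPos (w⁻¹ • (i : ι))) :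
    p.DLW (S.s i * w) = p.DL i * p.DLW w :=
  S.redProd_s_mul p.DL (fun _ _ h => p.DL_braid h) hi

lemma DL_apply' (i : S.I) (x : S.K) : p.DL i x = -algebraMap ℂ S.K (p.k i) *
    (S.X D.rho * p.tauTInv i (S.X (-D.rho) * x)) := by
  rw [DL_eq, LinearMap.smul_apply, Algebra.smul_def, map_neg]
  rfl

/-- The Demazure--Lusztig operators in terms of `σ`. -/
lemma DL_apply (i : S.I) (x : S.K) :
    p.DL i x = (p.c i - 1) * x - p.c i * S.X (D.mroot i) * p.sigmaSimple i x := by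
  have h1 := p.k_ne_zero i
  have hX := S.X_ne_zero D.rho
  have e : S.s i • -D.rho = -D.rho + D.mroot i := by
    rw [smul_neg, s_smul_rho]
    abel
  rw [DL_apply', tauTInv_apply, tauT_apply, p.sigmaSimple_mul i (D.X_mem_Km (neg_mem D.rho_mem_Pm)), weylK_X,
    e, X_add, X_neg, q, map_sub, map_inv₀]
  field_simp
  ring

/-- Conjugated and rescaled, the quadratic relation reads `(𝒯_i - k_i²)(𝒯_i + 1) = 0`. -/
lemma DL_sq (i : S.I) (x : S.K) :
    p.DL i (p.DL i x) = (p.ksq i - 1) * p.DL i x + p.ksq i * x := by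
  have hT : ∀ y, p.tauTInv i (p.tauTInv i y) = y - algebraMap ℂ S.K (p.q i) * p.tauTInv i y := by
    intro y
    have h := LinearMap.congr_fun (p.tauT_mul_tauTInv i) y
    rw [Module.End.mul_apply, Module.End.one_apply] at h
    rw [tauTInv_apply, h]
  have hX : ∀ y, S.X (-D.rho) * (-algebraMap ℂ S.K (p.k i) * (S.X D.rho * y)) =
      (-p.k i : ℂ) • y := by
    intro y
    have := S.X_ne_zero D.rho
    rw [Algebra.smul_def, map_neg, X_neg]
    field_simp
  have h1 := p.k_ne_zero i
  have h2 := S.X_ne_zero D.rho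
  rw [DL_apply', DL_apply', hX, map_smul, hT, Algebra.smul_def, map_neg, ksq, q, map_sub, map_inv₀,
    map_pow, X_neg]
  field_simp
  ring

/-- `(𝒯_i - k_i²) ∑_w 𝒯_w = 0`. -/
lemma DL_mul_sum (i : S.I) : p.DL i * ∑ w, p.DLW w = S.mulOp (p.ksq i) * ∑ w, p.DLW w := by
  -- The elements of `W` are grouped into pairs `w`, `s_i w`. Each pair contributes `(1 + 𝒯_i) 𝒯_w`
  -- for the shorter element `w`, and `𝒯_i - k_i²` kills this.
  have key : ∀ w, p.DL i * (p.DLW w + p.DLW (S.s i * w)) =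
      S.mulOp (p.ksq i) * (p.DLW w + p.DLW (S.s i * w)) := by
    have h : ∀ w, S.b.IsPos (w⁻¹ • (i : ι)) → p.DL i * (p.DLW w + p.DLW (S.s i * w)) =
        S.mulOp (p.ksq i) * (p.DLW w + p.DLW (S.s i * w)) := by
      intro w hw
      rw [p.DLW_s_mul hw]
      ext x
      simp only [Module.End.mul_apply, LinearMap.add_apply, map_add, mulOp_apply, DL_sq]
      ring
    intro w
    by_cases hw : S.b.IsPos (w⁻¹ • (i : ι))
    · exact h w hw
    · have := h (S.s i * w) ((S.isPos_inv_smul_s_mul w i).2 hw)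
      rwa [s_mul_s_cancel, add_comm] at this
  have hsum : ∑ w, p.DLW (S.s i * w) = ∑ w, p.DLW w :=
    Fintype.sum_equiv (Equiv.mulLeft (S.s i)) _ _ fun _ => rfl
  have h := Finset.sum_congr (rfl : (Finset.univ : Finset S.W) = _) fun w _ => key w
  rw [← Finset.mul_sum, ← Finset.mul_sum, Finset.sum_add_distrib, hsum, ← two_smul ℂ,
    mul_smul_comm, mul_smul_comm] at h
  exact smul_right_injective _ (two_ne_zero (α := ℂ)) h

/-! ### The sum of the Demazure--Lusztig operators -/

/-- Coefficients in `ℂ(P^m)` pass through `σ(s_i)` semilinearly, and `σ(s_i) σ(w) = σ(s_i w)` is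
absorbed by reindexing. -/
lemma DL_mul_sum_sigma (i : S.I) {a : S.W → S.K} (ha : ∀ w, a w ∈ D.Km) :
    p.DL i * ∑ w, S.mulOp (a w) * p.sigma w = ∑ w, S.mulOp ((p.c i - 1) * a w -
      p.c i * S.X (D.mroot i) * S.weylK (S.s i) (a (S.s i * w))) * p.sigma w := by
  ext x
  have hsum : ∑ w, S.weylK (S.s i) (a w) * p.sigma (S.s i * w) x =
      ∑ w, S.weylK (S.s i) (a (S.s i * w)) * p.sigma w x :=
    Fintype.sum_equiv (Equiv.mulLeft (S.s i)) _ _ fun w => by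
      rw [Equiv.coe_mulLeft, s_mul_s_cancel]
  simp only [Module.End.mul_apply, LinearMap.sum_apply, mulOp_apply, DL_apply, map_sum,
    p.sigmaSimple_mul i (ha _), ← Module.End.mul_apply (p.sigmaSimple i), ← p.sigma_s_mul]
  rw [Finset.sum_sub_distrib, ← Finset.mul_sum, ← Finset.mul_sum, hsum, Finset.mul_sum, Finset.mul_sum,
    ← Finset.sum_sub_distrib]
  exact Finset.sum_congr rfl fun w _ => by ring

lemma DL_coeff_mem (i : S.I) {a b : S.K} (ha : a ∈ D.Km) (hb : b ∈ D.Km) :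
    (p.c i - 1) * a - p.c i * S.X (D.mroot i) * S.weylK (S.s i) b ∈ D.Km :=
  sub_mem (mul_mem (sub_mem (p.c_mem_Km i) (one_mem _)) ha)
    (mul_mem (mul_mem (p.c_mem_Km i) (D.X_mem_Km (D.mroot_mem_Pm i))) (D.weylK_mem_Km _ hb))

/-- The expansion of `𝒯_w` in the operators `σ(v)`, and its leading coefficient. -/
lemma exists_DLW_eq (w : S.W) : ∃ a : S.W → S.K, (∀ v, a v ∈ D.Km) ∧
    p.DLW w = ∑ v, S.mulOp (a v) * p.sigma v ∧
    (∀ v, S.length w ≤ S.length v → v ≠ w → a v = 0) ∧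
    a w = (-1) ^ S.length w * ∏ j ∈ S.inversions w⁻¹, (p.c j * S.X (D.mroot j)) := by
  classical
  induction w using S.induction_length with
  | one =>
    refine ⟨Pi.single 1 1, fun v => ?_, ?_, fun v _ hv => Pi.single_eq_of_ne hv _, ?_⟩
    · rw [Pi.single_apply]
      split_ifs
      · exact one_mem _
      · exact zero_mem _
    · rw [Finset.sum_eq_single_of_mem 1 (Finset.mem_univ _)]
      · rw [Pi.single_eq_same, mulOp_one, sigma_one, DLW_one, one_mul]
      · intro v _ hv
        ext x
        rw [Pi.single_eq_of_ne hv, Module.End.mul_apply, mulOp_apply, zero_mul,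
          LinearMap.zero_apply]
    · have : S.inversions 1⁻¹ = ∅ := by simp [inversions]
      rw [this, Pi.single_eq_same, length_one, pow_zero, Finset.prod_empty, mul_one]
  | cons i w h ih =>
    obtain ⟨a, ha, hw, h0, h1⟩ := ih
    have hl := S.length_s_mul_of_pos h
    refine ⟨fun v => (p.c i - 1) * a v - p.c i * S.X (D.mroot i) *
      S.weylK (S.s i) (a (S.s i * v)), fun v => p.DL_coeff_mem i (ha _) (ha _), ?_, ?_, ?_⟩
    · rw [p.DLW_s_mul h, hw, p.DL_mul_sum_sigma i ha]
    · intro v hv hne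
      -- For `v ≠ s_i w` at least as long as `s_i w`, both `v` and `s_i v` are at least as long as
      -- `w` and differ from `w`. Both earlier coefficients therefore vanish.
      have h2 := S.length_s_mul_le (S.s i * v) i
      rw [s_mul_s_cancel] at h2
      have h3 : a v = 0 := h0 v (by omega) (by rintro rfl; omega)
      have h4 : a (S.s i * v) = 0 := by
        refine h0 _ (by omega) ?_
        rintro rfl
        exact hne (S.s_mul_s_cancel i v).symm
      simp only [h3, h4, map_zero, mul_zero, sub_zero]
    · have h3 : a (S.s i * w) = 0 := by
        refine h0 _ (by omega) fun he => ?_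
        rw [he] at hl
        omega
      have h4 : S.weylK (S.s i) (∏ j ∈ S.inversions w⁻¹, (p.c j * S.X (D.mroot j))) =
          ∏ j ∈ S.inversions w⁻¹, (p.c (S.s i • j) * S.X (D.mroot (S.s i • j))) := by
        rw [map_prod]
        exact Finset.prod_congr rfl fun j _ => by rw [map_mul, weylK_c, weylK_X, mroot_smul]
      simp only [s_mul_s_cancel]
      rw [h3, h1, S.neg_one_pow_length_s_mul, map_mul, h4, map_pow, map_neg, map_one,
        S.prod_inversions_s_mul h]
      ring

/-- The reflection `s_i` permutes the positive roots other than `α_i`. -/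
lemma weylK_cProd (i : S.I) : S.weylK (S.s i) p.cProd * p.c i =
    p.cProd * p.c (S.negIdx i) := by
  classical
  have hi : (i : ι) ∈ S.posRoots := by simp [posRoots, S.isPos_simple i]
  have hmem : ∀ l ∈ S.posRoots.erase (i : ι), S.s i • l ∈ S.posRoots.erase (i : ι) := by
    intro l hl
    simp only [posRoots, Finset.mem_erase, Finset.mem_filter, Finset.mem_univ, true_and] at hl ⊢
    refine ⟨fun he => ?_, S.isPos_s_smul hl.2 hl.1⟩
    have := congrArg (S.s i • ·) he
    simp only [s_smul_smul_idx, s_smul_self_idx] at this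
    rw [this, isPos_negIdx] at hl
    exact hl.2 (S.isPos_simple i)
  have h : S.weylK (S.s i) (∏ j ∈ S.posRoots.erase (i : ι), p.c j) =
      ∏ j ∈ S.posRoots.erase (i : ι), p.c j := by
    rw [map_prod]
    exact Finset.prod_nbij' (fun l => S.s i • l) (fun l => S.s i • l) hmem hmem
      (fun l _ => S.s_smul_smul_idx i l) (fun l _ => S.s_smul_smul_idx i l)
      (fun l _ => p.weylK_c _ l)
  rw [cProd, ← Finset.mul_prod_erase _ _ hi, map_mul, h, weylK_c, s_smul_self_idx]
  ring

lemma mroot_negIdx (i : S.I) : D.mroot (S.negIdx i) = -D.mroot i := by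
  rw [← s_smul_self_idx, mroot_smul, s_smul_mroot]

/-- Equivalent to `c_α + c_{-α} = 1 + k_α²`; this is where the eigenvalue `k_i²` meets the closed
formula. -/
lemma c_negIdx (i : S.I) : p.c i - 1 - p.ksq i = -p.c (S.negIdx i) := by
  have h1 := one_sub_mroot_ne_zero D i
  have h2 := one_sub_mroot_ne_zero D (S.negIdx i)
  have hk : p.ksq (S.negIdx i) = p.ksq i := by
    rw [ksq, ← s_smul_self_idx, p.k_smul, ksq]
  have hX := S.X_ne_zero (D.mroot i)
  rw [c, c, hk]
  rw [mroot_negIdx, X_neg] at h2 ⊢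
  have h3 : S.X (D.mroot i) - 1 ≠ 0 := by
    rw [← neg_sub]
    exact neg_ne_zero.2 h1
  have h4 : 1 - (S.X (D.mroot i))⁻¹ = (S.X (D.mroot i) - 1) / S.X (D.mroot i) := by
    field_simp
  rw [h4]
  field_simp
  ring

/-- The coefficients of `∑_w 𝒯_w` in the operators `σ(w)`. -/
def sumCoef (w : S.W) : S.K :=
  p.cProd * ((-1) ^ S.length w * ∏ i ∈ S.inversions w⁻¹, S.X (D.mroot i))

/-- The closed formula satisfies the eigenvector recursion. The sign flips, `ρ^m - wρ^m` shifts by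
`α_i^m`, and only the factor at `α_i` of `∏ c_α` changes under `s_i`. -/
lemma sumCoef_s_mul (i : S.I) (w : S.W) :
    (p.c i - 1) * p.sumCoef w - p.c i * S.X (D.mroot i) *
      S.weylK (S.s i) (p.sumCoef (S.s i * w)) = p.ksq i * p.sumCoef w := by
  have hX := S.X_ne_zero (D.mroot i)
  have e : S.s i • (D.rho - (S.s i * w) • D.rho) = -D.mroot i + (D.rho - w • D.rho) := by
    rw [smul_sub, ← mul_smul, s_mul_s_cancel, s_smul_rho]
    abel
  have hs : S.weylK (S.s i) (p.sumCoef (S.s i * w)) * p.c i * S.X (D.mroot i) =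
      -(p.c (S.negIdx i) * p.sumCoef w) := by
    rw [sumCoef, sumCoef, ← X_rho_sub_smul, ← X_rho_sub_smul, S.neg_one_pow_length_s_mul, map_mul,
      map_mul, weylK_X, e, X_add, X_neg, map_neg, map_pow, map_neg, map_one]
    have := p.weylK_cProd i
    field_simp
    linear_combination -S.X (D.rho - w • D.rho) * this
  linear_combination p.sumCoef w * p.c_negIdx i - hs

theorem sum_DLW : ∑ w, p.DLW w = ∑ w, S.mulOp (p.sumCoef w) * p.sigma w := by
  choose a ha hw h0 h1 using fun w => p.exists_DLW_eq w
  have hb : ∀ v, ∑ w, a w v ∈ D.Km := fun v => sum_mem fun w _ => ha w v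
  have hN : ∑ w, p.DLW w = ∑ v, S.mulOp (∑ w, a w v) * p.sigma v := by
    rw [Finset.sum_congr rfl fun w _ => hw w, Finset.sum_comm]
    refine Finset.sum_congr rfl fun v _ => LinearMap.ext fun x => ?_
    simp only [LinearMap.sum_apply, Module.End.mul_apply, mulOp_apply, Finset.sum_mul]
  have hrec : ∀ (i : S.I) v, (p.c i - 1) * (∑ w, a w v) - p.c i * S.X (D.mroot i) *
      S.weylK (S.s i) (∑ w, a w (S.s i * v)) = p.ksq i * ∑ w, a w v := by
    intro i v
    have h := p.DL_mul_sum i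
    rw [hN, p.DL_mul_sum_sigma i hb, ← sub_eq_zero, Finset.mul_sum, ← Finset.sum_sub_distrib] at h
    refine sub_eq_zero.1 (congrFun (p.eq_zero_of_sum_sigma (a := fun v =>
      (p.c i - 1) * (∑ w, a w v) - p.c i * S.X (D.mroot i) *
        S.weylK (S.s i) (∑ w, a w (S.s i * v)) - p.ksq i * ∑ w, a w v) (Eq.trans (Finset.sum_congr rfl fun v _ => ?_) h)) v)
    rw [← mul_assoc, ← mulOp_mul, ← sub_mul]
    congr 1
    exact LinearMap.ext fun x => sub_mul _ _ _
  -- No other `𝒯_w` involves `σ(w₀)`, since all lengths are at most that of `w₀`.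
  have htop : ∑ w, a w S.w₀ = p.sumCoef S.w₀ := by
    rw [Finset.sum_eq_single_of_mem S.w₀ (Finset.mem_univ _)]
    · rw [h1, sumCoef, cProd, inversions_w₀_inv, Finset.prod_mul_distrib]
      ring
    · intro w _ hne
      exact h0 w _ (S.exists_longest.choose_spec w) hne.symm
  -- The factor `c_i x^{α_i^m}` is nonzero, so the recursion determines the coefficient at `s_i v`
  -- from the one at `v`.
  have hstep : ∀ (i : S.I) v, ∑ w, a w v = p.sumCoef v →
      ∑ w, a w (S.s i * v) = p.sumCoef (S.s i * v) := by
    intro i v h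
    have e1 := hrec i v
    have e2 := p.sumCoef_s_mul i v
    rw [h, ← e2, sub_right_inj] at e1
    exact (S.weylK (S.s i)).injective
      (mul_left_cancel₀ (mul_ne_zero (p.c_ne_zero i) (S.X_ne_zero _)) e1)
  have hall : ∀ ω : List S.I, ∑ w, a w (S.wordProd ω * S.w₀) = p.sumCoef (S.wordProd ω * S.w₀) := by
    intro ω
    induction ω with
    | nil => rw [wordProd_nil, one_mul]; exact htop
    | cons i ω ih => rw [wordProd_cons, mul_assoc]; exact hstep i _ ih
  rw [hN]
  refine Finset.sum_congr rfl fun v _ => ?_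
  obtain ⟨ω, hω⟩ := S.exists_word (v * S.w₀⁻¹)
  have := hall ω
  rw [hω, inv_mul_cancel_right] at this
  rw [this]

end Parameters

end

end Metaplectic

namespace Metaplectic

noncomputable section

open BasedRootSystem MetaplecticStructure

/-! ### Polynomiality and the final formulas -/

namespace BasedRootSystem

variable {ι E : Type*} [Fintype ι] [NormedAddCommGroup E] [InnerProductSpace ℝ E]
  (S : BasedRootSystem ι E)

lemma X_mem_groupAlg {Lam : AddSubgroup E} {lam : S.P} (h : (lam : E) ∈ Lam) :
    S.X lam ∈ S.groupAlg Lam := Submodule.subset_span ⟨lam, h, rfl⟩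

lemma smul_mem_of_rootLattice_le {Lam : AddSubgroup E} (hQ : S.rootLattice ≤ Lam) (w : S.W)
    {lam : S.P} (h : (lam : E) ∈ Lam) : ((w • lam : S.P) : E) ∈ Lam := by
  induction w using S.induction_length with
  | one => rwa [one_smul]
  | cons i w _ ih =>
    rw [mul_smul, s_smul]
    exact sub_mem ih (zsmul_mem (hQ (AddSubgroup.subset_closure ⟨i, rfl⟩)) _)

/-- A finite geometric sum; the induction runs in both directions, as the exponent may be negative.
-/
lemma geomSum_mem_groupAlg {Lam : AddSubgroup E} {lam mu : S.P} (h : (lam : E) ∈ Lam)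
    (hmu : (mu : E) ∈ Lam) (h0 : mu ≠ 0) (e : ℤ) :
    (1 - S.X (e • mu)) / (1 - S.X mu) * S.X lam ∈ S.groupAlg Lam := by
  have h1 := S.one_sub_X_ne_zero h0
  have step : ∀ e : ℤ, (1 - S.X ((e + 1) • mu)) / (1 - S.X mu) * S.X lam =
      (1 - S.X (e • mu)) / (1 - S.X mu) * S.X lam + S.X (e • mu + lam) := by
    intro e
    rw [add_smul, one_smul, X_add, X_add]
    field_simp
    ring
  have hX : ∀ e : ℤ, S.X (e • mu + lam) ∈ S.groupAlg Lam := fun e =>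
    S.X_mem_groupAlg (add_mem (zsmul_mem hmu e) h)
  induction e using Int.induction_on with
  | zero => simp [X_zero]
  | succ k ih => rw [step]; exact add_mem ih (hX _)
  | pred k ih =>
    have := step (-k - 1)
    rw [sub_add_cancel] at this
    rw [eq_sub_of_add_eq this.symm]
    exact sub_mem ih (hX _)

end BasedRootSystem

namespace Parameters

variable {ι E : Type*} [Fintype ι] [NormedAddCommGroup E] [InnerProductSpace ℝ E]
  {S : BasedRootSystem ι E} {D : MetaplecticStructure S} (p : Parameters D)

/-- The factor `c_i` cancels the denominator `1 - k_i² x^{α_i^m}` of `σ(s_i)`. The remaining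
denominator `1 - x^{α_i^m}` divides its numerator, which makes integrality visible. -/
lemma DL_X (i : S.I) (lam : S.P) : p.DL i (S.X lam) =
    (1 - (p.k i : ℂ) ^ 2) • ((1 - S.X (D.qPair (-lam) i • D.mroot i)) / (1 - S.X (D.mroot i)) *
      S.X (D.mroot i + lam)) +
    ((p.k i : ℂ) ^ 2 * p.g (D.Qroot i - D.Broot lam i) (D.size i)) •
      S.X (S.rootP i + S.s i • lam) := by
  have h1 := one_sub_mroot_ne_zero D i
  have h2 := p.one_sub_ksq_ne_zero i
  have h3 := S.X_ne_zero (D.mroot i)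
  rw [DL_apply, sigmaSimple_X, sigmaFormula, map_one, X_neg, c, Algebra.smul_def, Algebra.smul_def,
    map_sub, map_one, map_mul, X_add (lam := D.mroot i)]
  change _ = (1 - p.ksq i) * _ + p.ksq i * _ * _
  field_simp
  ring

lemma DL_mem_groupAlg {Lam : AddSubgroup E} (hQ : S.rootLattice ≤ Lam) (i : S.I) {f : S.K}
    (hf : f ∈ S.groupAlg Lam) : p.DL i f ∈ S.groupAlg Lam := by
  have hroot : (S.rootP i : E) ∈ Lam := hQ (AddSubgroup.subset_closure ⟨i, rfl⟩)
  have hmroot : (D.mroot i : E) ∈ Lam := nsmul_mem hroot _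
  induction hf using Submodule.span_induction with
  | mem x hx =>
    obtain ⟨lam, hlam, rfl⟩ := hx
    rw [DL_X]
    exact add_mem (Submodule.smul_mem _ _ (S.geomSum_mem_groupAlg (add_mem hmroot hlam) hmroot
      (D.mroot_ne_zero i) _)) (Submodule.smul_mem _ _ (S.X_mem_groupAlg
      (add_mem hroot (S.smul_mem_of_rootLattice_le hQ _ hlam))))
  | zero => rw [map_zero]; exact zero_mem _
  | add x y _ _ hx hy => rw [map_add]; exact add_mem hx hy
  | smul a x _ hx => rw [map_smul]; exact Submodule.smul_mem _ _ hx

lemma DLW_mem_groupAlg {Lam : AddSubgroup E} (hQ : S.rootLattice ≤ Lam) (w : S.W) {f : S.K}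
    (hf : f ∈ S.groupAlg Lam) : p.DLW w f ∈ S.groupAlg Lam := by
  rw [DLW]
  induction S.redWord w with
  | nil => exact hf
  | cons i ω ih => exact p.DL_mem_groupAlg hQ i ih

lemma mulOp_neg_one_pow (n : ℕ) : S.mulOp ((-1) ^ n) = (-1) ^ n := by
  induction n with
  | zero => rw [pow_zero, pow_zero, mulOp_one]
  | succ n ih =>
    rw [pow_succ, pow_succ, mulOp_mul, ih]
    congr 1
    exact LinearMap.ext fun x => neg_one_mul x

lemma sum_DLW_eq_inversions : ∑ w : S.W, p.DLW w =
    S.mulOp p.cProd * ∑ w : S.W, (-1) ^ S.length w *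
      S.mulOp (∏ i ∈ S.inversions w⁻¹, S.X (D.mroot i)) * p.sigma w := by
  rw [sum_DLW, Finset.mul_sum]
  refine Finset.sum_congr rfl fun w _ => ?_
  rw [sumCoef, mulOp_mul, mulOp_mul, mulOp_neg_one_pow, mul_assoc]

lemma sum_DLW_eq_rho : ∑ w : S.W, p.DLW w =
    S.mulOp p.cProd * S.mulOp (S.X D.rho) * (∑ w : S.W, (-1) ^ S.length w * p.sigma w) *
      S.mulOp (S.X (-D.rho)) := by
  rw [sum_DLW_eq_inversions, mul_assoc (S.mulOp p.cProd), mul_assoc (S.mulOp p.cProd),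
    mul_assoc]
  congr 1
  rw [Finset.sum_mul, Finset.mul_sum]
  refine Finset.sum_congr rfl fun w _ => LinearMap.ext fun x => ?_
  rw [← mulOp_neg_one_pow]
  simp only [Module.End.mul_apply, mulOp_apply]
  rw [p.sigma_mul w (D.X_mem_Km (neg_mem D.rho_mem_Pm)), weylK_X, ← X_rho_sub_smul, smul_neg,
    sub_eq_add_neg, X_add]
  ring

lemma whittaker_eq (lam : S.P) : p.whittaker lam = ∑ w : S.W, p.DLW w (S.X (S.w₀ • lam)) := by
  rw [← LinearMap.sum_apply, sum_DLW_eq_inversions, whittaker, Module.End.mul_apply, mulOp_apply,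
    LinearMap.sum_apply]
  congr 1
  refine Finset.sum_congr rfl fun w _ => ?_
  rw [← mulOp_neg_one_pow]
  simp only [Module.End.mul_apply, mulOp_apply, mul_assoc]

end Parameters

end

end Metaplectic

/-- Demazure--Lusztig expression of the metaplectic Whittaker function. -/
theorem mainTheorem6 {ι E : Type*} [Fintype ι] [NormedAddCommGroup E] [InnerProductSpace ℝ E]
    (S : Metaplectic.BasedRootSystem ι E) (D : Metaplectic.MetaplecticStructure S)
    (p : Metaplectic.Parameters D) :
    -- the operators `σ(s_i)` define a representation of `W`, and `w ↦ σ(w)` is this representation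
    (∀ ω : List S.I, p.sigma (S.wordProd ω) = (ω.map p.sigmaSimple).prod) ∧
    -- the operators `τ(T_i)` are invertible
    (∀ i : S.I, IsUnit (p.tauT i)) ∧
    -- the operator `𝒯_w` does not depend on the reduced expression of `w`
    (∀ (w : S.W) (ω : List S.I), S.IsReducedWord ω w → p.DLW w = (ω.map p.DL).prod) ∧
    -- the two expressions of `∑_w 𝒯_w`
    (∑ w : S.W, p.DLW w =
      S.mulOp p.cProd * S.mulOp (S.X D.rho) * (∑ w : S.W, (-1) ^ S.length w * p.sigma w) *
        S.mulOp (S.X (-D.rho))) ∧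
    (∑ w : S.W, p.DLW w =
      S.mulOp p.cProd * ∑ w : S.W, (-1) ^ S.length w *
        S.mulOp (∏ i ∈ S.inversions w⁻¹, S.X (D.mroot i)) * p.sigma w) ∧
    -- the Whittaker function
    (∀ lam : S.P, S.IsDominant lam →
      p.whittaker lam = ∑ w : S.W, p.DLW w (S.X (S.w₀ • lam))) ∧
    -- polynomiality
    (∀ Lam : AddSubgroup E, S.rootLattice ≤ Lam → Lam ≤ S.weightLattice →
      ∀ lam : S.P, S.IsDominant lam → (lam : E) ∈ Lam →
        p.whittaker lam ∈ S.groupAlg Lam) := by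
  refine ⟨p.sigma_wordProd, p.isUnit_tauT, fun w ω h => p.DLW_eq h, p.sum_DLW_eq_rho,
    p.sum_DLW_eq_inversions, fun lam _ => p.whittaker_eq lam, fun Lam hQ _ lam _ hlam => ?_⟩
  rw [p.whittaker_eq]
  exact sum_mem fun w _ => p.DLW_mem_groupAlg hQ w
    (S.X_mem_groupAlg (S.smul_mem_of_rootLattice_le hQ _ hlam))
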